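/- Let $\mathcal Y$ be a (real or complex) Hilbert space and $A$ a normal operator on $\mathcal Y$ (densely defined, closed, $AA^*=A^*A$ as unbounded operators) which generates a strongly continuous semigroup $(e^{tA})_{t\ge 0}$. Let $\mathcal D\subset\mathcal Y$ be open and let $B\colon\mathcal D\to\mathcal Y$ be Lipschitz. For $m\in\mathbb N$ let $\mathbb P_m$ be the spectral projector of $A$ onto $\{\lambda\in\operatorname{spec}(A):|\lambda|\le m\}$; if $\mathcal Y$ is real, the spectrum and the spectral projector are those of the complexification of $A$, and $\mathbb P_m$ is the restriction of that projector to $\mathcal Y$. Let $T>0$ and let $U\in C([0,T],\mathcal D)$ be a mild solution of $\partial_tU=AU+B(U)$ with $U(0)=U^0$, i.e. $$U(t)=e^{tA}U^0+\int_0^t e^{(t-s)A}B(U(s))\,ds\qquad(0\le t\le T).$$ Then there is $m_*\in\mathbb N$ such that for every $m\ge m_*$ there exists a solution $u_m\in C([0,T],\mathcal D)$, with values in $\mathbb P_m\mathcal Y\cap D(A)$, of the projected system $$\dot u_m=Au_m+\mathbb P_mB(u_m)\ \text{ on }[0,T],\qquad u_m(0)=\mathbb P_mU^0 .$$ Moreover,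 for any such solutions $u_m$ ($m\ge m_*$), $$\sup_{t\in[0,T]}\|U(t)-u_m(t)\|_{\mathcal Y}\to 0\qquad\text{as } m\to\infty .$$ -/

import Mathlib

open Set Filter Topology MeasureTheory
open scoped NNReal ENNReal

noncomputable section

namespace Galerkin

/-! ### Unbounded operators, semigroups, solutions (real or complex Hilbert spaces) -/

section General

variable {𝕜 : Type*} [RCLike 𝕜] {Y : Type*} [NormedAddCommGroup Y] [InnerProductSpace 𝕜 Y]

/-- `IsCompValue S T x z`: the vector `x` lies in the domain of the product `S T`, that is
`x ∈ D(T)` and `T x ∈ D(S)`, and `S T x = z`. -/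
def IsCompValue (S T : Y →ₗ.[𝕜] Y) (x z : Y) : Prop :=
  ∃ y : Y, (x, y) ∈ T.graph ∧ (y, z) ∈ S.graph

/-- A normal operator: densely defined, closed, and `A A* = A* A` as unbounded operators
(equality of the domains included). -/
structure IsNormalOperator [CompleteSpace Y] (A : Y →ₗ.[𝕜] Y) : Prop where
  dense_domain : Dense (A.domain : Set Y)
  isClosed : A.IsClosed
  comm : ∀ x z : Y, IsCompValue A A.adjoint x z ↔ IsCompValue A.adjoint A x z

/-- The spectrum of an unbounded operator: the complement of the set of those `z` for which
`z - A : D(A) → Y` is bijective with bounded inverse `R`. -/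
def unboundedSpectrum (A : Y →ₗ.[𝕜] Y) : Set 𝕜 :=
  {z | ¬ ∃ R : Y →L[𝕜] Y,
    (∀ y : Y, ∃ h : R y ∈ A.domain, z • R y - A ⟨R y, h⟩ = y) ∧
    (∀ x : A.domain, R (z • (x : Y) - A x) = x)}

/-- A strongly continuous semigroup; only the values `S t` with `0 ≤ t` are relevant. -/
structure IsC0Semigroup (S : ℝ → Y →L[𝕜] Y) : Prop where
  map_zero : S 0 = ContinuousLinearMap.id 𝕜 Y
  map_add : ∀ s t : ℝ, 0 ≤ s → 0 ≤ t → S (s + t) = (S s).comp (S t)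
  tendsto_zero : ∀ x : Y, Tendsto (fun t : ℝ => S t x) (𝓝[>] 0) (𝓝 x)

variable [NormedSpace ℝ Y]

/-- `A` is the infinitesimal generator of `S`: the domain of `A` consists exactly of those `x`
for which `(S h x - x) / h` converges as `h ↓ 0`, and `A x` is the limit. -/
def IsGenerator (A : Y →ₗ.[𝕜] Y) (S : ℝ → Y →L[𝕜] Y) : Prop :=
  ∀ x y : Y, (x, y) ∈ A.graph ↔
    Tendsto (fun h : ℝ => h⁻¹ • (S h x - x)) (𝓝[>] 0) (𝓝 y)

/-- `U ∈ C([0,T], D)` is a mild solution of `U' = A U + B(U)`, `U(0) = U⁰`, where `S` is the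
semigroup generated by `A`. -/
structure IsMildSolution (S : ℝ → Y →L[𝕜] Y) (B : Y → Y) (D : Set Y) (T : ℝ) (U₀ : Y)
    (U : ℝ → Y) : Prop where
  continuousOn : ContinuousOn U (Icc 0 T)
  mapsTo : MapsTo U (Icc 0 T) D
  eq_duhamel : ∀ t ∈ Icc 0 T, U t = S t U₀ + ∫ s in (0 : ℝ)..t, S (t - s) (B (U s))

/-- `u ∈ C([0,T], D)` is a solution, with values in the range of the projector `P`, of the
projected system `u' = A u + P B(u)`, `u(0) = P U⁰` (one-sided derivatives at the end points). -/
structure IsProjectedSolution (A : Y →ₗ.[𝕜] Y) (B : Y → Y) (D : Set Y) (P : Y → Y) (T : ℝ)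
    (U₀ : Y) (u : ℝ → Y) : Prop where
  continuousOn : ContinuousOn u (Icc 0 T)
  mapsTo : MapsTo u (Icc 0 T) D
  mem_range : ∀ t ∈ Icc 0 T, P (u t) = u t
  initial : u 0 = P U₀
  equation : ∀ t ∈ Icc 0 T, ∃ h : u t ∈ A.domain,
    HasDerivWithinAt u (A ⟨u t, h⟩ + P (B (u t))) (Icc 0 T) t

end General

/-! ### Spectral projectors of normal operators on a complex Hilbert space -/

section Spectral

/-- A projection-valued measure on the Borel sets of `ℂ`. -/
structure ProjectionValuedMeasure (Y : Type*) [NormedAddCommGroup Y] [InnerProductSpace ℂ Y]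
    [CompleteSpace Y] where
  proj : Set ℂ → Y →L[ℂ] Y
  isStarProjection : ∀ s, MeasurableSet s → IsStarProjection (proj s)
  univ : proj univ = 1
  inter : ∀ s t, MeasurableSet s → MeasurableSet t → proj (s ∩ t) = proj s * proj t
  iUnion : ∀ f : ℕ → Set ℂ, (∀ i, MeasurableSet (f i)) → Pairwise (Function.onFun Disjoint f) →
    ∀ x : Y, HasSum (fun i => proj (f i) x) (proj (⋃ i, f i) x)

variable {Y : Type*} [NormedAddCommGroup Y] [InnerProductSpace ℂ Y] [CompleteSpace Y]

theorem inner_starProjection {p : Y →L[ℂ] Y} (hp : IsStarProjection p) (x : Y) :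
    inner ℂ x (p x) = ((‖p x‖ ^ 2 : ℝ) : ℂ) := by
  have h1 : p (p x) = p x := by
    have := congrArg (fun q : Y →L[ℂ] Y => q x) hp.isIdempotentElem
    simpa using this
  have h2 : ContinuousLinearMap.adjoint p = p := hp.isSelfAdjoint
  calc inner ℂ x (p x) = inner ℂ x (p (p x)) := by rw [h1]
    _ = inner ℂ x (ContinuousLinearMap.adjoint p (p x)) := by rw [h2]
    _ = inner ℂ (p x) (p x) := by rw [ContinuousLinearMap.adjoint_inner_right]
    _ = _ := by rw [inner_self_eq_norm_sq_to_K]; norm_cast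

/-- The finite positive measure `μ_x(s) = ⟨E(s) x, x⟩ = ‖E(s) x‖²`. -/
def ProjectionValuedMeasure.measure (E : ProjectionValuedMeasure Y) (x : Y) : Measure ℂ :=
  Measure.ofMeasurable (fun s _ => ENNReal.ofReal (‖E.proj s x‖ ^ 2))
    (by
      have h := E.iUnion (fun _ => ∅) (fun _ => MeasurableSet.empty)
        (fun _ _ _ => disjoint_bot_left) x
      have h0 := h.summable.tendsto_atTop_zero
      have h1 : E.proj ∅ x = 0 := tendsto_nhds_unique tendsto_const_nhds h0
      simp [h1])
    (by
      intro f hf hd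
      have h := (E.iUnion f hf hd x).mapL (innerSL ℂ x)
      simp only [innerSL_apply_apply] at h
      rw [inner_starProjection (E.isStarProjection _ (MeasurableSet.iUnion hf))] at h
      simp_rw [fun i => inner_starProjection (E.isStarProjection _ (hf i)) x] at h
      have h' := Complex.hasSum_ofReal.mp h
      rw [← h'.tsum_eq, ENNReal.ofReal_tsum_of_nonneg (fun i => by positivity) h'.summable])

/-- `E` is the spectral measure of `A`, that is `A = ∫ z dE(z)`: the domain of `A` is
`{x | ∫ |z|² dμ_x(z) < ∞}`, and `⟨A x, x⟩ = ∫ z dμ_x(z)` on this domain (in Mathlib the inner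
product is linear in its second argument). By polarization this determines `A`. -/
structure IsSpectralMeasure (A : Y →ₗ.[ℂ] Y) (E : ProjectionValuedMeasure Y) : Prop where
  mem_domain_iff : ∀ x : Y, x ∈ A.domain ↔ ∫⁻ z, ‖z‖ₑ ^ 2 ∂(E.measure x) < ∞
  inner_apply : ∀ x : A.domain, inner ℂ (x : Y) (A x) = ∫ z, z ∂(E.measure x)

open Classical in
/-- The spectral projector `E(s)` of `A` onto the Borel set `s`, `E` being the spectral measure
of `A` (which exists and is unique for a normal operator; the value is `0` for an operator that
has no spectral measure). -/
def spectralProjector (A : Y →ₗ.[ℂ] Y) (s : Set ℂ) : Y →L[ℂ] Y :=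
  if h : ∃ E : ProjectionValuedMeasure Y, IsSpectralMeasure A E then h.choose.proj s else 0

/-- The Galerkin projector `P_m`: the spectral projector of `A` onto
`{z ∈ spec A | |z| ≤ m}`. -/
def galerkinProjector (A : Y →ₗ.[ℂ] Y) (m : ℕ) : Y →L[ℂ] Y :=
  spectralProjector A {z | z ∈ unboundedSpectrum A ∧ ‖z‖ ≤ m}

end Spectral

/-! ### Real Hilbert spaces: complexification -/

section Real

/-- The complexification `Y ⊕ i Y` of a real Hilbert space `Y`; the pair `(a, b)` is `a + i b`,
and `‖a + i b‖² = ‖a‖² + ‖b‖²`. -/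
def Complexification (Y : Type*) : Type _ := WithLp 2 (Y × Y)

namespace Complexification

variable {Y : Type*}

/-- The vector `a + i b`. -/
def mk (a b : Y) : Complexification Y := WithLp.toLp 2 (a, b)

/-- The real part. -/
def re (z : Complexification Y) : Y := WithLp.fst (p := 2) (α := Y) (β := Y) z

/-- The imaginary part. -/
def im (z : Complexification Y) : Y := WithLp.snd (p := 2) (α := Y) (β := Y) z

@[simp] theorem re_mk (a b : Y) : (mk a b).re = a := rfl
@[simp] theorem im_mk (a b : Y) : (mk a b).im = b := rfl

theorem ext {z w : Complexification Y} (h1 : z.re = w.re) (h2 : z.im = w.im) : z = w :=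
  (WithLp.ofLp_injective 2) (Prod.ext h1 h2)

variable [NormedAddCommGroup Y]

instance : NormedAddCommGroup (Complexification Y) :=
  inferInstanceAs (NormedAddCommGroup (WithLp 2 (Y × Y)))

instance [CompleteSpace Y] : CompleteSpace (Complexification Y) :=
  inferInstanceAs (CompleteSpace (WithLp 2 (Y × Y)))

@[simp] theorem re_add (z w : Complexification Y) : (z + w).re = z.re + w.re := rfl
@[simp] theorem im_add (z w : Complexification Y) : (z + w).im = z.im + w.im := rfl
@[simp] theorem re_zero : (0 : Complexification Y).re = 0 := rfl
@[simp] theorem im_zero : (0 : Complexification Y).im = 0 := rfl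

theorem norm_sq (z : Complexification Y) : ‖z‖ ^ 2 = ‖z.re‖ ^ 2 + ‖z.im‖ ^ 2 :=
  WithLp.prod_norm_sq_eq_of_L2 (α := Y) (β := Y) z

variable [InnerProductSpace ℝ Y]

instance : SMul ℂ (Complexification Y) :=
  ⟨fun c z => mk (c.re • z.re - c.im • z.im) (c.re • z.im + c.im • z.re)⟩

@[simp] theorem re_smul (c : ℂ) (z : Complexification Y) :
    (c • z).re = c.re • z.re - c.im • z.im := rfl
@[simp] theorem im_smul (c : ℂ) (z : Complexification Y) :
    (c • z).im = c.re • z.im + c.im • z.re := rfl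

instance : Module ℂ (Complexification Y) where
  one_smul z := by apply ext <;> simp
  mul_smul c d z := by apply ext <;> simp <;> module
  smul_zero c := by apply ext <;> simp
  smul_add c z w := by apply ext <;> simp <;> module
  add_smul c d z := by apply ext <;> simp <;> module
  zero_smul z := by apply ext <;> simp

/-- `⟨a + i b, c + i d⟩ = ⟨a, c⟩ + ⟨b, d⟩ + i (⟨a, d⟩ - ⟨b, c⟩)`, conjugate linear in the first
argument. -/
instance : Inner ℂ (Complexification Y) :=
  ⟨fun z w => ⟨inner ℝ z.re w.re + inner ℝ z.im w.im, inner ℝ z.re w.im - inner ℝ z.im w.re⟩⟩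

theorem inner_def (z w : Complexification Y) : inner ℂ z w =
    (⟨inner ℝ z.re w.re + inner ℝ z.im w.im, inner ℝ z.re w.im - inner ℝ z.im w.re⟩ : ℂ) := rfl

theorem norm_smul_sq (c : ℂ) (z : Complexification Y) : ‖c • z‖ ^ 2 = (‖c‖ * ‖z‖) ^ 2 := by
  rw [mul_pow, norm_sq, norm_sq, Complex.sq_norm, Complex.normSq_apply, re_smul, im_smul,
    norm_sub_sq_real, norm_add_sq_real]
  simp only [norm_smul, mul_pow, Real.norm_eq_abs, sq_abs, inner_smul_left, inner_smul_right,
    real_inner_comm z.re z.im, conj_trivial]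
  ring

instance : InnerProductSpace ℂ (Complexification Y) where
  norm_smul_le c z := by
    refine le_of_eq ((sq_eq_sq₀ (by positivity) (by positivity)).mp (norm_smul_sq c z))
  norm_sq_eq_re_inner z := by
    rw [norm_sq, inner_def]
    simp
  conj_inner_symm z w := by
    simp only [inner_def]
    apply Complex.ext <;> simp [real_inner_comm]
  add_left z w v := by
    simp only [inner_def]
    apply Complex.ext <;> simp [inner_add_left] <;> ring
  smul_left z w c := by
    simp only [inner_def]
    apply Complex.ext <;>
      simp [inner_add_left, inner_sub_left, inner_smul_left] <;> ring

end Complexification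

variable {Y : Type*} [NormedAddCommGroup Y] [InnerProductSpace ℝ Y]

/-- The complexified operator `A (a + i b) = A a + i A b` with domain `D(A) + i D(A)`. -/
def complexifyOperator (A : Y →ₗ.[ℝ] Y) : Complexification Y →ₗ.[ℂ] Complexification Y where
  domain :=
    { carrier := {z | z.re ∈ A.domain ∧ z.im ∈ A.domain}
      add_mem' := fun hz hw =>
        ⟨A.domain.add_mem hz.1 hw.1, A.domain.add_mem hz.2 hw.2⟩
      zero_mem' := ⟨A.domain.zero_mem, A.domain.zero_mem⟩
      smul_mem' := fun c _ hz =>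
        ⟨A.domain.sub_mem (A.domain.smul_mem c.re hz.1) (A.domain.smul_mem c.im hz.2),
          A.domain.add_mem (A.domain.smul_mem c.re hz.2) (A.domain.smul_mem c.im hz.1)⟩ }
  toFun :=
    { toFun := fun z => Complexification.mk (A ⟨z.1.re, z.2.1⟩) (A ⟨z.1.im, z.2.2⟩)
      map_add' := fun z w => by
        apply Complexification.ext
        · exact A.map_add ⟨z.1.re, z.2.1⟩ ⟨w.1.re, w.2.1⟩
        · exact A.map_add ⟨z.1.im, z.2.2⟩ ⟨w.1.im, w.2.2⟩
      map_smul' := fun c z => by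
        apply Complexification.ext
        · exact (A.map_sub (c.re • ⟨z.1.re, z.2.1⟩) (c.im • ⟨z.1.im, z.2.2⟩)).trans
            (by rw [A.map_smul, A.map_smul])
        · exact (A.map_add (c.re • ⟨z.1.im, z.2.2⟩) (c.im • ⟨z.1.re, z.2.1⟩)).trans
            (by rw [A.map_smul, A.map_smul]) }

/-- The Galerkin projector of an operator on a real Hilbert space: the restriction to `Y` of the
Galerkin projector of the complexified operator (which maps `Y` into `Y`, since the set
`{z ∈ spec A | |z| ≤ m}` is symmetric with respect to complex conjugation). -/
def realGalerkinProjector [CompleteSpace Y] (A : Y →ₗ.[ℝ] Y) (m : ℕ) (x : Y) : Y :=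
  (galerkinProjector (complexifyOperator A) m (Complexification.mk x 0)).re

end Real

end Galerkin

end

/-! The analytic half needs only four facts about `P_m`: it is a contractive projection, it reduces
`A`, `G_m = A P_m` is bounded, and `P_m → 1` strongly. Then `P_m` commutes with `e^{tA}`, and
`e^{tA} = e^{tG_m}` on the range of `P_m`. Thus `P_m U` and `u_m` satisfy Duhamel formulas for the
same semigroup. If `η_m` bounds `‖U - P_m U‖` on `[0,T]` and `M` bounds `‖e^{tA}‖` there, Gronwall
gives `‖U - u_m‖ ≤ η_m exp((M L + 1) T)`. Since the orbit of `U` is compact, `η_m` can be taken to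
tend to zero.

Existence uses the same estimate. The nonlinearity is replaced by `B(U(t) + ρ(y - U(t)))`, with `ρ`
the radial retraction onto a small ball. This is globally Lipschitz and bounded, so the truncated
projected equation is solvable on all of `[0,T]`. For large `m` the estimate keeps its solution in
the tube about `U` where `ρ` is the identity (`exists_isCutoffSolution`,
`exists_forall_isCutoffSolution_and_tendsto`).

The operator-theoretic half provides the four facts. A generator has a bounded resolvent `R` at some
real point `a`, and normality of `A` makes `R` normal (`IsNormalOperator.isStarNormal_resolvent`).
The continuous functional calculus of `R`, extended to Borel functions through the Riesz theorem,
gives projections. Pushed forward by `w ↦ a - 1/w`, they form a spectral measure of `A`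
(`isSpectralMeasure_repPVM`). The Galerkin projector is defined by choosing some spectral measure;
this is harmless because `A` determines the projections onto closed sets
(`IsSpectralMeasure.proj_eq_of_isClosed`). Strong convergence holds because the complement of the
spectrum has projection zero.

On a real space everything is done in the complexification. Conjugating a spectral measure of the
complexified operator gives another one, so by uniqueness the projector commutes with conjugation
and restricts to the real space. -/

noncomputable section

namespace Galerkin

/-! ### Strongly continuous semigroups on real Banach spaces -/

section Semigroup

variable {Y : Type*} [NormedAddCommGroup Y] [NormedSpace ℝ Y]

/-- A strongly continuous semigroup on a real normed space. -/
structure IsStronglyContinuousSemigroup (S : ℝ → Y →L[ℝ] Y) : Prop where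
  map_zero : S 0 = ContinuousLinearMap.id ℝ Y
  map_add : ∀ s t : ℝ, 0 ≤ s → 0 ≤ t → S (s + t) = (S s).comp (S t)
  tendsto_zero : ∀ x : Y, Tendsto (fun t : ℝ => S t x) (𝓝[>] 0) (𝓝 x)

namespace IsStronglyContinuousSemigroup

variable {S : ℝ → Y →L[ℝ] Y} (hS : IsStronglyContinuousSemigroup S)

include hS

theorem map_zero_apply (x : Y) : S 0 x = x := by simp [hS.map_zero]

theorem map_add_apply {s t : ℝ} (hs : 0 ≤ s) (ht : 0 ≤ t) (x : Y) : S (s + t) x = S s (S t x) := by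
  simp [hS.map_add s t hs ht]

theorem tendsto_zero_right (x : Y) : Tendsto (fun t : ℝ => S t x) (𝓝[≥] 0) (𝓝 x) := by
  have h : ContinuousWithinAt (fun t : ℝ => S t x) (Ioi 0) 0 := by
    simpa [ContinuousWithinAt, hS.map_zero_apply] using hS.tendsto_zero x
  have := continuousWithinAt_Ioi_iff_Ici.mp h
  simpa [ContinuousWithinAt, hS.map_zero_apply] using this

/-- Otherwise there are `t n → 0` with `‖S (t n)‖ > n`, although every orbit is bounded along `t n`;
this contradicts Banach–Steinhaus. -/
theorem exists_norm_le_near_zero [CompleteSpace Y] :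
    ∃ δ > 0, ∃ M : ℝ, ∀ t ∈ Icc (0 : ℝ) δ, ‖S t‖ ≤ M := by
  by_contra! hcon
  choose t ht htn using fun n : ℕ => hcon (1 / ((n : ℝ) + 1)) (by positivity) n
  have ht0 : Tendsto t atTop (𝓝[≥] 0) := by
    refine tendsto_nhdsWithin_iff.mpr ⟨?_, Eventually.of_forall fun n => (ht n).1⟩
    exact squeeze_zero (fun n => (ht n).1) (fun n => (ht n).2)
      tendsto_one_div_add_atTop_nhds_zero_nat
  obtain ⟨C, hC⟩ := banach_steinhaus (g := fun n => S (t n)) (fun x => by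
    obtain ⟨C, hC⟩ := ((hS.tendsto_zero_right x).comp ht0).norm.bddAbove_range
    exact ⟨C, fun n => hC ⟨n, rfl⟩⟩)
  obtain ⟨n, hn⟩ := exists_nat_gt C
  exact absurd (htn n) (not_lt.mpr ((hC n).trans hn.le))

theorem exists_norm_le [CompleteSpace Y] (T : ℝ) :
    ∃ M : ℝ, 1 ≤ M ∧ ∀ t ∈ Icc (0 : ℝ) T, ‖S t‖ ≤ M := by
  obtain ⟨δ, hδ, M, hM⟩ := hS.exists_norm_le_near_zero
  have key : ∀ n : ℕ, ∃ C : ℝ, ∀ t ∈ Icc (0 : ℝ) (n * δ), ‖S t‖ ≤ C := by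
    intro n
    induction n with
    | zero =>
      refine ⟨M, fun t ht => hM t ⟨ht.1, ht.2.trans (by simpa using hδ.le)⟩⟩
    | succ n ih =>
      obtain ⟨C, hC⟩ := ih
      refine ⟨max M (M * C), fun t ht => ?_⟩
      rcases le_total t δ with h | h
      · exact (hM t ⟨ht.1, h⟩).trans (le_max_left _ _)
      · have h1 := hS.map_add δ (t - δ) hδ.le (by linarith)
        rw [add_sub_cancel] at h1
        rw [h1]
        refine (ContinuousLinearMap.opNorm_comp_le _ _).trans (le_trans ?_ (le_max_right _ _))
        have h2 : ‖S (t - δ)‖ ≤ C := hC _ ⟨by linarith, by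
          have := ht.2; push_cast at this; linarith⟩
        have h3 : ‖S δ‖ ≤ M := hM δ ⟨hδ.le, le_rfl⟩
        exact mul_le_mul h3 h2 (norm_nonneg _) ((norm_nonneg _).trans h3)
  obtain ⟨n, hn⟩ := exists_nat_ge (T / δ)
  obtain ⟨C, hC⟩ := key n
  exact ⟨max 1 C, le_max_left _ _, fun t ht =>
    (hC t ⟨ht.1, ht.2.trans ((div_le_iff₀ hδ).mp hn)⟩).trans (le_max_right _ _)⟩

/-- Continuity at `0` is carried to both sides of any `s` by factoring out the smaller time; the
uniform bound `M` is what handles the left side. -/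
theorem continuousOn_orbit [CompleteSpace Y] (x : Y) (T : ℝ) :
    ContinuousOn (fun t => S t x) (Icc 0 T) := by
  obtain ⟨M, hM1, hM⟩ := hS.exists_norm_le T
  have key : ∀ s ∈ Icc (0 : ℝ) T, ∀ t ∈ Icc (0 : ℝ) T,
      ‖S t x - S s x‖ ≤ M * ‖S |t - s| x - x‖ := by
    have aux : ∀ s ∈ Icc (0 : ℝ) T, ∀ t ∈ Icc (0 : ℝ) T, s ≤ t →
        ‖S t x - S s x‖ ≤ M * ‖S |t - s| x - x‖ := by
      intro s hs t ht hst
      have h1 := hS.map_add_apply hs.1 (sub_nonneg.mpr hst) x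
      rw [add_sub_cancel] at h1
      rw [abs_of_nonneg (sub_nonneg.mpr hst), h1, ← map_sub]
      exact (ContinuousLinearMap.le_opNorm _ _).trans
        (mul_le_mul_of_nonneg_right (hM s hs) (norm_nonneg _))
    intro s hs t ht
    rcases le_total s t with h | h
    · exact aux s hs t ht h
    · rw [norm_sub_rev, abs_sub_comm]; exact aux t ht s hs h
  intro s hs
  rw [ContinuousWithinAt, tendsto_iff_norm_sub_tendsto_zero]
  have h1 : Tendsto (fun t : ℝ => |t - s|) (𝓝[Icc 0 T] s) (𝓝[≥] 0) := by
    refine tendsto_nhdsWithin_iff.mpr ⟨?_, Eventually.of_forall fun t => mem_Ici.mpr (abs_nonneg _)⟩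
    have : Continuous fun t : ℝ => |t - s| := by fun_prop
    simpa using (this.tendsto s).mono_left nhdsWithin_le_nhds
  have h2 := ((((hS.tendsto_zero_right x).comp h1).sub_const x).norm).const_mul M
  simp only [sub_self, norm_zero, mul_zero] at h2
  refine squeeze_zero' (Eventually.of_forall fun _ => norm_nonneg _) ?_ h2
  filter_upwards [self_mem_nhdsWithin] with t ht using key s hs t ht

theorem continuousOn_uncurry [CompleteSpace Y] (T : ℝ) :
    ContinuousOn (fun p : ℝ × Y => S p.1 p.2) (Icc 0 T ×ˢ univ) := by
  obtain ⟨M, hM1, hM⟩ := hS.exists_norm_le T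
  refine continuousOn_prod_of_continuousOn_lipschitzOnWith' _ M.toNNReal (fun t ht => ?_)
    (fun x _ => hS.continuousOn_orbit x T)
  refine LipschitzWith.lipschitzOnWith ((S t).lipschitz.weaken ?_)
  rw [← NNReal.coe_le_coe, Real.coe_toNNReal _ (by linarith)]
  exact hM t ht

theorem continuousOn_convolution [CompleteSpace Y] {t : ℝ} {g : ℝ → Y}
    (hg : ContinuousOn g (Icc 0 t)) : ContinuousOn (fun s => S (t - s) (g s)) (Icc 0 t) := by
  refine (hS.continuousOn_uncurry t).comp (f := fun s => (t - s, g s)) ?_ ?_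
  · exact (continuousOn_const.sub continuousOn_id).prodMk hg
  · intro s hs
    exact ⟨⟨by linarith [hs.2], by linarith [hs.1]⟩, mem_univ _⟩

theorem hasDerivWithinAt_orbit {x y : Y} {t : ℝ} (ht : 0 ≤ t)
    (h : Tendsto (fun h : ℝ => h⁻¹ • (S h (S t x) - S t x)) (𝓝[>] 0) (𝓝 y)) :
    HasDerivWithinAt (fun t => S t x) y (Ici t) t := by
  rw [← hasDerivWithinAt_Ioi_iff_Ici, hasDerivWithinAt_iff_tendsto_slope' (by simp)]
  have h1 : Tendsto (fun r : ℝ => r - t) (𝓝[>] t) (𝓝[>] 0) := by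
    refine tendsto_nhdsWithin_iff.mpr ⟨?_, ?_⟩
    · have : Continuous fun r : ℝ => r - t := by fun_prop
      simpa using (this.tendsto t).mono_left nhdsWithin_le_nhds
    · filter_upwards [self_mem_nhdsWithin] with r hr using mem_Ioi.mpr (sub_pos.mpr (mem_Ioi.mp hr))
  refine (h.comp h1).congr' ?_
  filter_upwards [self_mem_nhdsWithin] with r hr
  have h2 := hS.map_add_apply (sub_nonneg.mpr (le_of_lt hr)) ht x
  rw [sub_add_cancel] at h2
  simp [slope, ← h2]

/-- The semigroup maps the domain of its generator into itself and commutes with it. -/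
theorem tendsto_generator_map {x y : Y} {t : ℝ} (ht : 0 ≤ t)
    (h : Tendsto (fun h : ℝ => h⁻¹ • (S h x - x)) (𝓝[>] 0) (𝓝 y)) :
    Tendsto (fun h : ℝ => h⁻¹ • (S h (S t x) - S t x)) (𝓝[>] 0) (𝓝 (S t y)) := by
  refine (((S t).continuous.tendsto y).comp h).congr' ?_
  filter_upwards [self_mem_nhdsWithin] with r hr
  have hr' : 0 ≤ r := le_of_lt hr
  simp only [Function.comp_apply, map_smul, map_sub]
  rw [← hS.map_add_apply hr' ht, ← hS.map_add_apply ht hr', add_comm]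

end IsStronglyContinuousSemigroup

end Semigroup

/-! ### Duhamel's formula for bounded generators -/

section Exponential

variable {Y : Type*} [NormedAddCommGroup Y] [NormedSpace ℝ Y] [CompleteSpace Y]

/-- The uniformly continuous group generated by a bounded operator. -/
def expGroup (G : Y →L[ℝ] Y) (t : ℝ) : Y →L[ℝ] Y := NormedSpace.exp (t • G)

variable (G : Y →L[ℝ] Y)

omit [CompleteSpace Y] in
theorem expGroup_zero : expGroup G 0 = 1 := by simp [expGroup]

theorem expGroup_add (s t : ℝ) : expGroup G (s + t) = expGroup G s * expGroup G t := by
  rw [expGroup, add_smul]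
  exact NormedSpace.exp_add_of_commute_of_mem_ball (𝕂 := ℝ)
    (((Commute.refl G).smul_left s).smul_right t)
    ((NormedSpace.expSeries_radius_eq_top ℝ (Y →L[ℝ] Y)).symm ▸ edist_lt_top _ _)
    ((NormedSpace.expSeries_radius_eq_top ℝ (Y →L[ℝ] Y)).symm ▸ edist_lt_top _ _)

theorem expGroup_add_apply (s t : ℝ) (x : Y) :
    expGroup G (s + t) x = expGroup G s (expGroup G t x) := by
  rw [expGroup_add]; rfl

omit [CompleteSpace Y] in
theorem expGroup_zero_apply (x : Y) : expGroup G 0 x = x := by simp [expGroup_zero]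

theorem expGroup_neg_apply (t : ℝ) (x : Y) : expGroup G (-t) (expGroup G t x) = x := by
  rw [← expGroup_add_apply, neg_add_cancel, expGroup_zero_apply]

theorem expGroup_apply_neg (t : ℝ) (x : Y) : expGroup G t (expGroup G (-t) x) = x := by
  rw [← expGroup_add_apply, add_neg_cancel, expGroup_zero_apply]

theorem hasDerivAt_expGroup (t : ℝ) : HasDerivAt (expGroup G) (G * expGroup G t) t :=
  hasDerivAt_exp_smul_const' G t

theorem hasDerivAt_expGroup' (t : ℝ) : HasDerivAt (expGroup G) (expGroup G t * G) t :=
  hasDerivAt_exp_smul_const G t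

theorem continuous_expGroup : Continuous (expGroup G) :=
  continuous_iff_continuousAt.mpr fun t => (hasDerivAt_expGroup G t).continuousAt

variable {G}

theorem hasDerivWithinAt_expGroup_apply {u : ℝ → Y} {u' : Y} {s : Set ℝ} {t : ℝ}
    (hu : HasDerivWithinAt u u' s t) :
    HasDerivWithinAt (fun r => expGroup G r (u r)) (G (expGroup G t (u t)) + expGroup G t u') s t := by
  have := (hasDerivAt_expGroup G t).hasDerivWithinAt.clm_apply hu (s := s)
  simpa using this

theorem hasDerivWithinAt_expGroup_neg_apply {u : ℝ → Y} {u' : Y} {s : Set ℝ} {t : ℝ}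
    (hu : HasDerivWithinAt u u' s t) :
    HasDerivWithinAt (fun r => expGroup G (-r) (u r)) (expGroup G (-t) (u' - G (u t))) s t := by
  have h1 : HasDerivAt (fun r => expGroup G (-r)) (-(expGroup G (-t) * G)) t := by
    have := (hasDerivAt_expGroup' G (-t)).scomp t (hasDerivAt_neg t)
    rwa [neg_one_smul] at this
  have := h1.hasDerivWithinAt.clm_apply hu (s := s)
  convert this using 1
  simp [sub_eq_neg_add]

/-- `e^{-tG} u(t)` has right derivative zero. One-sided derivatives are used because they are what
the generator yields along an orbit. -/
theorem eq_expGroup_of_hasDerivWithinAt_right {u : ℝ → Y} {T : ℝ} (hu : ContinuousOn u (Icc 0 T))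
    (hu' : ∀ t ∈ Ico 0 T, HasDerivWithinAt u (G (u t)) (Ici t) t) :
    ∀ t ∈ Icc 0 T, u t = expGroup G t (u 0) := by
  intro t ht
  have h1 := constant_of_has_deriv_right_zero (f := fun r => expGroup G (-r) (u r)) (a := 0) (b := T)
    (((continuous_expGroup G).comp continuous_neg).continuousOn.clm_apply hu)
    (fun s hs => by simpa using hasDerivWithinAt_expGroup_neg_apply (G := G) (hu' s hs)) t ht
  simp only [neg_zero, expGroup_zero_apply] at h1
  rw [← h1, expGroup_apply_neg]

/-- Variation of constants: `(e^{-sG} u(s))' = e^{-sG} g(s)` is integrated over `[0,t]` and `e^{tG}`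
is applied. -/
theorem eq_duhamel_of_hasDerivWithinAt {u g : ℝ → Y} {T : ℝ} (hg : ContinuousOn g (Icc 0 T))
    (hu : ∀ t ∈ Icc 0 T, HasDerivWithinAt u (G (u t) + g t) (Icc 0 T) t) :
    ∀ t ∈ Icc 0 T, u t = expGroup G t (u 0) + ∫ s in (0 : ℝ)..t, expGroup G (t - s) (g s) := by
  intro t ht
  have hsub : Icc 0 t ⊆ Icc 0 T := Icc_subset_Icc_right ht.2
  have hcont : ContinuousOn (fun s => expGroup G (-s) (g s)) (Icc 0 t) :=
    ((continuous_expGroup G).comp continuous_neg).continuousOn.clm_apply (hg.mono hsub)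
  have hderiv : ∀ s ∈ Icc 0 t, HasDerivWithinAt (fun r => expGroup G (-r) (u r))
      (expGroup G (-s) (g s)) (Icc 0 t) s := fun s hs => by
    simpa using hasDerivWithinAt_expGroup_neg_apply (G := G) ((hu s (hsub hs)).mono hsub)
  have h1 := intervalIntegral.integral_eq_sub_of_hasDeriv_right
    (f := fun r => expGroup G (-r) (u r)) (f' := fun s => expGroup G (-s) (g s)) (a := 0) (b := t)
    (by rw [uIcc_of_le ht.1]; exact fun s hs => (hderiv s hs).continuousWithinAt)
    (by
      rw [min_eq_left ht.1, max_eq_right ht.1]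
      exact fun s hs => ((hderiv s (Ioo_subset_Icc_self hs)).hasDerivAt
        (Icc_mem_nhds hs.1 hs.2)).hasDerivWithinAt)
    (ContinuousOn.intervalIntegrable (by rwa [uIcc_of_le ht.1]))
  simp only [neg_zero, expGroup_zero_apply] at h1
  have h2 : ∫ s in (0 : ℝ)..t, expGroup G (t - s) (g s) =
      expGroup G t (∫ s in (0 : ℝ)..t, expGroup G (-s) (g s)) := by
    rw [← ContinuousLinearMap.intervalIntegral_comp_comm _
      (ContinuousOn.intervalIntegrable (by rwa [uIcc_of_le ht.1]))]
    simp_rw [sub_eq_add_neg, expGroup_add_apply]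
  rw [h2, h1, map_sub, expGroup_apply_neg, add_sub_cancel]

end Exponential

/-! ### Spectral cut-offs of a semigroup -/

section Cutoff

variable {Y : Type*} [NormedAddCommGroup Y] [NormedSpace ℝ Y]

/-- `(x, y)` belongs to the graph of the infinitesimal generator of `S`. -/
def IsGeneratorPair (S : ℝ → Y →L[ℝ] Y) (x y : Y) : Prop :=
  Tendsto (fun h : ℝ => h⁻¹ • (S h x - x)) (𝓝[>] 0) (𝓝 y)

/-- A contractive projection `P` that reduces the generator `A` of `S`, with `A P = G` bounded. -/
structure IsSpectralCutoff (S : ℝ → Y →L[ℝ] Y) (P G : Y →L[ℝ] Y) : Prop where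
  norm_le : ∀ x, ‖P x‖ ≤ ‖x‖
  idem : ∀ x, P (P x) = P x
  isGeneratorPair : ∀ x, IsGeneratorPair S (P x) (G x)
  map_generator : ∀ x y, IsGeneratorPair S x y → P y = G x

namespace IsSpectralCutoff

variable {S : ℝ → Y →L[ℝ] Y} {P G : Y →L[ℝ] Y} (hP : IsSpectralCutoff S P G)

include hP

theorem generator_proj (x : Y) : G (P x) = G x := by
  have h := hP.isGeneratorPair (P x)
  rw [hP.idem] at h
  exact tendsto_nhds_unique h (hP.isGeneratorPair x)

theorem proj_generator (x : Y) : P (G x) = G x :=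
  (hP.map_generator _ _ (hP.isGeneratorPair x)).trans (hP.generator_proj x)

theorem proj_expGroup [CompleteSpace Y] (t : ℝ) (x : Y) :
    P (expGroup G t x) = expGroup G t (P x) := by
  have hcomm : Commute P G := by
    ext y
    exact (hP.proj_generator y).trans (hP.generator_proj y).symm
  have h : Commute P (expGroup G t) := (hcomm.smul_right t).exp_right
  exact congrArg (fun q : Y →L[ℝ] Y => q x) h.eq

/-- The curve `s ↦ S s e^{-sG} P z` is constant, since on the range of `P` the generators of the two
factors cancel. -/
theorem semigroup_proj [CompleteSpace Y] (hS : IsStronglyContinuousSemigroup S) {t : ℝ}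
    (ht : 0 ≤ t) (x : Y) : S t (P x) = expGroup G t (P x) := by
  have hE : Continuous fun s => expGroup G (-s) := (continuous_expGroup G).comp continuous_neg
  have key : ∀ z, S t (expGroup G (-t) (P z)) = P z := by
    intro z
    have hcont : ContinuousOn (fun s => S s (expGroup G (-s) (P z))) (Icc 0 t) := by
      refine (hS.continuousOn_uncurry t).comp (f := fun s => (s, expGroup G (-s) (P z))) ?_
        fun s hs => ⟨hs, mem_univ _⟩
      exact continuousOn_id.prodMk (hE.clm_apply continuous_const).continuousOn
    have h := constant_of_has_deriv_right_zero hcont (fun s hs => ?_) t ⟨ht, le_rfl⟩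
    · simpa [expGroup_zero_apply, hS.map_zero_apply] using h
    set w := expGroup G (-s) (P z) with hw
    have hPw : P w = w := by rw [hw, hP.proj_expGroup, hP.idem]
    rw [← hasDerivWithinAt_Ioi_iff_Ici, hasDerivWithinAt_iff_tendsto_slope' (by simp)]
    have h1 : Tendsto (fun r : ℝ => r - s) (𝓝[>] s) (𝓝[>] 0) := by
      refine tendsto_nhdsWithin_iff.mpr ⟨?_, ?_⟩
      · have : Continuous fun r : ℝ => r - s := by fun_prop
        simpa using (this.tendsto s).mono_left nhdsWithin_le_nhds
      · filter_upwards [self_mem_nhdsWithin] with r hr using mem_Ioi.mpr (sub_pos.mpr (mem_Ioi.mp hr))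
    have h2 : Tendsto (fun h : ℝ => h⁻¹ • (expGroup G (-h) w - w)) (𝓝[>] 0) (𝓝 (-(G w))) := by
      have h3 := (hasDerivWithinAt_expGroup_neg_apply (G := G)
        (hasDerivWithinAt_const (0 : ℝ) (Ioi 0) w))
      rw [hasDerivWithinAt_iff_tendsto_slope' (by simp)] at h3
      simpa [slope_fun_def, expGroup_zero_apply] using h3
    -- Joint continuity of `(h, y) ↦ S h y` allows `S h` to act on a quotient that itself varies
    -- with `h`.
    have h4 : Tendsto (fun h : ℝ => S h (h⁻¹ • (expGroup G (-h) w - w))) (𝓝[>] 0)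
        (𝓝 (-(G w))) := by
      have h5 := (hS.continuousOn_uncurry 1).continuousWithinAt (x := (0, -(G w)))
        ⟨⟨le_rfl, zero_le_one⟩, mem_univ _⟩
      have h6 : Tendsto (fun h : ℝ => (h, h⁻¹ • (expGroup G (-h) w - w))) (𝓝[>] 0)
          (𝓝[Icc 0 1 ×ˢ univ] (0, -(G w))) := by
        refine tendsto_nhdsWithin_iff.mpr ⟨?_, ?_⟩
        · exact (tendsto_id.mono_left nhdsWithin_le_nhds).prodMk_nhds h2
        · filter_upwards [Ioc_mem_nhdsGT (zero_lt_one (α := ℝ))] with r hr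
          exact ⟨⟨hr.1.le, hr.2⟩, mem_univ _⟩
      have h7 := h5.tendsto.comp h6
      simp only [hS.map_zero_apply] at h7
      exact h7
    have h8 : Tendsto (fun h : ℝ => h⁻¹ • (S h w - w)) (𝓝[>] 0) (𝓝 (G w)) := by
      have := hP.isGeneratorPair w
      rwa [hPw] at this
    -- With `h = r - s`, the increment of the curve is `S s` applied to `S h (e^{-hG} w - w) + (S h
    -- w - w)`, whose quotients tend to `-G w + G w = 0`.
    have h9 := (((S s).continuous.tendsto _).comp (h4.add h8)).comp h1
    rw [neg_add_cancel, map_zero] at h9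
    refine h9.congr' ?_
    filter_upwards [self_mem_nhdsWithin] with r hr
    have hr' : 0 ≤ r - s := (sub_pos.mpr (mem_Ioi.mp hr)).le
    have e1 : expGroup G (-r) (P z) = expGroup G (-(r - s)) w := by
      rw [hw, ← expGroup_add_apply]; congr 2; ring
    have e2 : ∀ y, S r y = S s (S (r - s) y) := fun y => by
      rw [← hS.map_add_apply hs.1 hr', add_sub_cancel]
    simp only [Function.comp_apply, slope_def_module, e1, e2]
    simp only [map_smul, map_sub, map_add]
    module
  have h := key (expGroup G t x)
  rwa [hP.proj_expGroup, expGroup_neg_apply] at h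

/-- For `x` in the domain of the generator, `v(s) = P S s x` solves `v' = G v`, so it equals `e^{sG}
P x = S s P x`; density extends this to all `x`. -/
theorem proj_semigroup [CompleteSpace Y] (hS : IsStronglyContinuousSemigroup S)
    (hd : Dense {x | ∃ y, IsGeneratorPair S x y}) {t : ℝ} (ht : 0 ≤ t) (x : Y) :
    P (S t x) = S t (P x) := by
  have h : (fun x => P (S t x)) = fun x => S t (P x) := by
    refine Continuous.ext_on hd (by fun_prop) (by fun_prop) ?_
    rintro x ⟨y, hxy⟩
    have h1 := eq_expGroup_of_hasDerivWithinAt_right (G := G) (T := t) (u := fun s => P (S s x))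
      (P.continuous.comp_continuousOn (hS.continuousOn_orbit x t)) (fun s hs => by
        have h2 := hS.tendsto_generator_map hs.1 hxy
        have h3 := P.hasFDerivAt.comp_hasDerivWithinAt s (hS.hasDerivWithinAt_orbit hs.1 h2)
        rwa [hP.map_generator _ _ h2, ← hP.generator_proj] at h3) t ⟨ht, le_rfl⟩
    simpa [hS.map_zero_apply, hP.semigroup_proj hS ht] using h1
  exact congrFun h x

end IsSpectralCutoff

end Cutoff

/-! ### Comparison of a mild solution with the solutions of the projected systems -/

section Comparison

variable {Y : Type*} [NormedAddCommGroup Y] [NormedSpace ℝ Y]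

/-- Integral form of Gronwall: the differential form is applied to the primitive of `φ`. -/
theorem le_mul_exp_of_le_add_integral {φ : ℝ → ℝ} {η K T : ℝ} (hη : 0 ≤ η) (hK : 0 < K)
    (hφ : ContinuousOn φ (Icc 0 T)) (hφ0 : ∀ t ∈ Icc 0 T, 0 ≤ φ t)
    (h : ∀ t ∈ Icc 0 T, φ t ≤ η + K * ∫ s in (0 : ℝ)..t, φ s) :
    ∀ t ∈ Icc 0 T, φ t ≤ η * Real.exp (K * T) := by
  intro t ht
  have hT : 0 ≤ T := ht.1.trans ht.2
  have hderiv : ∀ s ∈ Icc 0 T, HasDerivWithinAt (fun r => ∫ s in (0 : ℝ)..r, φ s) (φ s) (Icc 0 T) s := by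
    intro s hs
    have : Fact (s ∈ Icc 0 T) := ⟨hs⟩
    exact intervalIntegral.integral_hasDerivWithinAt_right
      (ContinuousOn.intervalIntegrable (hφ.mono (by
        rw [uIcc_of_le hs.1]; exact Icc_subset_Icc_right hs.2)))
      (hφ.stronglyMeasurableAtFilter_nhdsWithin measurableSet_Icc s) (hφ s hs)
  have hnn : ∀ s ∈ Icc 0 T, 0 ≤ ∫ s in (0 : ℝ)..s, φ s := fun s hs =>
    intervalIntegral.integral_nonneg hs.1 fun r hr => hφ0 r ⟨hr.1, hr.2.trans hs.2⟩
  have h1 := norm_le_gronwallBound_of_norm_deriv_right_le (f := fun r => ∫ s in (0 : ℝ)..r, φ s)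
    (f' := φ) (δ := 0) (K := K) (ε := η) (a := 0) (b := T)
    (fun s hs => (hderiv s hs).continuousWithinAt)
    (fun s hs => (hderiv s ⟨hs.1, hs.2.le⟩).mono_of_mem_nhdsWithin
      (mem_of_superset (Icc_mem_nhdsGE hs.2) (Icc_subset_Icc_left hs.1)))
    (by simp)
    (fun s hs => by
      have hs' : s ∈ Icc 0 T := ⟨hs.1, hs.2.le⟩
      rw [Real.norm_of_nonneg (hφ0 s hs'), Real.norm_of_nonneg (hnn s hs'), add_comm]
      exact h s hs') t ht
  rw [gronwallBound_of_K_ne_0 hK.ne', Real.norm_of_nonneg (hnn t ht), sub_zero] at h1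
  have h2 : Real.exp (K * t) ≤ Real.exp (K * T) :=
    Real.exp_le_exp.mpr (mul_le_mul_of_nonneg_left ht.2 hK.le)
  calc φ t ≤ η + K * (∫ s in (0 : ℝ)..t, φ s) := h t ht
    _ ≤ η + K * (0 * Real.exp (K * t) + η / K * (Real.exp (K * t) - 1)) := by gcongr
    _ = η * Real.exp (K * t) := by field_simp; ring
    _ ≤ η * Real.exp (K * T) := by gcongr

variable [CompleteSpace Y] {S : ℝ → Y →L[ℝ] Y} {P G : Y →L[ℝ] Y}

/-- `U - P U` costs `η`, while `P U - u` is the convolution of `S` with `P (b - g)`. The forcing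
terms `b` and `g` are left abstract so that the estimate serves both the original nonlinearity and
its truncation. -/
theorem norm_sub_le_of_projected_duhamel (hS : IsStronglyContinuousSemigroup S)
    (hP : IsSpectralCutoff S P G) (hd : Dense {x | ∃ y, IsGeneratorPair S x y})
    {T M η : ℝ} {L : ℝ≥0} {U₀ : Y} {U b g u : ℝ → Y} (hM1 : 1 ≤ M)
    (hM : ∀ t ∈ Icc 0 T, ‖S t‖ ≤ M) (hη : ∀ t ∈ Icc 0 T, ‖U t - P (U t)‖ ≤ η)
    (hU : ContinuousOn U (Icc 0 T)) (hb : ContinuousOn b (Icc 0 T))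
    (hUeq : ∀ t ∈ Icc 0 T, U t = S t U₀ + ∫ s in (0 : ℝ)..t, S (t - s) (b s))
    (hu : ContinuousOn u (Icc 0 T)) (hg : ContinuousOn g (Icc 0 T))
    (hueq : ∀ t ∈ Icc 0 T, u t = expGroup G t (P U₀) + ∫ s in (0 : ℝ)..t, expGroup G (t - s) (P (g s)))
    (hbg : ∀ t ∈ Icc 0 T, ‖b t - g t‖ ≤ L * ‖U t - u t‖) :
    ∀ t ∈ Icc 0 T, ‖U t - u t‖ ≤ η * Real.exp ((M * L + 1) * T) := by
  rcases lt_or_ge T 0 with hT | hT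
  · exact fun t ht => absurd (ht.1.trans ht.2) (not_le.mpr hT)
  have hη0 : 0 ≤ η := (norm_nonneg _).trans (hη 0 ⟨le_rfl, hT⟩)
  have hφ : ContinuousOn (fun t => ‖U t - u t‖) (Icc 0 T) := (hU.sub hu).norm
  -- The natural Gronwall constant is `M L`; adding `1` keeps it positive when `L = 0`.
  refine le_mul_exp_of_le_add_integral hη0 (by positivity) hφ (fun t _ => norm_nonneg _) ?_
  intro t ht
  have hsub : Icc 0 t ⊆ Icc 0 T := Icc_subset_Icc_right ht.2
  have hci : ∀ f : ℝ → Y, ContinuousOn f (Icc 0 T) →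
      IntervalIntegrable (fun s => S (t - s) (f s)) volume 0 t := fun f hf =>
    ContinuousOn.intervalIntegrable (by
      rw [uIcc_of_le ht.1]; exact hS.continuousOn_convolution (hf.mono hsub))
  have hPc : ∀ f : ℝ → Y, ContinuousOn f (Icc 0 T) → ContinuousOn (fun s => P (f s)) (Icc 0 T) :=
    fun f hf => P.continuous.comp_continuousOn hf
  have h1 : P (U t) = S t (P U₀) + ∫ s in (0 : ℝ)..t, S (t - s) (P (b s)) := by
    rw [hUeq t ht, map_add, hP.proj_semigroup hS hd ht.1,
      ← ContinuousLinearMap.intervalIntegral_comp_comm _ (hci b hb)]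
    congr 1
    refine intervalIntegral.integral_congr fun s hs => ?_
    rw [uIcc_of_le ht.1] at hs
    exact hP.proj_semigroup hS hd (sub_nonneg.mpr hs.2) _
  have h2 : u t = S t (P U₀) + ∫ s in (0 : ℝ)..t, S (t - s) (P (g s)) := by
    rw [hueq t ht, hP.semigroup_proj hS ht.1]
    congr 1
    refine intervalIntegral.integral_congr fun s hs => ?_
    rw [uIcc_of_le ht.1] at hs
    exact (hP.semigroup_proj hS (sub_nonneg.mpr hs.2) _).symm
  have h3 : P (U t) - u t = ∫ s in (0 : ℝ)..t, S (t - s) (P (b s - g s)) := by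
    rw [h1, h2, add_sub_add_left_eq_sub,
      ← intervalIntegral.integral_sub (hci _ (hPc b hb)) (hci _ (hPc g hg))]
    simp
  have hφi : IntervalIntegrable (fun s => ‖U s - u s‖) volume 0 t :=
    ContinuousOn.intervalIntegrable (by rw [uIcc_of_le ht.1]; exact hφ.mono hsub)
  have h4 : ‖P (U t) - u t‖ ≤ ∫ s in (0 : ℝ)..t, (M * L + 1) * ‖U s - u s‖ := by
    rw [h3]
    refine intervalIntegral.norm_integral_le_of_norm_le ht.1 ?_ (hφi.const_mul _)
    refine Eventually.of_forall fun s hs => ?_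
    have hs' : s ∈ Icc 0 T := ⟨hs.1.le, hs.2.trans ht.2⟩
    have h5 : ‖S (t - s)‖ ≤ M := hM _ ⟨sub_nonneg.mpr hs.2, by linarith [hs.1, ht.2]⟩
    calc ‖S (t - s) (P (b s - g s))‖ ≤ ‖S (t - s)‖ * ‖P (b s - g s)‖ :=
          ContinuousLinearMap.le_opNorm _ _
      _ ≤ M * (L * ‖U s - u s‖) :=
          mul_le_mul h5 ((hP.norm_le _).trans (hbg s hs')) (norm_nonneg _) (by linarith)
      _ ≤ (M * L + 1) * ‖U s - u s‖ := by nlinarith [norm_nonneg (U s - u s)]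
  rw [intervalIntegral.integral_const_mul] at h4
  calc ‖U t - u t‖ = ‖(U t - P (U t)) + (P (U t) - u t)‖ := by rw [sub_add_sub_cancel]
    _ ≤ ‖U t - P (U t)‖ + ‖P (U t) - u t‖ := norm_add_le _ _
    _ ≤ _ := add_le_add (hη t ht) h4

end Comparison

/-! ### Radial retraction onto a ball -/

section Retraction

variable {Y : Type*} [NormedAddCommGroup Y] [NormedSpace ℝ Y]

/-- The radial retraction onto the closed ball of radius `r` about the origin. -/
def radialRetraction (r : ℝ) (v : Y) : Y := (r / max r ‖v‖) • v

theorem radialRetraction_of_norm_le {r : ℝ} (hr : 0 < r) {v : Y} (hv : ‖v‖ ≤ r) :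
    radialRetraction r v = v := by
  rw [radialRetraction, max_eq_left hv, div_self hr.ne', one_smul]

theorem norm_radialRetraction {r : ℝ} (hr : 0 < r) (v : Y) :
    ‖radialRetraction r v‖ = r / max r ‖v‖ * ‖v‖ := by
  rw [radialRetraction, norm_smul, Real.norm_of_nonneg]
  have : 0 < max r ‖v‖ := lt_max_of_lt_left hr
  positivity

theorem norm_radialRetraction_le {r : ℝ} (hr : 0 < r) (v : Y) : ‖radialRetraction r v‖ ≤ r := by
  have h : 0 < max r ‖v‖ := lt_max_of_lt_left hr
  rw [norm_radialRetraction hr, div_mul_eq_mul_div, div_le_iff₀ h]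
  exact mul_le_mul_of_nonneg_left (le_max_right _ _) hr.le

theorem norm_radialRetraction_le_norm {r : ℝ} (hr : 0 < r) (v : Y) :
    ‖radialRetraction r v‖ ≤ ‖v‖ := by
  rw [norm_radialRetraction hr]
  exact mul_le_of_le_one_left (norm_nonneg _)
    ((div_le_one (lt_max_of_lt_left hr)).mpr (le_max_left _ _))

/-- The difference splits into a scaled `v - w` and a change of scaling factor on `w`, each of norm
at most `‖v - w‖`. The constant `2` holds in every normed space and is all that is needed. -/
theorem lipschitzWith_radialRetraction {r : ℝ} (hr : 0 < r) :
    LipschitzWith 2 (radialRetraction r : Y → Y) := by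
  refine LipschitzWith.of_dist_le_mul fun v w => ?_
  rw [dist_eq_norm, dist_eq_norm]
  have hv : 0 < max r ‖v‖ := lt_max_of_lt_left hr
  have hw : 0 < max r ‖w‖ := lt_max_of_lt_left hr
  have e : radialRetraction r v - radialRetraction r w =
      (r / max r ‖v‖) • (v - w) + (r / max r ‖v‖ - r / max r ‖w‖) • w := by
    simp only [radialRetraction]; module
  have h1 : ‖(r / max r ‖v‖) • (v - w)‖ ≤ ‖v - w‖ := by
    rw [norm_smul, Real.norm_of_nonneg (by positivity)]
    exact mul_le_of_le_one_left (norm_nonneg _) ((div_le_one hv).mpr (le_max_left _ _))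
  have h2 : ‖(r / max r ‖v‖ - r / max r ‖w‖) • w‖ ≤ ‖v - w‖ := by
    have e2 : r / max r ‖v‖ - r / max r ‖w‖ =
        (r / max r ‖v‖) * (max r ‖w‖ - max r ‖v‖) / max r ‖w‖ := by field_simp
    rw [norm_smul, e2, norm_div, norm_mul, Real.norm_of_nonneg (by positivity : 0 ≤ r / max r ‖v‖),
      Real.norm_of_nonneg hw.le, div_mul_eq_mul_div, div_le_iff₀ hw]
    have h3 : ‖max r ‖w‖ - max r ‖v‖‖ ≤ ‖v - w‖ := by
      rw [norm_sub_rev v w]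
      have := abs_max_sub_max_le_max r ‖w‖ r ‖v‖
      rw [sub_self, abs_zero, max_eq_right (abs_nonneg (‖w‖ - ‖v‖))] at this
      exact this.trans (abs_norm_sub_norm_le _ _)
    have h4 : r / max r ‖v‖ ≤ 1 := (div_le_one hv).mpr (le_max_left _ _)
    calc r / max r ‖v‖ * ‖max r ‖w‖ - max r ‖v‖‖ * ‖w‖ ≤ 1 * ‖v - w‖ * max r ‖w‖ := by
          gcongr
          exact le_max_right _ _
      _ = ‖v - w‖ * max r ‖w‖ := by ring
  rw [e]
  refine (norm_add_le _ _).trans ?_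
  have : ((2 : ℝ≥0) : ℝ) = 2 := rfl
  rw [this]
  linarith

end Retraction

/-! ### Existence and convergence for abstract spectral cut-offs. -/

section Convergence

variable {Y : Type*} [NormedAddCommGroup Y] [NormedSpace ℝ Y] [CompleteSpace Y]

/-- A bounded Lipschitz perturbation of a bounded linear equation is globally solvable. -/
theorem exists_solution_of_bounded_lipschitz (G : Y →L[ℝ] Y) {F : ℝ → Y → Y} {T : ℝ} (hT : 0 ≤ T)
    {K C : ℝ≥0} (hlip : ∀ t ∈ Icc 0 T, LipschitzWith K (F t))
    (hcont : ∀ x, ContinuousOn (fun t => F t x) (Icc 0 T))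
    (hbound : ∀ t ∈ Icc 0 T, ∀ x, ‖F t x‖ ≤ C) (x₀ : Y) :
    ∃ u : ℝ → Y, u 0 = x₀ ∧
      ∀ t ∈ Icc 0 T, HasDerivWithinAt u (G (u t) + F t (u t)) (Icc 0 T) t := by
  obtain ⟨N, hN⟩ : ∃ N : ℝ≥0, ∀ t ∈ Icc (-T) T, ‖expGroup G t‖ ≤ N := by
    obtain ⟨N, hN⟩ := isCompact_Icc.exists_bound_of_continuousOn
      (continuous_expGroup G).continuousOn (s := Icc (-T) T)
    exact ⟨N.toNNReal, fun t ht => (hN t ht).trans (Real.le_coe_toNNReal N)⟩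
  have hN1 : ∀ t ∈ Icc 0 T, ‖expGroup G t‖ ≤ N := fun t ht => hN t ⟨by linarith [ht.1], ht.2⟩
  have hN2 : ∀ t ∈ Icc 0 T, ‖expGroup G (-t)‖ ≤ N := fun t ht =>
    hN (-t) ⟨by linarith [ht.2], by linarith [ht.1, ht.2]⟩
  have hFc : ContinuousOn (fun p : ℝ × Y => F p.1 p.2) (Icc 0 T ×ˢ univ) :=
    continuousOn_prod_of_continuousOn_lipschitzOnWith' _ K
      (fun t ht => (hlip t ht).lipschitzOnWith) fun x _ => hcont x
  -- In the variable `w = e^{-tG} u` the linear term disappears and the field is bounded by `N C`. A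
  -- ball of radius `N C T` therefore suffices for Picard–Lindelöf on the whole interval.
  have hpl : IsPicardLindelof (fun t w => expGroup G (-t) (F t (expGroup G t w)))
      (tmin := 0) (tmax := T) ⟨0, le_rfl, hT⟩ x₀ (N * C * T.toNNReal) 0 (N * C) (N * (K * N)) := by
    refine ⟨fun t ht => ?_, fun x _ => ?_, fun t ht x _ => ?_, ?_⟩
    · refine LipschitzWith.lipschitzOnWith ?_
      exact ((expGroup G (-t)).lipschitz.weaken (hN2 t ht)).comp
        ((hlip t ht).comp ((expGroup G t).lipschitz.weaken (hN1 t ht)))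
    · refine ((continuous_expGroup G).comp continuous_neg).continuousOn.clm_apply ?_
      refine hFc.comp (f := fun t => (t, expGroup G t x)) ?_ fun t ht => ⟨ht, mem_univ _⟩
      exact continuousOn_id.prodMk ((continuous_expGroup G).clm_apply continuous_const).continuousOn
    · refine (ContinuousLinearMap.le_opNorm _ _).trans ?_
      rw [NNReal.coe_mul]
      exact mul_le_mul (hN2 t ht) (hbound t ht _) (norm_nonneg _) N.coe_nonneg
    · simp [hT]
  obtain ⟨w, hw0, hw⟩ := hpl.exists_eq_forall_mem_Icc_hasDerivWithinAt₀
  refine ⟨fun t => expGroup G t (w t), ?_, fun t ht => ?_⟩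
  · simpa [expGroup_zero_apply] using hw0
  · have := hasDerivWithinAt_expGroup_apply (G := G) (hw t ht)
    simpa [expGroup_apply_neg] using this

/-- A solution of the projected system, formulated with the bounded operator `G = A P`. -/
structure IsCutoffSolution (P G : Y →L[ℝ] Y) (B : Y → Y) (D : Set Y) (T : ℝ) (U₀ : Y)
    (u : ℝ → Y) : Prop where
  mapsTo : MapsTo u (Icc 0 T) D
  mem_range : ∀ t ∈ Icc 0 T, P (u t) = u t
  initial : u 0 = P U₀
  equation : ∀ t ∈ Icc 0 T, HasDerivWithinAt u (G (u t) + P (B (u t))) (Icc 0 T) t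

-- Strong convergence of contractions is uniform on compact sets, by the `ε/3` argument with a
-- finite net.
omit [CompleteSpace Y] in
theorem tendstoUniformlyOn_of_norm_le {P : ℕ → Y →L[ℝ] Y} (hP : ∀ m x, ‖P m x‖ ≤ ‖x‖)
    (hlim : ∀ x, Tendsto (fun m => P m x) atTop (𝓝 x)) {K : Set Y} (hK : IsCompact K) {ε : ℝ}
    (hε : 0 < ε) : ∀ᶠ m in atTop, ∀ x ∈ K, ‖x - P m x‖ ≤ ε := by
  obtain ⟨t, -, htf, htK⟩ := hK.finite_cover_balls (e := ε / 3) (by positivity)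
  have h1 : ∀ᶠ m in atTop, ∀ y ∈ t, ‖y - P m y‖ < ε / 3 := by
    rw [eventually_all_finite htf]
    intro y _
    have := ((hlim y).const_sub y).norm
    rw [sub_self, norm_zero] at this
    exact this.eventually (gt_mem_nhds (by positivity))
  filter_upwards [h1] with m hm x hx
  obtain ⟨y, hy, hxy⟩ := mem_iUnion₂.mp (htK hx)
  rw [Metric.mem_ball, dist_eq_norm] at hxy
  have e : x - P m x = (x - y) + (y - P m y) - P m (x - y) := by rw [map_sub]; abel
  rw [e]
  calc _ ≤ ‖x - y‖ + ‖y - P m y‖ + ‖P m (x - y)‖ :=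
        (norm_sub_le _ _).trans (add_le_add_left (norm_add_le _ _) _)
    _ ≤ ε / 3 + ε / 3 + ε / 3 :=
        add_le_add (add_le_add hxy.le (hm y hy).le) ((hP m _).trans hxy.le)
    _ = ε := by ring

theorem IsCutoffSolution.norm_sub_le {S : ℝ → Y →L[ℝ] Y} {P G : Y →L[ℝ] Y}
    (hS : IsStronglyContinuousSemigroup S)
    (hP : IsSpectralCutoff S P G) (hd : Dense {x | ∃ y, IsGeneratorPair S x y})
    {T M η : ℝ} {L : ℝ≥0} {U₀ : Y} {U u : ℝ → Y} {B : Y → Y} {D : Set Y} (hM1 : 1 ≤ M)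
    (hM : ∀ t ∈ Icc 0 T, ‖S t‖ ≤ M) (hη : ∀ t ∈ Icc 0 T, ‖U t - P (U t)‖ ≤ η)
    (hB : LipschitzOnWith L B D)
    (hU : ContinuousOn U (Icc 0 T)) (hUD : MapsTo U (Icc 0 T) D)
    (hUeq : ∀ t ∈ Icc 0 T, U t = S t U₀ + ∫ s in (0 : ℝ)..t, S (t - s) (B (U s)))
    (hu : IsCutoffSolution P G B D T U₀ u) :
    ∀ t ∈ Icc 0 T, ‖U t - u t‖ ≤ η * Real.exp ((M * L + 1) * T) := by
  have huc : ContinuousOn u (Icc 0 T) := fun t ht => (hu.equation t ht).continuousWithinAt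
  have hg : ContinuousOn (fun t => B (u t)) (Icc 0 T) := hB.continuousOn.comp huc hu.mapsTo
  refine norm_sub_le_of_projected_duhamel hS hP hd hM1 hM hη hU (hB.continuousOn.comp hU hUD)
    hUeq huc hg ?_ fun t ht => hB.norm_sub_le (hUD ht) (hu.mapsTo ht)
  have := eq_duhamel_of_hasDerivWithinAt (P.continuous.comp_continuousOn hg) hu.equation
  rwa [hu.initial] at this

/-- The equation is solved with the nonlinearity truncated outside the tube of radius `r` about `U`;
`hηr` makes the a priori estimate confine the solution to that tube, where the truncation is
inactive. -/
theorem exists_isCutoffSolution {S : ℝ → Y →L[ℝ] Y} {P G : Y →L[ℝ] Y}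
    (hS : IsStronglyContinuousSemigroup S)
    (hP : IsSpectralCutoff S P G) (hd : Dense {x | ∃ y, IsGeneratorPair S x y})
    {T M η r : ℝ} {L : ℝ≥0} {U₀ : Y} {U : ℝ → Y} {B : Y → Y} {D : Set Y} (hT : 0 ≤ T) (hM1 : 1 ≤ M)
    (hM : ∀ t ∈ Icc 0 T, ‖S t‖ ≤ M) (hη : ∀ t ∈ Icc 0 T, ‖U t - P (U t)‖ ≤ η)
    (hB : LipschitzOnWith L B D)
    (hU : ContinuousOn U (Icc 0 T)) (hUD : MapsTo U (Icc 0 T) D)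
    (hUeq : ∀ t ∈ Icc 0 T, U t = S t U₀ + ∫ s in (0 : ℝ)..t, S (t - s) (B (U s)))
    (hr : 0 < r) (hrD : ∀ t ∈ Icc 0 T, ∀ y, ‖y - U t‖ ≤ r → y ∈ D)
    (hηr : η * Real.exp ((M * L + 1) * T) ≤ r) :
    ∃ u, IsCutoffSolution P G B D T U₀ u := by
  have hmem : ∀ t ∈ Icc 0 T, ∀ y, U t + radialRetraction r (y - U t) ∈ D := fun t ht y =>
    hrD t ht _ (by rw [add_sub_cancel_left]; exact norm_radialRetraction_le hr _)
  set f : ℝ → Y → Y := fun t y => B (U t + radialRetraction r (y - U t)) with hf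
  have hBU : ContinuousOn (fun t => B (U t)) (Icc 0 T) := hB.continuousOn.comp hU hUD
  obtain ⟨b, hb⟩ := isCompact_Icc.exists_bound_of_continuousOn hBU
  have hfbU : ∀ t ∈ Icc 0 T, ∀ y, ‖B (U t) - f t y‖ ≤ L * ‖radialRetraction r (y - U t)‖ := by
    intro t ht y
    have := hB.norm_sub_le (hUD ht) (hmem t ht y)
    rwa [sub_add_cancel_left, norm_neg] at this
  have hfb : ∀ t ∈ Icc 0 T, ∀ y, ‖f t y‖ ≤ b + L * r := by
    intro t ht y
    calc ‖f t y‖ = ‖B (U t) - (B (U t) - f t y)‖ := by rw [sub_sub_cancel]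
      _ ≤ ‖B (U t)‖ + ‖B (U t) - f t y‖ := norm_sub_le _ _
      _ ≤ b + L * r := add_le_add (hb t ht) ((hfbU t ht y).trans
          (mul_le_mul_of_nonneg_left (norm_radialRetraction_le hr _) L.coe_nonneg))
  have hflip : ∀ t ∈ Icc 0 T, LipschitzWith (L * 2) (f t) := by
    intro t ht
    have h1 : LipschitzWith 2 (fun y => U t + radialRetraction r (y - U t)) := by
      refine LipschitzWith.of_dist_le_mul fun x y => ?_
      have := (lipschitzWith_radialRetraction hr).dist_le_mul (x - U t) (y - U t)
      simpa using this
    rw [← lipschitzOnWith_univ] at h1 ⊢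
    exact hB.comp h1 fun y _ => hmem t ht y
  have hfc : ∀ v : ℝ → Y, ContinuousOn v (Icc 0 T) → ContinuousOn (fun t => f t (v t)) (Icc 0 T) := by
    intro v hv
    refine hB.continuousOn.comp (f := fun t => U t + radialRetraction r (v t - U t)) ?_
      fun t ht => hmem t ht _
    exact hU.add ((lipschitzWith_radialRetraction hr).continuous.comp_continuousOn (hv.sub hU))
  have hP1 : LipschitzWith 1 P := LipschitzWith.of_dist_le_mul fun x y => by
    simpa [dist_eq_norm] using hP.norm_le (x - y)
  obtain ⟨u, hu0, hu⟩ := exists_solution_of_bounded_lipschitz G (F := fun t y => P (f t y))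
    (K := 1 * (L * 2)) (C := (b + L * r).toNNReal) hT (fun t ht => hP1.comp (hflip t ht))
    (fun x => P.continuous.comp_continuousOn (hfc _ continuousOn_const))
    (fun t ht x => (hP.norm_le _).trans ((hfb t ht x).trans (Real.le_coe_toNNReal _))) (P U₀)
  have huc : ContinuousOn u (Icc 0 T) := fun t ht => (hu t ht).continuousWithinAt
  have hfu := hfc u huc
  have hduh := eq_duhamel_of_hasDerivWithinAt (P.continuous.comp_continuousOn hfu) hu
  rw [hu0] at hduh
  simp only [Function.comp_apply] at hduh
  -- The comparison applies with the original constant `L`: the retraction shortens vectors, so `‖B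
  -- (U s) - f s (u s)‖ ≤ L ‖U s - u s‖`.
  have hclose : ∀ t ∈ Icc 0 T, ‖U t - u t‖ ≤ r := fun t ht =>
    (norm_sub_le_of_projected_duhamel hS hP hd hM1 hM hη hU hBU hUeq huc hfu hduh
      (fun s hs => (hfbU s hs _).trans (by
        rw [norm_sub_rev (U s)]
        exact mul_le_mul_of_nonneg_left (norm_radialRetraction_le_norm hr _) L.coe_nonneg)) t
      ht).trans hηr
  have hfB : ∀ t ∈ Icc 0 T, f t (u t) = B (u t) := fun t ht => by
    simp only [hf]
    rw [radialRetraction_of_norm_le hr (by rw [norm_sub_rev]; exact hclose t ht), add_sub_cancel]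
  refine ⟨u, fun t ht => hrD t ht _ (by rw [norm_sub_rev]; exact hclose t ht), fun t ht => ?_, hu0,
    fun t ht => ?_⟩
  -- The solution stays in the range of `P` because every term of its Duhamel formula is fixed by
  -- `P`.
  · have hint : IntervalIntegrable (fun s => expGroup G (t - s) (P (f s (u s)))) volume 0 t := by
      refine ContinuousOn.intervalIntegrable ?_
      rw [uIcc_of_le ht.1]
      exact ((continuous_expGroup G).comp (continuous_const.sub continuous_id)).continuousOn.clm_apply
        ((P.continuous.comp_continuousOn hfu).mono (Icc_subset_Icc_right ht.2))
    rw [hduh t ht, map_add, hP.proj_expGroup, hP.idem,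
      ← ContinuousLinearMap.intervalIntegral_comp_comm _ hint]
    simp_rw [hP.proj_expGroup, hP.idem]
  · rw [← hfB t ht]; exact hu t ht

/-- Convergence of the projected solutions, for abstract spectral cut-offs. -/
theorem exists_forall_isCutoffSolution_and_tendsto {S : ℝ → Y →L[ℝ] Y} {P G : ℕ → Y →L[ℝ] Y}
    (hS : IsStronglyContinuousSemigroup S) (hP : ∀ m, IsSpectralCutoff S (P m) (G m))
    (hlim : ∀ x, Tendsto (fun m => P m x) atTop (𝓝 x))
    (hd : Dense {x | ∃ y, IsGeneratorPair S x y})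
    {T : ℝ} {L : ℝ≥0} {U₀ : Y} {U : ℝ → Y} {B : Y → Y} {D : Set Y} (hT : 0 < T) (hD : IsOpen D)
    (hB : LipschitzOnWith L B D)
    (hU : ContinuousOn U (Icc 0 T)) (hUD : MapsTo U (Icc 0 T) D)
    (hUeq : ∀ t ∈ Icc 0 T, U t = S t U₀ + ∫ s in (0 : ℝ)..t, S (t - s) (B (U s))) :
    ∃ mstar : ℕ, (∀ m ≥ mstar, ∃ u, IsCutoffSolution (P m) (G m) B D T U₀ u) ∧
      ∀ u : ℕ → ℝ → Y, (∀ m ≥ mstar, IsCutoffSolution (P m) (G m) B D T U₀ (u m)) →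
        Tendsto (fun m => ⨆ t : Icc (0 : ℝ) T, ‖U t - u m t‖) atTop (𝓝 0) := by
  obtain ⟨M, hM1, hM⟩ := hS.exists_norm_le T
  have hK : IsCompact (U '' Icc 0 T) := isCompact_Icc.image_of_continuousOn hU
  -- Compactness of the orbit gives one radius `r` for the whole tube inside the open set `D`.
  obtain ⟨r, hr, hrD⟩ := hK.exists_cthickening_subset_open hD hUD.image_subset
  have hrD' : ∀ t ∈ Icc 0 T, ∀ y, ‖y - U t‖ ≤ r → y ∈ D := fun t ht y hy =>
    hrD (Metric.mem_cthickening_of_dist_le y (U t) r _ (mem_image_of_mem U ht)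
      (by rwa [dist_eq_norm]))
  have hC : 0 < Real.exp ((M * L + 1) * T) := Real.exp_pos _
  have hunif : ∀ ε > 0, ∀ᶠ m in atTop, ∀ t ∈ Icc 0 T,
      ‖U t - P m (U t)‖ ≤ ε / Real.exp ((M * L + 1) * T) := fun ε hε => by
    filter_upwards [tendstoUniformlyOn_of_norm_le (fun m => (hP m).norm_le) hlim hK
      (div_pos hε hC)] with m hm t ht using hm _ (mem_image_of_mem U ht)
  obtain ⟨mstar, hmstar⟩ := eventually_atTop.mp (hunif r hr)
  refine ⟨mstar, fun m hm => ?_, fun u hu => ?_⟩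
  · exact exists_isCutoffSolution hS (hP m) hd hT.le hM1 hM (hmstar m hm) hB hU hUD hUeq hr hrD'
      (div_mul_cancel₀ _ hC.ne').le
  · rw [Metric.tendsto_nhds]
    intro ε hε
    filter_upwards [hunif (ε / 2) (by positivity), eventually_ge_atTop mstar] with m hm hmm
    have h1 : ⨆ t : Icc (0 : ℝ) T, ‖U t - u m t‖ ≤ ε / 2 :=
      Real.iSup_le (fun t => by
        have := (hu m hmm).norm_sub_le hS (hP m) hd hM1 hM hm hB hU hUD hUeq t t.2
        rwa [div_mul_cancel₀ _ hC.ne'] at this) (by positivity)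
    have h2 : 0 ≤ ⨆ t : Icc (0 : ℝ) T, ‖U t - u m t‖ := Real.iSup_nonneg fun t => norm_nonneg _
    rw [Real.dist_eq, sub_zero, abs_of_nonneg h2]
    linarith

end Convergence

/-! ### The resolvent of a generator -/

section Resolvent

namespace IsStronglyContinuousSemigroup

variable {Y : Type*} [NormedAddCommGroup Y] [NormedSpace ℝ Y] {S : ℝ → Y →L[ℝ] Y}

theorem rescale (hS : IsStronglyContinuousSemigroup S) (a : ℝ) :
    IsStronglyContinuousSemigroup fun t => Real.exp (-a * t) • S t where
  map_zero := by simp [hS.map_zero]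
  map_add s t hs ht := by
    ext x
    simp [hS.map_add s t hs ht, mul_add, Real.exp_add, mul_smul, smul_comm (Real.exp (-(a * s)))]
  tendsto_zero x := by
    have h : Tendsto (fun t : ℝ => Real.exp (-a * t)) (𝓝[>] 0) (𝓝 1) := by
      have : Continuous fun t : ℝ => Real.exp (-a * t) := by fun_prop
      simpa using (this.tendsto 0).mono_left nhdsWithin_le_nhds
    simpa using h.smul (hS.tendsto_zero x)

theorem _root_.Galerkin.IsGeneratorPair.rescale {a : ℝ} {x y : Y}
    (h : IsGeneratorPair S x y) :
    IsGeneratorPair (fun t => Real.exp (-a * t) • S t) x (y - a • x) := by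
  have h1 : Tendsto (fun t : ℝ => t⁻¹ • (Real.exp (-a * t) - 1)) (𝓝[>] 0) (𝓝 (-a)) := by
    have h2 : HasDerivAt (fun t : ℝ => Real.exp (-a * t)) (-a) 0 := by
      simpa using ((hasDerivAt_id (0 : ℝ)).const_mul (-a)).exp
    have := (hasDerivWithinAt_iff_tendsto_slope' (by simp)).mp
      (h2.hasDerivWithinAt (s := Ioi (0 : ℝ)))
    simpa [slope_fun_def] using this
  have h3 : Tendsto (fun t : ℝ => Real.exp (-a * t)) (𝓝[>] 0) (𝓝 1) := by
    have : Continuous fun t : ℝ => Real.exp (-a * t) := by fun_prop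
    simpa using (this.tendsto 0).mono_left nhdsWithin_le_nhds
  have h4 := (h3.smul h).add (h1.smul_const x)
  rw [one_smul, neg_smul, ← sub_eq_add_neg] at h4
  refine h4.congr fun t => ?_
  simp only [_root_.smul_apply, smul_eq_mul]
  module

/-- With `F r = ∫₀^r S s x`, the semigroup law gives `S h (F 1) = F (1 + h) - F h`, so the quotient
tends to `F' 1 - F' 0`. -/
theorem isGeneratorPair_integral [CompleteSpace Y] (hS : IsStronglyContinuousSemigroup S) (x : Y) :
    IsGeneratorPair S (∫ s in (0 : ℝ)..1, S s x) (S 1 x - x) := by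
  -- The interval `[0, 2]` leaves room for right increments at `1`.
  have hc := hS.continuousOn_orbit x 2
  have hint : ∀ a ∈ Icc (0 : ℝ) 2, ∀ b ∈ Icc (0 : ℝ) 2,
      IntervalIntegrable (fun s => S s x) volume a b := fun a ha b hb =>
    ContinuousOn.intervalIntegrable (hc.mono (uIcc_subset_Icc ha hb))
  set F : ℝ → Y := fun r => ∫ s in (0 : ℝ)..r, S s x with hF
  have hderiv : ∀ r ∈ Ico (0 : ℝ) 2, Tendsto (fun h : ℝ => h⁻¹ • (F (r + h) - F r)) (𝓝[>] 0)
      (𝓝 (S r x)) := by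
    intro r hr
    have hr' : r ∈ Icc (0 : ℝ) 2 := ⟨hr.1, hr.2.le⟩
    have : Fact (r ∈ Icc (0 : ℝ) 2) := ⟨hr'⟩
    have h1 : HasDerivWithinAt F (S r x) (Icc 0 2) r :=
      intervalIntegral.integral_hasDerivWithinAt_right
        (hint 0 (by simp) r hr') (hc.stronglyMeasurableAtFilter_nhdsWithin measurableSet_Icc r)
        (hc r hr')
    have h2 : HasDerivWithinAt F (S r x) (Ioi r) r := (h1.mono_of_mem_nhdsWithin
      (mem_of_superset (Icc_mem_nhdsGE hr.2) (Icc_subset_Icc_left hr.1)) :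
        HasDerivWithinAt F (S r x) (Ici r) r).mono Ioi_subset_Ici_self
    rw [hasDerivWithinAt_iff_tendsto_slope' (by simp)] at h2
    have h3 : Tendsto (fun h : ℝ => r + h) (𝓝[>] 0) (𝓝[>] r) := by
      refine tendsto_nhdsWithin_iff.mpr ⟨?_, ?_⟩
      · have : Continuous fun h : ℝ => r + h := by fun_prop
        simpa using (this.tendsto 0).mono_left nhdsWithin_le_nhds
      · filter_upwards [self_mem_nhdsWithin] with h hh
        exact mem_Ioi.mpr (lt_add_of_pos_right r hh)
    refine (h2.comp h3).congr fun h => ?_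
    simp [slope_def_module]
  have h4 := (hderiv 1 (by norm_num)).sub (hderiv 0 (by norm_num))
  rw [hS.map_zero_apply] at h4
  refine h4.congr' ?_
  filter_upwards [Ioc_mem_nhdsGT (zero_lt_one (α := ℝ))] with h hh
  have hshift : S h (F 1) = F (1 + h) - F h := by
    rw [hF, ← ContinuousLinearMap.intervalIntegral_comp_comm _ (hint 0 (by norm_num) 1 (by norm_num)),
      intervalIntegral.integral_interval_sub_left (hint _ (by norm_num) _ ⟨by linarith [hh.1], by linarith [hh.2]⟩)
        (hint _ (by norm_num) _ ⟨hh.1.le, by linarith [hh.2]⟩)]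
    have : ∫ s in h..1 + h, S s x = ∫ s in (0 : ℝ)..1, S (s + h) x := by
      rw [intervalIntegral.integral_comp_add_right (fun s => S s x), zero_add]
    rw [this]
    refine intervalIntegral.integral_congr fun s hs => ?_
    rw [uIcc_of_le zero_le_one] at hs
    rw [add_comm, hS.map_add_apply hh.1.le hs.1]
  have hF0 : F 0 = 0 := by simp [hF]
  change _ = h⁻¹ • (S h (F 1) - F 1)
  rw [hshift, ← smul_sub, zero_add, hF0]
  congr 1
  abel

theorem eq_of_isGeneratorPair_zero [CompleteSpace Y] (hS : IsStronglyContinuousSemigroup S) {x : Y}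
    (h : IsGeneratorPair S x 0) : S 1 x = x := by
  have := constant_of_has_deriv_right_zero (hS.continuousOn_orbit x 1) (fun s hs => by
    have := hS.hasDerivWithinAt_orbit hs.1 (hS.tendsto_generator_map hs.1 h)
    rwa [_root_.map_zero] at this) 1 ⟨zero_le_one, le_rfl⟩
  rwa [hS.map_zero_apply] at this

/-- No Laplace transform is needed. With `a = ‖S 1‖`, the rescaled semigroup `V t = e^{-at} S t` has
`‖V 1‖ ≤ a e^{-a} < 1`, so `1 - V 1` is invertible. Since `A - a` maps `∫₀¹ V s v` to `V 1 v - v`,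
the choice `v = (1 - V 1)⁻¹ y` solves `(a - A) x = y`. The difference of two solutions is fixed by
`V 1`, hence zero. -/
theorem exists_existsUnique_isGeneratorPair [CompleteSpace Y]
    (hS : IsStronglyContinuousSemigroup S) :
    ∃ a : ℝ, ∀ y, ∃! x, IsGeneratorPair S x (a • x - y) := by
  set a : ℝ := ‖S 1‖ with ha
  refine ⟨a, ?_⟩
  have hS' := hS.rescale a
  set V : ℝ → Y →L[ℝ] Y := fun t => Real.exp (-a * t) • S t with hV
  have hback : ∀ x y, IsGeneratorPair V x y → IsGeneratorPair S x (y + a • x) := by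
    intro x y h
    have := h.rescale (a := -a)
    have e : (fun t => Real.exp (- -a * t) • V t) = S := by
      funext t
      simp [hV, smul_smul, ← Real.exp_add]
    rwa [e, neg_smul, sub_neg_eq_add] at this
  have hN : ‖V 1‖ < 1 := by
    simp only [hV, mul_one]
    rw [norm_smul, Real.norm_of_nonneg (Real.exp_pos _).le, ← ha, Real.exp_neg,
      inv_mul_lt_iff₀ (Real.exp_pos _), mul_one]
    linarith [Real.add_one_le_exp a]
  intro y
  obtain ⟨u, hu⟩ := isUnit_one_sub_of_norm_lt_one hN
  have huy : ∀ z, (u : Y →L[ℝ] Y) z = z - V 1 z := fun z => by rw [hu]; rfl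
  have hinv : ∀ z, (u : Y →L[ℝ] Y) ((↑u⁻¹ : Y →L[ℝ] Y) z) = z := fun z =>
    congrArg (fun q : Y →L[ℝ] Y => q z) u.mul_inv
  refine ⟨∫ s in (0 : ℝ)..1, V s ((↑u⁻¹ : Y →L[ℝ] Y) y), ?_, ?_⟩
  · have h1 := hback _ _ (hS'.isGeneratorPair_integral ((↑u⁻¹ : Y →L[ℝ] Y) y))
    convert h1 using 1
    have := (huy ((↑u⁻¹ : Y →L[ℝ] Y) y)).symm.trans (hinv y)
    rw [← sub_eq_zero] at this ⊢
    rw [← neg_zero, ← this]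
    abel
  · intro x hx
    have h1 := hback _ _ (hS'.isGeneratorPair_integral ((↑u⁻¹ : Y →L[ℝ] Y) y))
    set x' := ∫ s in (0 : ℝ)..1, V s ((↑u⁻¹ : Y →L[ℝ] Y) y) with hx'
    have hx1 := hx.rescale (a := a)
    have h2 := hS'.isGeneratorPair_integral ((↑u⁻¹ : Y →L[ℝ] Y) y)
    have h3 : IsGeneratorPair V (x - x') 0 := by
      have h4 := Tendsto.sub hx1 h2
      have e : a • x - y - a • x - (V 1 ((↑u⁻¹ : Y →L[ℝ] Y) y) - (↑u⁻¹ : Y →L[ℝ] Y) y) = 0 := by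
        have := (huy ((↑u⁻¹ : Y →L[ℝ] Y) y)).symm.trans (hinv y)
        rw [← sub_eq_zero] at this
        rw [← this]
        abel
      rw [e] at h4
      refine h4.congr fun t => ?_
      rw [map_sub, ← smul_sub]
      congr 1
      abel
    have h5 := hS'.eq_of_isGeneratorPair_zero h3
    have h6 : (u : Y →L[ℝ] Y) (x - x') = 0 := by rw [huy, h5, sub_self]
    have h7 : (↑u⁻¹ : Y →L[ℝ] Y) ((u : Y →L[ℝ] Y) (x - x')) = x - x' :=
      congrArg (fun q : Y →L[ℝ] Y => q (x - x')) u.inv_mul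
    rw [h6, _root_.map_zero] at h7
    exact (sub_eq_zero.mp h7.symm)

end IsStronglyContinuousSemigroup

variable {𝕜 : Type*} [RCLike 𝕜] {Y : Type*} [NormedAddCommGroup Y] [InnerProductSpace 𝕜 Y]

theorem mem_graph_iff_exists {A : Y →ₗ.[𝕜] Y} {x y : Y} :
    (x, y) ∈ A.graph ↔ ∃ h : x ∈ A.domain, A ⟨x, h⟩ = y := by
  rw [LinearPMap.mem_graph_iff]
  constructor
  · rintro ⟨⟨_, h⟩, rfl, h2⟩
    exact ⟨h, h2⟩
  · rintro ⟨h, h2⟩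
    exact ⟨⟨x, h⟩, rfl, h2⟩

/-- `R` is the bounded inverse of `z - A`. -/
def IsResolvent (A : Y →ₗ.[𝕜] Y) (z : 𝕜) (R : Y →L[𝕜] Y) : Prop :=
  (∀ y : Y, ∃ h : R y ∈ A.domain, z • R y - A ⟨R y, h⟩ = y) ∧
    ∀ x : A.domain, R (z • (x : Y) - A x) = x

/-- Boundedness is the closed graph theorem: the graph of the inverse is a continuous preimage of
the graph of `A`. -/
theorem exists_isResolvent_of_existsUnique [CompleteSpace Y] {A : Y →ₗ.[𝕜] Y} (hA : A.IsClosed) {z : 𝕜}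
    (h : ∀ y, ∃! x, (x, z • x - y) ∈ A.graph) : ∃ R, IsResolvent A z R := by
  choose r hr hru using h
  let R : Y →ₗ[𝕜] Y :=
    { toFun := r
      map_add' := fun y y' => by
        refine (hru (y + y') (r y + r y') ?_).symm
        have := A.graph.add_mem (hr y) (hr y')
        convert this using 1
        simp only [Prod.mk_add_mk, Prod.mk.injEq, true_and]
        module
      map_smul' := fun c y => by
        refine (hru (c • y) (c • r y) ?_).symm
        have := A.graph.smul_mem c (hr y)
        convert this using 1
        simp only [Prod.smul_mk, Prod.mk.injEq, true_and]
        module }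
  have hR : Continuous R := by
    refine LinearMap.continuous_of_isClosed_graph R ?_
    have e : (R.graph : Set (Y × Y)) = (fun p : Y × Y => (p.2, z • p.2 - p.1)) ⁻¹' (A.graph : Set (Y × Y)) := by
      ext ⟨y, x⟩
      simp only [SetLike.mem_coe, LinearMap.mem_graph_iff, mem_preimage]
      exact ⟨fun h => by rw [h]; exact hr y, fun h => hru y x h⟩
    rw [e]
    exact hA.preimage (by fun_prop)
  refine ⟨⟨R, hR⟩, fun y => ?_, fun x => ?_⟩
  · obtain ⟨hd, he⟩ := mem_graph_iff_exists.mp (hr y)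
    exact ⟨hd, (congrArg (z • r y - ·) he).trans (sub_sub_cancel _ _)⟩
  · refine (hru _ _ ?_).symm
    simp

variable [NormedSpace ℝ Y] [IsScalarTower ℝ 𝕜 Y]

theorem IsC0Semigroup.restrictScalars {S : ℝ → Y →L[𝕜] Y} (hS : IsC0Semigroup S) :
    IsStronglyContinuousSemigroup fun t => (S t).restrictScalars ℝ where
  map_zero := by ext; simp [hS.map_zero]
  map_add s t hs ht := by ext; simp [hS.map_add s t hs ht]
  tendsto_zero := hS.tendsto_zero

theorem exists_isResolvent [CompleteSpace Y] {A : Y →ₗ.[𝕜] Y} {S : ℝ → Y →L[𝕜] Y} (hcl : A.IsClosed)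
    (hS : IsC0Semigroup S) (hA : IsGenerator A S) : ∃ a : ℝ, ∃ R, IsResolvent A (a : 𝕜) R := by
  obtain ⟨a, ha⟩ := hS.restrictScalars.exists_existsUnique_isGeneratorPair
  refine ⟨a, exists_isResolvent_of_existsUnique hcl fun y => ?_⟩
  have e : ∀ x : Y, (a : 𝕜) • x = a • x := fun x => by
    rw [← algebraMap_smul 𝕜 a x]
  have e2 : (fun x => (x, (a : 𝕜) • x - y) ∈ A.graph) = fun x =>
      IsGeneratorPair (fun t => (S t).restrictScalars ℝ) x (a • x - y) := by
    funext x
    rw [e]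
    exact propext (hA x _)
  rw [e2]
  exact ha y

end Resolvent

/-! ### Normality of the resolvent of a normal operator -/

section NormalResolvent

variable {𝕜 : Type*} [RCLike 𝕜] {Y : Type*} [NormedAddCommGroup Y] [InnerProductSpace 𝕜 Y]

/-- Stated through graphs so that `A` and its adjoint become two subspaces of `Y × Y` whose roles
can be exchanged. -/
theorem mem_adjoint_graph_iff [CompleteSpace Y] {A : Y →ₗ.[𝕜] Y} (hA : Dense (A.domain : Set Y)) {x y : Y} :
    (x, y) ∈ A.adjoint.graph ↔ ∀ u v, (u, v) ∈ A.graph → inner 𝕜 v x = inner 𝕜 u y := by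
  rw [mem_graph_iff_exists]
  constructor
  · rintro ⟨h, rfl⟩ u v huv
    obtain ⟨hu, rfl⟩ := mem_graph_iff_exists.mp huv
    have := LinearPMap.adjoint_isFormalAdjoint hA ⟨x, h⟩ ⟨u, hu⟩
    rw [← inner_conj_symm, ← this, inner_conj_symm]
  · intro h
    have h' : ∀ u : A.domain, inner 𝕜 y (u : Y) = inner 𝕜 x (A u) := fun u => by
      rw [← inner_conj_symm, ← h _ _ (A.mem_graph u), inner_conj_symm]
    have hx : x ∈ A.adjoint.domain := LinearPMap.mem_adjoint_domain_of_exists x ⟨y, h'⟩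
    exact ⟨hx, LinearPMap.adjoint_apply_eq hA ⟨x, hx⟩ h'⟩

theorem IsResolvent.apply_eq {A : Y →ₗ.[𝕜] Y} {z : 𝕜} {R : Y →L[𝕜] Y} (hR : IsResolvent A z R)
    {u v : Y} (h : (u, v) ∈ A.graph) : R (z • u - v) = u := by
  obtain ⟨hu, rfl⟩ := mem_graph_iff_exists.mp h
  exact hR.2 ⟨u, hu⟩

theorem IsResolvent.mem_graph {A : Y →ₗ.[𝕜] Y} {z : 𝕜} {R : Y →L[𝕜] Y} (hR : IsResolvent A z R)
    (y : Y) : (R y, z • R y - y) ∈ A.graph := by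
  obtain ⟨h, he⟩ := hR.1 y
  refine mem_graph_iff_exists.mpr ⟨h, ?_⟩
  rw [← sub_sub_cancel (z • R y) (A ⟨R y, h⟩), he]

variable [CompleteSpace Y]

theorem IsResolvent.adjoint_mem_graph {A : Y →ₗ.[𝕜] Y} (hA : Dense (A.domain : Set Y)) {z : 𝕜}
    {R : Y →L[𝕜] Y} (hR : IsResolvent A z R) (q : Y) :
    (R.adjoint q, star z • R.adjoint q - q) ∈ A.adjoint.graph := by
  rw [mem_adjoint_graph_iff hA]
  intro u v huv
  have h1 := hR.apply_eq huv
  rw [map_sub, map_smul, sub_eq_iff_eq_add] at h1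
  have h2 : R v = z • R u - u := by rw [h1]; abel
  rw [ContinuousLinearMap.adjoint_inner_right, h2, inner_sub_right, inner_smul_right,
    ContinuousLinearMap.adjoint_inner_right, inner_sub_left, inner_smul_left]
  rfl

/-- This is `A** ⊆ A`. Testing against the vectors `R* q`, which lie in the domain of `A*`, gives `w
= R (z w - y)`. -/
theorem IsResolvent.mem_graph_of_forall_adjoint {A : Y →ₗ.[𝕜] Y} (hA : Dense (A.domain : Set Y))
    {z : 𝕜} {R : Y →L[𝕜] Y} (hR : IsResolvent A z R) {w y : Y}
    (h : ∀ u v, (u, v) ∈ A.adjoint.graph → inner 𝕜 v w = inner 𝕜 u y) : (w, y) ∈ A.graph := by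
  have h1 : w = R (z • w - y) := by
    refine ext_inner_left 𝕜 fun q => ?_
    have h2 := h _ _ (hR.adjoint_mem_graph hA q)
    rw [inner_sub_left, inner_smul_left, ContinuousLinearMap.adjoint_inner_left,
      ContinuousLinearMap.adjoint_inner_left, sub_eq_iff_eq_add] at h2
    rw [map_sub, map_smul, inner_sub_right, inner_smul_right]
    have h3 : (starRingEnd 𝕜) (star z) = z := star_star z
    rw [h3] at h2
    rw [h2]
    ring
  have h4 := hR.mem_graph (z • w - y)
  rwa [← h1, sub_sub_cancel] at h4

/-- If the graphs `𝒜` and `ℬ` are adjoint to each other, `1 + ℬ 𝒜` is onto. -/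
theorem exists_mem_mem_add_eq {𝒜 ℬ : Submodule 𝕜 (Y × Y)} (h𝒜 : IsClosed (𝒜 : Set (Y × Y)))
    (hℬ : ∀ x y, (x, y) ∈ ℬ ↔ ∀ u v, (u, v) ∈ 𝒜 → inner 𝕜 v x = inner 𝕜 u y) (w : Y) :
    ∃ x y z, (x, y) ∈ 𝒜 ∧ (y, z) ∈ ℬ ∧ x + z = w := by
  let K : Submodule 𝕜 (WithLp 2 (Y × Y)) := 𝒜.comap (WithLp.linearEquiv 2 𝕜 (Y × Y)).toLinearMap
  have hK : IsClosed (K : Set (WithLp 2 (Y × Y))) :=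
    h𝒜.preimage (WithLp.prod_continuous_ofLp 2 Y Y)
  have : CompleteSpace K := hK.completeSpace_coe
  -- Von Neumann's argument: if `(x, y)` is the projection of `(w, 0)` onto the graph `𝒜`, the
  -- remainder `(w - x, -y)` is orthogonal to `𝒜`, which says exactly that `(y, w - x) ∈ ℬ`.
  set v : WithLp 2 (Y × Y) := WithLp.toLp 2 (w, 0) with hv
  set p := K.starProjection v with hp
  have hpK : p ∈ K := K.starProjection_apply_mem v
  have horth : v - p ∈ Kᗮ := K.sub_starProjection_mem_orthogonal v
  have hpK' : (p.fst, p.snd) ∈ 𝒜 := hpK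
  refine ⟨p.fst, p.snd, w - p.fst, hpK', ?_, by abel⟩
  rw [hℬ]
  intro a b hab
  have h1 := (Submodule.mem_orthogonal K _).mp horth (WithLp.toLp 2 (a, b)) hab
  rw [WithLp.prod_inner_apply] at h1
  have h2 : inner 𝕜 a (w - p.fst) + inner 𝕜 b (0 - p.snd) = 0 := h1
  rw [zero_sub, inner_neg_right, add_neg_eq_zero] at h2
  exact h2.symm

/-- Let the graphs `𝒜` and `ℬ` be adjoint to each other with `𝒜 ℬ = ℬ 𝒜`. Then the domain of `𝒜`
is contained in that of `ℬ`, and the norms of the images agree. -/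
theorem exists_mem_norm_eq_of_comm {𝒜 ℬ : Submodule 𝕜 (Y × Y)} (h𝒜 : IsClosed (𝒜 : Set (Y × Y)))
    (hℬc : IsClosed (ℬ : Set (Y × Y)))
    (h𝒜0 : ∀ y, (0, y) ∈ 𝒜 → y = 0) (hℬ0 : ∀ y, (0, y) ∈ ℬ → y = 0)
    (hℬ : ∀ x y, (x, y) ∈ ℬ ↔ ∀ u v, (u, v) ∈ 𝒜 → inner 𝕜 v x = inner 𝕜 u y)
    (hcomm : ∀ x z, (∃ y, (x, y) ∈ 𝒜 ∧ (y, z) ∈ ℬ) → ∃ y, (x, y) ∈ ℬ ∧ (y, z) ∈ 𝒜)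
    {x y : Y} (hxy : (x, y) ∈ 𝒜) : ∃ y', (x, y') ∈ ℬ ∧ ‖y'‖ = ‖y‖ := by
  -- `N` is the graph of `𝒜` restricted to the domain of `ℬ 𝒜`. There, with `z = ℬ 𝒜 x = 𝒜 ℬ x`,
  -- both `‖𝒜 x‖²` and `‖ℬ x‖²` equal `⟨x, z⟩`. It remains to see that this restriction is a core.
  let N : Submodule 𝕜 (WithLp 2 (Y × Y)) :=
    { carrier := {p | (p.fst, p.snd) ∈ 𝒜 ∧ ∃ z, (p.snd, z) ∈ ℬ}
      add_mem' := by
        rintro p q ⟨h1, z, h2⟩ ⟨h3, w, h4⟩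
        exact ⟨𝒜.add_mem h1 h3, z + w, ℬ.add_mem h2 h4⟩
      zero_mem' := ⟨𝒜.zero_mem, 0, ℬ.zero_mem⟩
      smul_mem' := by
        rintro c p ⟨h1, z, h2⟩
        exact ⟨𝒜.smul_mem c h1, c • z, ℬ.smul_mem c h2⟩ }
  have hN : ∀ p ∈ N, ∃ y', (p.fst, y') ∈ ℬ ∧ ‖y'‖ = ‖p.snd‖ := by
    rintro p ⟨h1, z, h2⟩
    obtain ⟨y', h3, h4⟩ := hcomm p.fst z ⟨_, h1, h2⟩
    refine ⟨y', h3, ?_⟩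
    have e1 := (hℬ _ _).mp h3 _ _ h4
    have e2 := (hℬ _ _).mp h2 _ _ h1
    have e3 : inner 𝕜 y' y' = inner 𝕜 p.snd p.snd := by
      rw [← e1, e2, ← inner_conj_symm, ← e2, inner_conj_symm]
    rw [inner_self_eq_norm_sq_to_K, inner_self_eq_norm_sq_to_K] at e3
    have e4 : ‖y'‖ ^ 2 = ‖p.snd‖ ^ 2 := by exact_mod_cast e3
    exact (sq_eq_sq₀ (norm_nonneg _) (norm_nonneg _)).mp e4
  have hfst : Continuous fun p : WithLp 2 (Y × Y) => p.fst :=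
    continuous_fst.comp (WithLp.prod_continuous_ofLp 2 Y Y)
  have hsnd : Continuous fun p : WithLp 2 (Y × Y) => p.snd :=
    continuous_snd.comp (WithLp.prod_continuous_ofLp 2 Y Y)
  have hdense : WithLp.toLp 2 (x, y) ∈ N.topologicalClosure := by
    set v : WithLp 2 (Y × Y) := WithLp.toLp 2 (x, y) with hv
    have hle : ∀ p ∈ N.topologicalClosure, (p.fst, p.snd) ∈ 𝒜 := by
      intro p hp
      have hcl : IsClosed {p : WithLp 2 (Y × Y) | (p.fst, p.snd) ∈ 𝒜} :=
        h𝒜.preimage (hfst.prodMk hsnd)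
      exact closure_minimal (fun q hq => hq.1) hcl hp
    set p := N.topologicalClosure.starProjection v with hp
    have hpK : p ∈ N.topologicalClosure := Submodule.starProjection_apply_mem _ v
    have horth : v - p ∈ N.topologicalClosureᗮ := Submodule.sub_starProjection_mem_orthogonal v
    have h1 : ((v - p).fst, (v - p).snd) ∈ 𝒜 := 𝒜.sub_mem hxy (hle p hpK)
    -- If `(e, 𝒜 e)` is orthogonal to `N`, solving `a + ℬ 𝒜 a = e` and testing with `(a, 𝒜 a)` gives
    -- `‖e‖² = 0`.
    obtain ⟨a, b, c, hab, hbc, habc⟩ := exists_mem_mem_add_eq h𝒜 hℬ (v - p).fst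
    have h2 := (Submodule.mem_orthogonal _ _).mp horth (WithLp.toLp 2 (a, b))
      (N.le_topologicalClosure ⟨hab, c, hbc⟩)
    rw [WithLp.prod_inner_apply] at h2
    have h3 : inner 𝕜 a (v - p).fst + inner 𝕜 b (v - p).snd = 0 := h2
    have h4 := (hℬ _ _).mp hbc _ _ h1
    rw [← inner_conj_symm b, h4, inner_conj_symm, ← inner_add_left, habc, inner_self_eq_zero] at h3
    rw [h3] at h1
    have h5 : v - p = 0 := by
      apply (WithLp.ofLp_injective 2)
      exact Prod.ext h3 (h𝒜0 _ h1)
    rw [sub_eq_zero.mp h5]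
    exact hpK
  obtain ⟨s, hsN, hs⟩ := mem_closure_iff_seq_limit.mp hdense
  choose y' hy' hnorm using fun n => hN (s n) (hsN n)
  -- The norm equality on `N` applied to differences makes the images under `ℬ` Cauchy, and
  -- closedness of `ℬ` then supplies the limit.
  have hdist : ∀ n m, dist (y' n) (y' m) = dist (s n).snd (s m).snd := by
    intro n m
    obtain ⟨w, hw, hwn⟩ := hN _ (N.sub_mem (hsN n) (hsN m))
    have h1 := ℬ.sub_mem hw (ℬ.sub_mem (hy' n) (hy' m))
    have h2 := hℬ0 (w - (y' n - y' m)) (by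
      convert h1 using 1
      refine Prod.ext ?_ rfl
      exact (sub_self _).symm)
    rw [dist_eq_norm, dist_eq_norm, ← sub_eq_zero.mp h2]
    exact hwn
  have hs2 : Tendsto (fun n => (s n).snd) atTop (𝓝 y) := (hsnd.tendsto _).comp hs
  have hs1 : Tendsto (fun n => (s n).fst) atTop (𝓝 x) := (hfst.tendsto _).comp hs
  have hcauchy : CauchySeq y' := by
    have h1 := hs2.cauchySeq
    rw [Metric.cauchySeq_iff] at h1 ⊢
    simpa only [hdist] using h1
  obtain ⟨l, hl⟩ := cauchySeq_tendsto_of_complete hcauchy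
  refine ⟨l, hℬc.mem_of_tendsto (hs1.prodMk_nhds hl) (Eventually.of_forall hy'), ?_⟩
  refine tendsto_nhds_unique hl.norm ?_
  simpa only [hnorm] using hs2.norm

omit [CompleteSpace Y] in
theorem inner_map_map_eq_of_norm_eq {V : Type*} [AddCommGroup V] [Module 𝕜 V] (f g : V →ₗ[𝕜] Y)
    (h : ∀ x, ‖f x‖ = ‖g x‖) (x y : V) : inner 𝕜 (f x) (f y) = inner 𝕜 (g x) (g y) := by
  rw [inner_eq_sum_norm_sq_div_four, inner_eq_sum_norm_sq_div_four]
  simp only [← map_smul, ← map_add, ← map_sub, h]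

/-- The resolvent of a normal operator is normal. -/
theorem IsNormalOperator.isStarNormal_resolvent {A : Y →ₗ.[𝕜] Y} (hA : IsNormalOperator A) {z : 𝕜}
    {R : Y →L[𝕜] Y} (hR : IsResolvent A z R) : IsStarNormal R := by
  have hd := hA.dense_domain
  have hbc : IsClosed (A.adjoint.graph : Set (Y × Y)) := LinearPMap.adjoint_isClosed hd
  have hab : ∀ x y, (x, y) ∈ A.adjoint.graph ↔
    ∀ u v, (u, v) ∈ A.graph → inner 𝕜 v x = inner 𝕜 u y := fun x y => mem_adjoint_graph_iff hd
  have hba : ∀ x y, (x, y) ∈ A.graph ↔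
      ∀ u v, (u, v) ∈ A.adjoint.graph → inner 𝕜 v x = inner 𝕜 u y := fun x y => by
    refine ⟨fun h u v huv => ?_, fun h => hR.mem_graph_of_forall_adjoint hd h⟩
    rw [← inner_conj_symm, ← (hab _ _).mp huv _ _ h, inner_conj_symm]
  have hA0 : ∀ y, (0, y) ∈ A.graph → y = 0 := fun y h =>
    A.graph_fst_eq_zero_snd h rfl
  have hB0 : ∀ y, (0, y) ∈ A.adjoint.graph → y = 0 := fun y h =>
    A.adjoint.graph_fst_eq_zero_snd h rfl
  have hAB : ∀ x y, (x, y) ∈ A.graph → ∃ y', (x, y') ∈ A.adjoint.graph ∧ ‖y'‖ = ‖y‖ := fun x y h =>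
    exists_mem_norm_eq_of_comm hA.isClosed hbc hA0 hB0 hab (fun x z => (hA.comm x z).mpr) h
  have hBA : ∀ x y, (x, y) ∈ A.adjoint.graph → ∃ y', (x, y') ∈ A.graph ∧ ‖y'‖ = ‖y‖ := fun x y h =>
    exists_mem_norm_eq_of_comm hbc hA.isClosed hB0 hA0 hba (fun x z => (hA.comm x z).mp) h
  have hle : A.domain ≤ A.adjoint.domain := fun x hx => by
    obtain ⟨y', h, -⟩ := hAB _ _ (A.mem_graph ⟨x, hx⟩)
    exact (mem_graph_iff_exists.mp h).1
  let f : A.domain →ₗ[𝕜] Y := z • A.domain.subtype - A.toFun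
  let g : A.domain →ₗ[𝕜] Y := star z • A.domain.subtype - A.adjoint.toFun.comp (Submodule.inclusion hle)
  have hfg : ∀ x, ‖f x‖ = ‖g x‖ := by
    intro x
    obtain ⟨y', hy', hn⟩ := hAB _ _ (A.mem_graph x)
    obtain ⟨hx', rfl⟩ := mem_graph_iff_exists.mp hy'
    have hf : f x = z • (x : Y) - A x := rfl
    have hg : g x = star z • (x : Y) - A.adjoint ⟨x, hx'⟩ := rfl
    rw [← sq_eq_sq₀ (norm_nonneg _) (norm_nonneg _), hf, hg, @norm_sub_sq 𝕜, @norm_sub_sq 𝕜, hn,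
      norm_smul, norm_smul, norm_star]
    congr 3
    rw [inner_smul_left, inner_smul_left, ← (hab _ _).mp hy' _ _ (A.mem_graph x),
      ← inner_conj_symm (A x), ← RCLike.conj_re, map_mul]
    rfl
  -- For `x = R* R y` one has `(z̄ - A*) x = R y`. Polarizing `‖(z - A) ·‖ = ‖(z̄ - A*) ·‖` against
  -- `R c` gives `(z - A) x = R* y`, hence `x = R R* y`.
  have key : ∀ y, R (R.adjoint y) = R.adjoint (R y) := by
    intro y
    obtain ⟨b', hb', -⟩ := hBA _ _ (hR.adjoint_mem_graph hd (R y))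
    obtain ⟨hx, -⟩ := mem_graph_iff_exists.mp hb'
    set x := R.adjoint (R y) with hxdef
    have hgx : g ⟨x, hx⟩ = R y := by
      obtain ⟨h1, h2⟩ := mem_graph_iff_exists.mp (hR.adjoint_mem_graph hd (R y))
      change star z • x - A.adjoint ⟨x, h1⟩ = R y
      rw [h2, sub_sub_cancel]
    have hfR : f ⟨x, hx⟩ = R.adjoint y := by
      refine ext_inner_right 𝕜 fun c => ?_
      obtain ⟨hc, hc2⟩ := hR.1 c
      have hfc : f ⟨R c, hc⟩ = c := hc2
      have h3 := inner_map_map_eq_of_norm_eq f g hfg ⟨x, hx⟩ ⟨R c, hc⟩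
      rw [hfc, hgx] at h3
      have h4 : inner 𝕜 (R y) (g ⟨R c, hc⟩) = inner 𝕜 y (R c) := by
        change inner 𝕜 (R y) (star z • R c - A.adjoint ⟨R c, hle hc⟩) = _
        rw [inner_sub_right, ← (hab _ _).mp (A.adjoint.mem_graph ⟨R c, hle hc⟩) _ _ (hR.mem_graph y),
          inner_smul_right, inner_sub_left, inner_smul_left]
        exact sub_sub_cancel _ _
      rw [h3, h4, ContinuousLinearMap.adjoint_inner_left]
    have := hR.2 ⟨x, hx⟩
    rw [← hfR]
    exact this
  refine ⟨ContinuousLinearMap.ext fun y => ?_⟩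
  exact (key y).symm

end NormalResolvent

/-! ### The Borel functional calculus of a representation of `C(X)` -/

section BoundedMeasurable

variable {X : Type*} [MeasurableSpace X]

theorem eLpNorm_two_pow {μ : Measure X} (f : X → ℂ) :
    eLpNorm f 2 μ ^ 2 = ∫⁻ z, ‖f z‖ₑ ^ 2 ∂μ := by
  have := eLpNorm_nnreal_pow_eq_lintegral (f := f) (μ := μ) (p := 2) (by norm_num)
  simpa using this

/-- Bounded measurable functions. -/
structure IsBoundedMeasurable (h : X → ℂ) : Prop where
  measurable : Measurable h
  bounded : ∃ C : ℝ, ∀ z, ‖h z‖ ≤ C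

theorem IsBoundedMeasurable.memLp {h : X → ℂ} (hh : IsBoundedMeasurable h) (μ : Measure X)
    [IsFiniteMeasure μ] : MemLp h 2 μ := by
  obtain ⟨C, hC⟩ := hh.bounded
  exact MemLp.of_bound hh.measurable.aestronglyMeasurable C (Eventually.of_forall hC)

theorem IsBoundedMeasurable.star {h : X → ℂ} (hh : IsBoundedMeasurable h) :
    IsBoundedMeasurable (star h) := by
  obtain ⟨C, hC⟩ := hh.bounded
  exact ⟨Complex.continuous_conj.measurable.comp hh.measurable, C, fun z => by simpa using hC z⟩

theorem isBoundedMeasurable_indicator {s : Set X} (hs : MeasurableSet s) :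
    IsBoundedMeasurable (s.indicator fun _ => (1 : ℂ)) := by
  refine ⟨measurable_const.indicator hs, 1, fun z => ?_⟩
  by_cases hz : z ∈ s <;> simp [hz]

theorem tendsto_eLpNorm_mul_sub {μ : Measure X} {h g : X → ℂ} {C : ℝ} (hg : ∀ z, ‖g z‖ ≤ C)
    {f : ℕ → X → ℂ} (hf : Tendsto (fun n => eLpNorm (f n - h) 2 μ) atTop (𝓝 0)) :
    Tendsto (fun n => eLpNorm (g * f n - g * h) 2 μ) atTop (𝓝 0) := by
  have h1 := ENNReal.Tendsto.const_mul (a := ENNReal.ofReal C) hf (Or.inr ENNReal.ofReal_ne_top)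
  rw [mul_zero] at h1
  refine tendsto_of_tendsto_of_tendsto_of_le_of_le tendsto_const_nhds h1 (fun _ => zero_le)
    fun n => ?_
  refine eLpNorm_le_mul_eLpNorm_of_ae_le_mul (Eventually.of_forall fun z => ?_) 2
  rw [← mul_sub, Pi.mul_apply, norm_mul]
  exact mul_le_mul_of_nonneg_right (hg z) (norm_nonneg _)

end BoundedMeasurable

/-! ### Representing measures and the extension from continuous to Borel functions. -/

section Representation

open scoped CompactlySupported

variable {X : Type*} [MetricSpace X] [CompactSpace X] [MeasurableSpace X] [BorelSpace X]
  {Y : Type*} [NormedAddCommGroup Y] [InnerProductSpace ℂ Y] [CompleteSpace Y]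
  (Φ : C(X, ℂ) →⋆ₐ[ℂ] (Y →L[ℂ] Y))

/-- A real continuous function, viewed as a complex one. -/
def complexMap {X : Type*} [TopologicalSpace X] (f : C(X, ℝ)) : C(X, ℂ) :=
  ⟨fun z => (f z : ℂ), by fun_prop⟩

omit [MeasurableSpace X] [BorelSpace X] [CompactSpace X] [MetricSpace X] in
theorem inner_rep_star_mul [TopologicalSpace X] [CompactSpace X]
    (Φ : C(X, ℂ) →⋆ₐ[ℂ] (Y →L[ℂ] Y)) (f : C(X, ℂ)) (x : Y) :
    inner ℂ x (Φ (star f * f) x) = ((‖Φ f x‖ ^ 2 : ℝ) : ℂ) := by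
  have h : Φ (star f * f) x = (Φ f).adjoint (Φ f x) := by
    rw [map_mul, map_star]; rfl
  rw [h, ContinuousLinearMap.adjoint_inner_right, inner_self_eq_norm_sq_to_K]
  norm_cast

/-- The positive functional `f ↦ ⟨x, Φ(f) x⟩`. -/
def repFunctional (x : Y) : C_c(X, ℝ) →ₚ[ℝ] ℝ :=
  PositiveLinearMap.mk₀
    { toFun := fun f => (inner ℂ x (Φ (complexMap f.toContinuousMap) x)).re
      map_add' := fun f g => by
        have : complexMap (f + g).toContinuousMap =
            complexMap f.toContinuousMap + complexMap g.toContinuousMap := by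
          ext z; simp [complexMap]
        rw [this, map_add, _root_.add_apply, inner_add_right, Complex.add_re]
      map_smul' := fun c f => by
        have : complexMap (c • f).toContinuousMap = (c : ℂ) • complexMap f.toContinuousMap := by
          ext z; simp [complexMap]
        rw [this, map_smul, _root_.smul_apply, inner_smul_right, Complex.re_ofReal_mul]
        rfl }
    (fun f hf => by
      -- Positivity: for `f = g̅ g` the functional equals `‖Φ(g) x‖²`.
      let g : C(X, ℂ) := complexMap ⟨fun z => √(f z), by fun_prop⟩
      have : complexMap f.toContinuousMap = star g * g := by
        ext z
        have h0 : 0 ≤ f z := hf z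
        simp only [complexMap, g, ContinuousMap.coe_mk, ContinuousMap.mul_apply,
          ContinuousMap.star_apply, RCLike.star_def, Complex.conj_ofReal]
        rw [← Complex.ofReal_mul, Real.mul_self_sqrt h0]
        rfl
      change 0 ≤ (inner ℂ x (Φ (complexMap f.toContinuousMap) x)).re
      rw [this, inner_rep_star_mul, Complex.ofReal_re]
      positivity)

/-- The measure representing `f ↦ ⟨x, Φ(f) x⟩`. -/
def repMeasure (x : Y) : Measure X := RealRMK.rieszMeasure (repFunctional Φ x)

instance (x : Y) : IsFiniteMeasure (repMeasure Φ x) := by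
  have : (repMeasure Φ x).Regular := by
    unfold repMeasure
    infer_instance
  infer_instance

theorem integral_repMeasure (f : C(X, ℝ)) (x : Y) :
    ∫ z, f z ∂(repMeasure Φ x) = (inner ℂ x (Φ (complexMap f) x)).re :=
  RealRMK.integral_rieszMeasure (repFunctional Φ x)
    (CompactlySupportedContinuousMap.continuousMapEquiv f)

theorem integral_norm_sq_repMeasure (f : C(X, ℂ)) (x : Y) :
    ∫ z, ‖f z‖ ^ 2 ∂(repMeasure Φ x) = ‖Φ f x‖ ^ 2 := by
  have h := integral_repMeasure Φ (⟨fun z => ‖f z‖ ^ 2, by fun_prop⟩ : C(X, ℝ)) x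
  have e : complexMap (⟨fun z => ‖f z‖ ^ 2, by fun_prop⟩ : C(X, ℝ)) = star f * f := by
    ext z
    simp only [complexMap, ContinuousMap.coe_mk, ContinuousMap.mul_apply,
      ContinuousMap.star_apply, RCLike.star_def]
    rw [mul_comm, Complex.mul_conj, Complex.normSq_eq_norm_sq]
  rw [e, inner_rep_star_mul, Complex.ofReal_re] at h
  exact h

/-- This isometry, from continuous functions with the `L²(μ_x)` norm into `Y`, carries the whole
extension to Borel functions. -/
theorem enorm_rep_apply (f : C(X, ℂ)) (x : Y) :
    ‖Φ f x‖ₑ = eLpNorm f 2 (repMeasure Φ x) := by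
  refine (ENNReal.pow_right_strictMono two_ne_zero).injective ?_
  have hint : Integrable (fun z => ‖f z‖ ^ 2) (repMeasure Φ x) :=
    Integrable.of_bound (by fun_prop) (‖f‖ ^ 2) (Eventually.of_forall fun z => by
      rw [Real.norm_of_nonneg (by positivity)]
      gcongr
      exact f.norm_coe_le_norm z)
  have h := ofReal_integral_eq_lintegral_ofReal hint (Eventually.of_forall fun z => by positivity)
  rw [integral_norm_sq_repMeasure, ENNReal.ofReal_pow (norm_nonneg _), ofReal_norm] at h
  simp only [eLpNorm_two_pow, h]
  refine lintegral_congr fun z => ?_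
  rw [ENNReal.ofReal_pow (norm_nonneg _), ofReal_norm]

theorem exists_tendsto_eLpNorm_sub {μ : Measure X} [IsFiniteMeasure μ] {h : X → ℂ}
    (hh : MemLp h 2 μ) :
    ∃ f : ℕ → C(X, ℂ), Tendsto (fun n => eLpNorm (⇑(f n) - h) 2 μ) atTop (𝓝 0) := by
  have key : ∀ n : ℕ, ∃ f : C(X, ℂ), eLpNorm (⇑f - h) 2 μ ≤ ((n : ℝ≥0∞) + 1)⁻¹ := by
    intro n
    obtain ⟨g, hg, -⟩ := hh.exists_boundedContinuous_eLpNorm_sub_le (by norm_num)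
      (ε := ((n : ℝ≥0∞) + 1)⁻¹) (by simp)
    refine ⟨g.toContinuousMap, ?_⟩
    rw [eLpNorm_sub_comm]
    exact hg
  choose f hf using key
  refine ⟨f, tendsto_of_tendsto_of_tendsto_of_le_of_le tendsto_const_nhds ?_
    (fun _ => zero_le) hf⟩
  have := (tendsto_add_atTop_iff_nat (f := fun n : ℕ => (n : ℝ≥0∞)⁻¹) 1).mpr
    ENNReal.tendsto_inv_nat_nhds_zero
  simpa using this

theorem edist_rep_apply_le {h : X → ℂ} {x : Y} (hh : MemLp h 2 (repMeasure Φ x)) (f g : C(X, ℂ)) :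
    edist (Φ f x) (Φ g x) ≤
      eLpNorm (⇑f - h) 2 (repMeasure Φ x) + eLpNorm (⇑g - h) 2 (repMeasure Φ x) := by
  rw [edist_eq_enorm_sub, ← _root_.sub_apply, ← map_sub, enorm_rep_apply]
  have e : (⇑(f - g) : X → ℂ) = (f - h) - (g - h) := by
    ext z; simp
  have hm : ∀ k : C(X, ℂ), AEStronglyMeasurable (⇑k - h) (repMeasure Φ x) := fun k =>
    k.continuous.aestronglyMeasurable.sub hh.1
  rw [e]
  exact eLpNorm_sub_le (hm f) (hm g) (by norm_num)

theorem exists_forall_tendsto_rep {h : X → ℂ} {x : Y} (hh : MemLp h 2 (repMeasure Φ x)) :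
    ∃ y, ∀ f : ℕ → C(X, ℂ), Tendsto (fun n => eLpNorm (⇑(f n) - h) 2 (repMeasure Φ x)) atTop (𝓝 0) →
      Tendsto (fun n => Φ (f n) x) atTop (𝓝 y) := by
  obtain ⟨f₀, hf₀⟩ := exists_tendsto_eLpNorm_sub hh
  have hc : CauchySeq fun n => Φ (f₀ n) x := by
    rw [EMetric.cauchySeq_iff]
    intro ε hε
    obtain ⟨N, hN⟩ := eventually_atTop.mp
      (hf₀.eventually (gt_mem_nhds (ENNReal.half_pos hε.ne')))
    refine ⟨N, fun m hm n hn => (edist_rep_apply_le Φ hh _ _).trans_lt ?_⟩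
    have := ENNReal.add_lt_add (hN m hm) (hN n hn)
    rwa [ENNReal.add_halves] at this
  obtain ⟨y, hy⟩ := cauchySeq_tendsto_of_complete hc
  refine ⟨y, fun f hf => ?_⟩
  have h1 : Tendsto (fun n => edist (Φ (f n) x) (Φ (f₀ n) x)) atTop (𝓝 0) := by
    have := hf.add hf₀
    rw [add_zero] at this
    exact tendsto_of_tendsto_of_tendsto_of_le_of_le tendsto_const_nhds this
      (fun _ => zero_le) fun n => edist_rep_apply_le Φ hh _ _
  rw [tendsto_iff_edist_tendsto_0] at hy ⊢
  have := h1.add hy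
  rw [add_zero] at this
  exact tendsto_of_tendsto_of_tendsto_of_le_of_le tendsto_const_nhds this
    (fun _ => zero_le) fun n => edist_triangle _ _ _

open Classical in
/-- The vector `h(Φ) x`, defined for `h ∈ L²(μ_x)` as the limit of `Φ(f) x` as `f → h` in `L²(μ_x)`. -/
def repCalc (h : X → ℂ) (x : Y) : Y :=
  if hh : MemLp h 2 (repMeasure Φ x) then (exists_forall_tendsto_rep Φ hh).choose else 0

theorem tendsto_repCalc {h : X → ℂ} {x : Y} (hh : MemLp h 2 (repMeasure Φ x)) {f : ℕ → C(X, ℂ)}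
    (hf : Tendsto (fun n => eLpNorm (⇑(f n) - h) 2 (repMeasure Φ x)) atTop (𝓝 0)) :
    Tendsto (fun n => Φ (f n) x) atTop (𝓝 (repCalc Φ h x)) := by
  rw [repCalc, dif_pos hh]
  exact (exists_forall_tendsto_rep Φ hh).choose_spec f hf

theorem memLp_continuousMap (f : C(X, ℂ)) {μ : Measure X} [IsFiniteMeasure μ] : MemLp f 2 μ :=
  MemLp.of_bound f.continuous.aestronglyMeasurable ‖f‖
    (Eventually.of_forall fun z => f.norm_coe_le_norm z)

theorem repCalc_continuousMap (f : C(X, ℂ)) (x : Y) : repCalc Φ f x = Φ f x :=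
  tendsto_nhds_unique
    (tendsto_repCalc Φ (memLp_continuousMap f) (f := fun _ => f) (by simp)) tendsto_const_nhds

theorem enorm_repCalc {h : X → ℂ} {x : Y} (hh : MemLp h 2 (repMeasure Φ x)) :
    ‖repCalc Φ h x‖ₑ = eLpNorm h 2 (repMeasure Φ x) := by
  obtain ⟨f, hf⟩ := exists_tendsto_eLpNorm_sub hh
  have h1 := (continuous_enorm.tendsto _).comp (tendsto_repCalc Φ hh hf)
  refine tendsto_nhds_unique h1 ?_
  simp only [Function.comp_def, enorm_rep_apply]
  have hm : ∀ n, AEStronglyMeasurable (⇑(f n) - h) (repMeasure Φ x) := fun n =>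
    (f n).continuous.aestronglyMeasurable.sub hh.1
  have hup : ∀ n, eLpNorm (f n) 2 (repMeasure Φ x) ≤
      eLpNorm (⇑(f n) - h) 2 (repMeasure Φ x) + eLpNorm h 2 (repMeasure Φ x) := fun n => by
    have := eLpNorm_add_le (hm n) hh.1 (p := 2) (by norm_num)
    rwa [sub_add_cancel] at this
  have hlow : ∀ n, eLpNorm h 2 (repMeasure Φ x) - eLpNorm (⇑(f n) - h) 2 (repMeasure Φ x) ≤
      eLpNorm (f n) 2 (repMeasure Φ x) := fun n => by
    have := eLpNorm_sub_le (f n).continuous.aestronglyMeasurable (hm n) (p := 2) (by norm_num)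
    rw [sub_sub_cancel] at this
    exact tsub_le_iff_right.mpr this
  refine tendsto_of_tendsto_of_tendsto_of_le_of_le ?_ ?_ hlow hup
  · have := ENNReal.Tendsto.sub (tendsto_const_nhds (x := eLpNorm h 2 (repMeasure Φ x))) hf
      (Or.inl hh.2.ne)
    simpa using this
  · simpa using hf.add_const (eLpNorm h 2 (repMeasure Φ x))

omit [CompactSpace X] [BorelSpace X] in
theorem tendsto_eLpNorm_sub_of_le {μ ν : Measure X} (hμν : μ ≤ ν) {h : X → ℂ} {f : ℕ → C(X, ℂ)}
    (hf : Tendsto (fun n => eLpNorm (⇑(f n) - h) 2 ν) atTop (𝓝 0)) :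
    Tendsto (fun n => eLpNorm (⇑(f n) - h) 2 μ) atTop (𝓝 0) :=
  tendsto_of_tendsto_of_tendsto_of_le_of_le tendsto_const_nhds hf (fun _ => zero_le)
    fun _ => eLpNorm_mono_measure _ hμν

/-- The measure depends on the vector, so linearity needs one sequence that works for several
vectors; it is found in `L²` of the sum of the measures. -/
theorem exists_common_approx {h : X → ℂ} (hh : IsBoundedMeasurable h) (x y z : Y) :
    ∃ f : ℕ → C(X, ℂ), Tendsto (fun n => eLpNorm (⇑(f n) - h) 2 (repMeasure Φ x)) atTop (𝓝 0) ∧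
      Tendsto (fun n => eLpNorm (⇑(f n) - h) 2 (repMeasure Φ y)) atTop (𝓝 0) ∧
      Tendsto (fun n => eLpNorm (⇑(f n) - h) 2 (repMeasure Φ z)) atTop (𝓝 0) := by
  obtain ⟨f, hf⟩ := exists_tendsto_eLpNorm_sub
    (hh.memLp (repMeasure Φ x + repMeasure Φ y + repMeasure Φ z))
  refine ⟨f, tendsto_eLpNorm_sub_of_le ?_ hf, tendsto_eLpNorm_sub_of_le ?_ hf,
    tendsto_eLpNorm_sub_of_le ?_ hf⟩
  · exact Measure.le_add_right (Measure.le_add_right le_rfl)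
  · exact Measure.le_add_right (Measure.le_add_left le_rfl)
  · exact Measure.le_add_left le_rfl

variable {Φ} in
theorem IsBoundedMeasurable.tendsto {h : X → ℂ} (hh : IsBoundedMeasurable h) {x : Y}
    {f : ℕ → C(X, ℂ)} (hf : Tendsto (fun n => eLpNorm (⇑(f n) - h) 2 (repMeasure Φ x)) atTop (𝓝 0)) :
    Tendsto (fun n => Φ (f n) x) atTop (𝓝 (repCalc Φ h x)) :=
  tendsto_repCalc Φ (hh.memLp _) hf

theorem repCalc_add {h : X → ℂ} (hh : IsBoundedMeasurable h) (x y : Y) :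
    repCalc Φ h (x + y) = repCalc Φ h x + repCalc Φ h y := by
  obtain ⟨f, h1, h2, h3⟩ := exists_common_approx Φ hh x y (x + y)
  refine tendsto_nhds_unique (hh.tendsto h3) ?_
  simp_rw [map_add]
  exact (hh.tendsto h1).add (hh.tendsto h2)

theorem repCalc_smul {h : X → ℂ} (hh : IsBoundedMeasurable h) (c : ℂ) (x : Y) :
    repCalc Φ h (c • x) = c • repCalc Φ h x := by
  obtain ⟨f, h1, h2, -⟩ := exists_common_approx Φ hh x (c • x) x
  refine tendsto_nhds_unique (hh.tendsto h2) ?_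
  simp_rw [map_smul]
  exact (hh.tendsto h1).const_smul c

theorem inner_repCalc {h : X → ℂ} (hh : IsBoundedMeasurable h) (x y : Y) :
    inner ℂ x (repCalc Φ h y) = inner ℂ (repCalc Φ (star h) x) y := by
  obtain ⟨f, h1, h2, -⟩ := exists_common_approx Φ hh x y x
  have h3 : Tendsto (fun n => eLpNorm (⇑(star (f n)) - star h) 2 (repMeasure Φ x)) atTop (𝓝 0) := by
    refine h1.congr fun n => ?_
    refine eLpNorm_congr_norm_ae (Eventually.of_forall fun z => ?_)
    rw [ContinuousMap.coe_star, ← star_sub]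
    exact (norm_star _).symm
  have h4 := (hh.star.tendsto h3).inner (tendsto_const_nhds (x := y)) (𝕜 := ℂ)
  have h5 := (tendsto_const_nhds (x := x)).inner (hh.tendsto h2) (𝕜 := ℂ)
  refine tendsto_nhds_unique h5 (h4.congr fun n => ?_)
  rw [map_star]
  exact ContinuousLinearMap.adjoint_inner_left _ _ _

theorem rep_apply_repCalc {h : X → ℂ} {x : Y} (hh : MemLp h 2 (repMeasure Φ x)) (g : C(X, ℂ)) :
    Φ g (repCalc Φ h x) = repCalc Φ (g * h) x := by
  obtain ⟨f, hf⟩ := exists_tendsto_eLpNorm_sub hh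
  have h1 := ((Φ g).continuous.tendsto _).comp (tendsto_repCalc Φ hh hf)
  have h2 := tendsto_eLpNorm_mul_sub (g := g) g.norm_coe_le_norm hf
  have hgh : MemLp (⇑g * h) 2 (repMeasure Φ x) :=
    hh.of_le_mul (c := ‖g‖) (g.continuous.aestronglyMeasurable.mul hh.1)
      (Eventually.of_forall fun z => by
        rw [Pi.mul_apply, norm_mul]
        exact mul_le_mul_of_nonneg_right (g.norm_coe_le_norm z) (norm_nonneg _))
  have h3 := tendsto_repCalc Φ hgh (f := fun n => g * f n) (by simpa using h2)
  refine tendsto_nhds_unique h1 (h3.congr fun n => ?_)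
  rw [map_mul]; rfl

theorem repCalc_rep_apply {h : X → ℂ} (hh : IsBoundedMeasurable h) (g : C(X, ℂ)) (x : Y) :
    repCalc Φ h (Φ g x) = repCalc Φ (g * h) x := by
  obtain ⟨f, h1, h2, -⟩ := exists_common_approx Φ hh x (Φ g x) x
  rw [← rep_apply_repCalc Φ (hh.memLp _)]
  refine tendsto_nhds_unique (hh.tendsto h2) ?_
  refine (((Φ g).continuous.tendsto _).comp (hh.tendsto h1)).congr fun n => ?_
  simp only [Function.comp_apply, ← mul_apply_eq_comp, ← map_mul, mul_comm]

/-- The bounded operator `h(Φ)`, for a bounded measurable function `h`. -/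
def repCalcL {h : X → ℂ} (hh : IsBoundedMeasurable h) : Y →L[ℂ] Y :=
  LinearMap.mkContinuousOfExistsBound
    { toFun := repCalc Φ h
      map_add' := repCalc_add Φ hh
      map_smul' := repCalc_smul Φ hh }
    (by
      obtain ⟨C, hC⟩ := hh.bounded
      refine ⟨C, fun x => ?_⟩
      have h1 : ‖repCalc Φ h x‖ₑ ≤ ENNReal.ofReal C * ‖x‖ₑ := by
        have h2 : ‖x‖ₑ = eLpNorm (⇑(1 : C(X, ℂ))) 2 (repMeasure Φ x) := by
          rw [← enorm_rep_apply, map_one]; rfl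
        rw [enorm_repCalc Φ (hh.memLp _), h2]
        refine eLpNorm_le_mul_eLpNorm_of_ae_le_mul (Eventually.of_forall fun z => ?_) 2
        simpa using hC z
      -- On an empty `X` the bound `C` may be negative; then `μ_x = 0` forces `x = 0`.
      rcases isEmpty_or_nonempty X with hX | ⟨⟨z⟩⟩
      · have h3 : ‖repCalc Φ h x‖ₑ = 0 := by
          rw [enorm_repCalc Φ (hh.memLp _), Measure.eq_zero_of_isEmpty (repMeasure Φ x)]
          simp
        have h4 : ‖x‖ₑ = 0 := by
          have h2 : ‖x‖ₑ = eLpNorm (⇑(1 : C(X, ℂ))) 2 (repMeasure Φ x) := by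
            rw [← enorm_rep_apply, map_one]; rfl
          rw [h2, Measure.eq_zero_of_isEmpty (repMeasure Φ x)]
          simp
        rw [enorm_eq_zero] at h3 h4
        have h5 : repCalc Φ h 0 = 0 := h4 ▸ h3
        simp [h4, h5]
      · have hC0 : 0 ≤ C := (norm_nonneg _).trans (hC z)
        have := ENNReal.toReal_mono (ENNReal.mul_ne_top ENNReal.ofReal_ne_top enorm_ne_top) h1
        simpa [ENNReal.toReal_ofReal hC0] using this)

theorem repCalcL_apply {h : X → ℂ} (hh : IsBoundedMeasurable h) (x : Y) :
    repCalcL Φ hh x = repCalc Φ h x := rfl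

theorem repCalc_sub {h k : X → ℂ} {x : Y} (hh : MemLp h 2 (repMeasure Φ x))
    (hk : MemLp k 2 (repMeasure Φ x)) :
    repCalc Φ h x - repCalc Φ k x = repCalc Φ (h - k) x := by
  obtain ⟨f, hf⟩ := exists_tendsto_eLpNorm_sub hh
  obtain ⟨g, hg⟩ := exists_tendsto_eLpNorm_sub hk
  have h1 : Tendsto (fun n => eLpNorm (⇑(f n - g n) - (h - k)) 2 (repMeasure Φ x)) atTop (𝓝 0) := by
    have h2 := hf.add hg
    rw [add_zero] at h2
    refine tendsto_of_tendsto_of_tendsto_of_le_of_le tendsto_const_nhds h2 (fun _ => zero_le)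
      fun n => ?_
    have e : ⇑(f n - g n) - (h - k) = (⇑(f n) - h) - (⇑(g n) - k) := by
      rw [ContinuousMap.coe_sub]; abel
    rw [e]
    exact eLpNorm_sub_le ((f n).continuous.aestronglyMeasurable.sub hh.1)
      ((g n).continuous.aestronglyMeasurable.sub hk.1) (by norm_num)
  refine tendsto_nhds_unique ((tendsto_repCalc Φ hh hf).sub (tendsto_repCalc Φ hk hg))
    ((tendsto_repCalc Φ (hh.sub hk) h1).congr fun n => ?_)
  rw [map_sub, _root_.sub_apply]

/-- Only `k` is approximated by continuous functions: multiplication by the bounded `h` preserves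
`L²` convergence. Allowing an unbounded `k` in `L²` is what lets the domain of `A` be analysed. -/
theorem repCalc_repCalc {h k : X → ℂ} (hh : IsBoundedMeasurable h) {x : Y}
    (hk : MemLp k 2 (repMeasure Φ x)) : repCalc Φ h (repCalc Φ k x) = repCalc Φ (h * k) x := by
  obtain ⟨f, hf⟩ := exists_tendsto_eLpNorm_sub hk
  obtain ⟨C, hC⟩ := hh.bounded
  have h1 := ((repCalcL Φ hh).continuous.tendsto _).comp (tendsto_repCalc Φ hk hf)
  have hmem : ∀ k, MemLp k 2 (repMeasure Φ x) → MemLp (h * k) 2 (repMeasure Φ x) := fun k hk =>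
    hk.of_le_mul (c := C) (hh.measurable.aestronglyMeasurable.mul hk.1)
      (Eventually.of_forall fun z => by
        rw [Pi.mul_apply, norm_mul]
        exact mul_le_mul_of_nonneg_right (hC z) (norm_nonneg _))
  refine tendsto_nhds_unique h1 ?_
  rw [tendsto_iff_edist_tendsto_0]
  refine (tendsto_eLpNorm_mul_sub hC hf).congr fun n => ?_
  have h3 := hmem _ (memLp_continuousMap (f n))
  rw [Function.comp_apply, repCalcL_apply, repCalc_rep_apply Φ hh, mul_comm (⇑(f n)) h, edist_eq_enorm_sub,
    repCalc_sub Φ h3 (hmem _ hk), enorm_repCalc Φ (h3.sub (hmem _ hk))]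

end Representation

/-! ### The spectral measure of an operator with a normal resolvent -/

section SpectralMeasureExistence

variable {X : Type*} [MetricSpace X] [CompactSpace X] [MeasurableSpace X] [BorelSpace X]
  {Y : Type*} [NormedAddCommGroup Y] [InnerProductSpace ℂ Y] [CompleteSpace Y]
  (Φ : C(X, ℂ) →⋆ₐ[ℂ] (Y →L[ℂ] Y))

omit [MetricSpace X] [CompactSpace X] [BorelSpace X] in
theorem eLpNorm_indicator_mul_pow {μ : Measure X} {s : Set X} (hs : MeasurableSet s) (k : X → ℂ) :
    eLpNorm (s.indicator (fun _ => (1 : ℂ)) * k) 2 μ ^ 2 = ∫⁻ z in s, ‖k z‖ₑ ^ 2 ∂μ := by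
  rw [eLpNorm_two_pow, ← lintegral_indicator hs]
  refine lintegral_congr fun z => ?_
  by_cases hz : z ∈ s <;> simp [hz]

theorem enorm_repCalc_indicator_repCalc {s : Set X} (hs : MeasurableSet s) {k : X → ℂ} {x : Y}
    (hk : MemLp k 2 (repMeasure Φ x)) :
    ‖repCalc Φ (s.indicator fun _ => 1) (repCalc Φ k x)‖ₑ ^ 2 =
      ∫⁻ z in s, ‖k z‖ₑ ^ 2 ∂(repMeasure Φ x) := by
  have hb := isBoundedMeasurable_indicator hs
  have hm : MemLp (s.indicator (fun _ => 1) * k) 2 (repMeasure Φ x) := by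
    have : s.indicator (fun _ => (1 : ℂ)) * k = s.indicator k := by
      ext z; by_cases hz : z ∈ s <;> simp [hz]
    rw [this]
    exact hk.indicator hs
  rw [repCalc_repCalc Φ hb hk, enorm_repCalc Φ hm, eLpNorm_indicator_mul_pow hs]

theorem repCalc_one (x : Y) : repCalc Φ (fun _ => 1) x = x := by
  have := repCalc_continuousMap Φ 1 x
  rw [map_one] at this
  exact this

theorem enorm_repCalc_indicator {s : Set X} (hs : MeasurableSet s) (x : Y) :
    ‖repCalc Φ (s.indicator fun _ => 1) x‖ₑ ^ 2 = repMeasure Φ x s := by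
  have := enorm_repCalc_indicator_repCalc Φ hs (memLp_const (1 : ℂ) (μ := repMeasure Φ x))
  rw [repCalc_one] at this
  simpa using this

open Classical in
/-- The spectral projections of a representation of `C(X)`, pushed forward by `ψ : X → ℂ`. -/
def repProj {ψ : X → ℂ} (hψ : Measurable ψ) (s : Set ℂ) : Y →L[ℂ] Y :=
  if hs : MeasurableSet s then repCalcL Φ (isBoundedMeasurable_indicator (hψ hs)) else 0

theorem repProj_apply {ψ : X → ℂ} (hψ : Measurable ψ) {s : Set ℂ} (hs : MeasurableSet s) (x : Y) :
    repProj Φ hψ s x = repCalc Φ ((ψ ⁻¹' s).indicator fun _ => 1) x := by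
  rw [repProj, dif_pos hs]; rfl

theorem repProj_inter {ψ : X → ℂ} (hψ : Measurable ψ) {s t : Set ℂ} (hs : MeasurableSet s)
    (ht : MeasurableSet t) : repProj Φ hψ (s ∩ t) = repProj Φ hψ s * repProj Φ hψ t := by
  ext x
  rw [mul_apply_eq_comp, repProj_apply Φ hψ hs, repProj_apply Φ hψ ht,
    repProj_apply Φ hψ (hs.inter ht), repCalc_repCalc Φ (isBoundedMeasurable_indicator (hψ hs))
      ((isBoundedMeasurable_indicator (hψ ht)).memLp _)]
  congr 1
  ext z
  by_cases h1 : ψ z ∈ s <;> by_cases h2 : ψ z ∈ t <;> simp [h1, h2]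

theorem repProj_sub {ψ : X → ℂ} (hψ : Measurable ψ) {s t : Set ℂ} (hs : MeasurableSet s)
    (ht : MeasurableSet t) (hst : s ⊆ t) (x : Y) :
    repProj Φ hψ t x - repProj Φ hψ s x = repProj Φ hψ (t \ s) x := by
  rw [repProj_apply Φ hψ hs, repProj_apply Φ hψ ht, repProj_apply Φ hψ (ht.diff hs),
    repCalc_sub Φ ((isBoundedMeasurable_indicator (hψ ht)).memLp _)
      ((isBoundedMeasurable_indicator (hψ hs)).memLp _)]
  congr 1
  ext z
  by_cases h1 : ψ z ∈ s
  · simp [h1, hst h1]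
  · by_cases h2 : ψ z ∈ t <;> simp [h1, h2]

theorem repProj_biUnion {ψ : X → ℂ} (hψ : Measurable ψ) {f : ℕ → Set ℂ}
    (hf : ∀ i, MeasurableSet (f i)) (hd : Pairwise (Function.onFun Disjoint f)) (F : Finset ℕ)
    (x : Y) : ∑ i ∈ F, repProj Φ hψ (f i) x = repProj Φ hψ (⋃ i ∈ F, f i) x := by
  classical
  induction F using Finset.induction_on with
  | empty =>
    rw [Finset.sum_empty, repProj_apply Φ hψ (by simp)]
    have e : ((ψ ⁻¹' ⋃ i ∈ (∅ : Finset ℕ), f i).indicator fun _ => (1 : ℂ)) = ⇑(0 : C(X, ℂ)) := by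
      ext z; simp
    rw [e, repCalc_continuousMap, map_zero]; rfl
  | insert a F ha ih =>
    have hF : MeasurableSet (⋃ i ∈ F, f i) := F.measurableSet_biUnion fun i _ => hf i
    rw [Finset.sum_insert ha, ih, Finset.set_biUnion_insert, ← eq_sub_iff_add_eq,
      repProj_sub Φ hψ hF ((hf a).union hF) subset_union_right]
    congr 2
    rw [union_sdiff_right]
    refine (Disjoint.sdiff_eq_left ?_).symm
    rw [disjoint_iUnion₂_right]
    exact fun i hi => hd (fun h => ha (h ▸ hi))

/-- The squared distance from a finite partial sum to the limit is the mass of the remaining sets,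
so countable additivity of `μ_x` gives strong convergence. -/
theorem hasSum_repProj {ψ : X → ℂ} (hψ : Measurable ψ) {f : ℕ → Set ℂ}
    (hf : ∀ i, MeasurableSet (f i)) (hd : Pairwise (Function.onFun Disjoint f)) (x : Y) :
    HasSum (fun i => repProj Φ hψ (f i) x) (repProj Φ hψ (⋃ i, f i) x) := by
  set μ := (repMeasure Φ x).map ψ with hμ
  have hU : MeasurableSet (⋃ i, f i) := MeasurableSet.iUnion hf
  have h1 : HasSum (fun i => μ (f i)) (μ (⋃ i, f i)) := by
    rw [measure_iUnion hd hf]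
    exact ENNReal.summable.hasSum
  have h2 := ENNReal.Tendsto.sub (tendsto_const_nhds (x := μ (⋃ i, f i))) h1
    (Or.inl (measure_ne_top _ _))
  rw [tsub_self] at h2
  rw [HasSum, SummationFilter.unconditional_filter, tendsto_iff_edist_tendsto_0]
  have h3 : ∀ F : Finset ℕ, edist (∑ i ∈ F, repProj Φ hψ (f i) x) (repProj Φ hψ (⋃ i, f i) x) ^ 2 =
      μ (⋃ i, f i) - ∑ i ∈ F, μ (f i) := by
    intro F
    have hF : MeasurableSet (⋃ i ∈ F, f i) := F.measurableSet_biUnion fun i _ => hf i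
    have hsub : (⋃ i ∈ F, f i) ⊆ ⋃ i, f i := iUnion₂_subset fun i _ => subset_iUnion f i
    rw [edist_comm, edist_eq_enorm_sub, repProj_biUnion Φ hψ hf hd, repProj_sub Φ hψ hF hU hsub,
      repProj_apply Φ hψ (hU.diff hF), enorm_repCalc_indicator Φ (hψ (hU.diff hF)),
      ← Measure.map_apply hψ (hU.diff hF), ← hμ,
      measure_sdiff hsub hF.nullMeasurableSet (measure_ne_top _ _),
      measure_biUnion_finset (fun i _ j _ hij => hd hij) fun i _ => hf i]
  have h4 : Tendsto (fun F : Finset ℕ =>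
      (edist (∑ i ∈ F, repProj Φ hψ (f i) x) (repProj Φ hψ (⋃ i, f i) x) ^ 2) ^ (1 / 2 : ℝ)) atTop
      (𝓝 (0 ^ (1 / 2 : ℝ))) := by
    simp_rw [h3]
    simpa using h2.ennrpow_const (1 / 2 : ℝ)
  rw [ENNReal.zero_rpow_of_pos (by norm_num)] at h4
  refine h4.congr fun F => ?_
  rw [← ENNReal.rpow_natCast, ← ENNReal.rpow_mul]
  norm_num

/-- The projection-valued measure of a representation of `C(X)`, pushed forward by `ψ : X → ℂ`. -/
def repPVM {ψ : X → ℂ} (hψ : Measurable ψ) : ProjectionValuedMeasure Y where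
  proj := repProj Φ hψ
  isStarProjection s hs := by
    refine ⟨?_, ?_⟩
    · rw [IsIdempotentElem, ← repProj_inter Φ hψ hs hs, inter_self]
    · rw [IsSelfAdjoint, ContinuousLinearMap.star_eq_adjoint]
      refine ContinuousLinearMap.ext fun x => ext_inner_right ℂ fun y => ?_
      rw [ContinuousLinearMap.adjoint_inner_left, repProj_apply Φ hψ hs, repProj_apply Φ hψ hs,
        inner_repCalc Φ (isBoundedMeasurable_indicator (hψ hs))]
      congr 2
      ext z
      by_cases h1 : ψ z ∈ s <;> simp [h1]
  univ := by
    ext x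
    rw [repProj_apply Φ hψ MeasurableSet.univ, preimage_univ, indicator_univ, repCalc_one]; rfl
  inter s t hs ht := repProj_inter Φ hψ hs ht
  iUnion f hf hd x := hasSum_repProj Φ hψ hf hd x

theorem ProjectionValuedMeasure.measure_apply (E : ProjectionValuedMeasure Y) (x : Y) {s : Set ℂ}
    (hs : MeasurableSet s) : E.measure x s = ‖E.proj s x‖ₑ ^ 2 := by
  rw [ProjectionValuedMeasure.measure, Measure.ofMeasurable_apply _ hs,
    ENNReal.ofReal_pow (norm_nonneg _), ofReal_norm]

theorem measure_repPVM_repCalc {ψ : X → ℂ} (hψ : Measurable ψ) {k : X → ℂ} {x : Y}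
    (hk : MemLp k 2 (repMeasure Φ x)) :
    (repPVM Φ hψ).measure (repCalc Φ k x) =
      ((repMeasure Φ x).withDensity fun z => ‖k z‖ₑ ^ 2).map ψ := by
  ext s hs
  rw [ProjectionValuedMeasure.measure_apply _ _ hs, Measure.map_apply hψ hs,
    withDensity_apply _ (hψ hs), ← enorm_repCalc_indicator_repCalc Φ (hψ hs) hk,
    ← repProj_apply Φ hψ hs]
  rfl

theorem measure_repPVM {ψ : X → ℂ} (hψ : Measurable ψ) (x : Y) :
    (repPVM Φ hψ).measure x = (repMeasure Φ x).map ψ := by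
  have := measure_repPVM_repCalc Φ hψ (memLp_const (1 : ℂ) (μ := repMeasure Φ x))
  rw [repCalc_one] at this
  simpa using! this

theorem repCalc_congr_ae {h k : X → ℂ} {x : Y} (hh : MemLp h 2 (repMeasure Φ x))
    (hhk : h =ᵐ[repMeasure Φ x] k) : repCalc Φ h x = repCalc Φ k x := by
  have hk : MemLp k 2 (repMeasure Φ x) := hh.ae_eq hhk
  rw [← sub_eq_zero, repCalc_sub Φ hh hk, ← enorm_eq_zero, enorm_repCalc Φ (hh.sub hk),
    eLpNorm_congr_ae (hhk.sub (EventuallyEq.refl _ k))]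
  simp

omit [CompactSpace X] [MeasurableSpace X] [BorelSpace X] in
theorem inner_rep_complexMap_im (f : C(X, ℝ)) (x : Y) :
    (inner ℂ x (Φ (complexMap f) x)).im = 0 := by
  have h1 : IsSelfAdjoint (complexMap f) := by
    ext z; simp [complexMap]
  have h2 : (Φ (complexMap f)).adjoint = Φ (complexMap f) := h1.map Φ
  refine Complex.conj_eq_iff_im.mp ?_
  rw [inner_conj_symm, ← ContinuousLinearMap.adjoint_inner_right, h2]

theorem integral_repMeasure_complex (f : C(X, ℂ)) (x : Y) :
    ∫ z, f z ∂(repMeasure Φ x) = inner ℂ x (Φ f x) := by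
  set g : C(X, ℝ) := ⟨fun z => (f z).re, by fun_prop⟩ with hg
  set k : C(X, ℝ) := ⟨fun z => (f z).im, by fun_prop⟩ with hk
  have hf : f = complexMap g + Complex.I • complexMap k := by
    ext z
    simp [complexMap, hg, hk, mul_comm Complex.I, Complex.re_add_im]
  have hint : Integrable f (repMeasure Φ x) := (memLp_continuousMap f).integrable (by norm_num)
  have h1 : ∀ q : C(X, ℝ), inner ℂ x (Φ (complexMap q) x) = ((∫ z, q z ∂(repMeasure Φ x) : ℝ) : ℂ) :=
    fun q => by
      rw [integral_repMeasure]
      exact Complex.ext rfl (inner_rep_complexMap_im Φ q x)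
  have h2 : ∫ z, f z ∂(repMeasure Φ x) =
      ((∫ z, g z ∂(repMeasure Φ x) : ℝ) : ℂ) + ((∫ z, k z ∂(repMeasure Φ x) : ℝ) : ℂ) * Complex.I :=
    (integral_re_add_im hint).symm
  rw [h2, ← h1, ← h1]
  conv_rhs => rw [hf]
  rw [map_add, map_smul, _root_.add_apply, _root_.smul_apply, inner_add_right, inner_smul_right,
    mul_comm Complex.I]

/-- Formally `A = z - R⁻¹`, and `R` has symbol `ι`, so `A` has symbol `ψ = z - 1/ι`. Injectivity of
`R` makes the zero set of `ι` null, so the convention `0⁻¹ = 0` does no harm. -/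
theorem isSpectralMeasure_repPVM {A : Y →ₗ.[ℂ] Y} {z : ℂ} {R : Y →L[ℂ] Y} (hR : IsResolvent A z R)
    {ι : C(X, ℂ)} (hΦι : Φ ι = R) {ψ : X → ℂ} (hψ : Measurable ψ) (hψι : ∀ w, ψ w = z - (ι w)⁻¹) :
    IsSpectralMeasure A (repPVM Φ hψ) := by
  have hinj : ∀ y, R y = 0 → y = 0 := by
    intro y hy
    have h1 := hR.mem_graph y
    rw [hy, smul_zero, zero_sub] at h1
    exact neg_eq_zero.mp (A.graph_fst_eq_zero_snd h1 rfl)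
  have hnull : ∀ x, ∀ᵐ w ∂(repMeasure Φ x), ι w ≠ 0 := by
    intro x
    set s : Set X := {w | ι w = 0} with hs
    have hsm : MeasurableSet s := ι.continuous.measurable (measurableSet_singleton (0 : ℂ))
    have h1 : R (repCalc Φ (s.indicator fun _ => 1) x) = 0 := by
      rw [← hΦι, rep_apply_repCalc Φ ((isBoundedMeasurable_indicator hsm).memLp _)]
      have e : ⇑ι * s.indicator (fun _ => 1) = ⇑(0 : C(X, ℂ)) := by
        ext w
        by_cases hw : ι w = 0 <;> simp [hs, hw]
      rw [e, repCalc_continuousMap, map_zero]; rfl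
    have h2 := enorm_repCalc_indicator Φ hsm x
    rw [hinj _ h1, enorm_zero, zero_pow two_ne_zero] at h2
    rw [ae_iff]
    simpa using h2.symm
  refine ⟨fun x => ⟨fun hx => ?_, fun hx => ?_⟩, fun x => ?_⟩
  -- For `x = R y` the measure of `x` has density `|ι|²`, and `ι ψ = z ι - ι ι⁻¹` is bounded.
  · obtain ⟨y, rfl⟩ : ∃ y, R y = x := ⟨_, hR.2 ⟨x, hx⟩⟩
    rw [← hΦι, ← repCalc_continuousMap, measure_repPVM_repCalc Φ hψ (memLp_continuousMap ι),
      lintegral_map (by fun_prop) hψ,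
      lintegral_withDensity_eq_lintegral_mul _ (by fun_prop) (by fun_prop)]
    calc _ ≤ ∫⁻ _, ENNReal.ofReal (‖z‖ * ‖ι‖ + 1) ^ 2 ∂(repMeasure Φ y) := by
          refine lintegral_mono fun w => ?_
          rw [Pi.mul_apply, ← mul_pow, ← enorm_mul]
          refine pow_le_pow_left' ?_ 2
          rw [← ofReal_norm]
          refine ENNReal.ofReal_le_ofReal ?_
          have e : ι w * ψ w = z * ι w - ι w * (ι w)⁻¹ := by
            rw [hψι]; ring
          rw [e]
          refine (norm_sub_le _ _).trans (add_le_add ?_ ?_)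
          · rw [norm_mul]
            exact mul_le_mul_of_nonneg_left (ι.norm_coe_le_norm w) (norm_nonneg _)
          · rw [norm_mul, norm_inv]
            exact mul_inv_le_one
      _ < ∞ := by
          rw [lintegral_const]
          exact ENNReal.mul_lt_top (by finiteness) (measure_lt_top _ _)
  · rw [measure_repPVM, lintegral_map (by fun_prop) hψ] at hx
    have hψL : MemLp ψ 2 (repMeasure Φ x) := by
      refine ⟨hψ.aestronglyMeasurable, ?_⟩
      rw [← eLpNorm_two_pow] at hx
      exact (ENNReal.pow_lt_top_iff.mp hx).resolve_right two_ne_zero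
    -- Conversely, `1/ι = z - ψ` is square integrable, so `x` is `R` applied to `(1/ι)(Φ) x` and
    -- lies in the domain.
    set k : X → ℂ := fun w => (ι w)⁻¹ with hk
    have hkL : MemLp k 2 (repMeasure Φ x) := by
      have : k = (fun _ => z) - ψ := by ext w; simp [hk, hψι]
      rw [this]
      exact (memLp_const z).sub hψL
    have h1 : R (repCalc Φ k x) = x := by
      have hae : (fun _ => 1) =ᵐ[repMeasure Φ x] ⇑ι * k := by
        filter_upwards [hnull x] with w hw
        rw [Pi.mul_apply, hk, mul_inv_cancel₀ hw]
      rw [← hΦι, rep_apply_repCalc Φ hkL, ← repCalc_congr_ae Φ (memLp_const 1) hae, repCalc_one]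
    rw [← h1]
    exact (hR.1 _).1
  · obtain ⟨y, hy⟩ : ∃ y, R y = x := ⟨_, hR.2 x⟩
    have hAx : A x = z • (x : Y) - y := by
      have := hR.mem_graph y
      rw [hy] at this
      obtain ⟨h1, h2⟩ := mem_graph_iff_exists.mp this
      exact h2
    have hx : (x : Y) = repCalc Φ ι y := by rw [repCalc_continuousMap, hΦι, hy]
    have h1 : inner ℂ (x : Y) y = ∫ w, (starRingEnd ℂ) (ι w) ∂(repMeasure Φ y) := by
      have := integral_repMeasure_complex Φ (star ι) y
      rw [map_star, hΦι, ContinuousLinearMap.star_eq_adjoint,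
        ContinuousLinearMap.adjoint_inner_right, hy] at this
      exact this.symm
    have h2 : inner ℂ (x : Y) (x : Y) = ∫ w, ((‖ι w‖ ^ 2 : ℝ) : ℂ) ∂(repMeasure Φ y) := by
      have h3 := integral_norm_sq_repMeasure Φ ι y
      rw [hΦι, hy] at h3
      rw [inner_self_eq_norm_sq_to_K]
      refine Eq.trans ?_ (integral_ofReal (𝕜 := ℂ) (f := fun w => ‖ι w‖ ^ 2)).symm
      rw [h3]
      norm_cast
    -- For `x = R y` both sides become integrals over `μ_y`, of `z |ι|² - ι̅` and of `|ι|² ψ`, which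
    -- agree pointwise.
    rw [hAx, inner_sub_right, inner_smul_right, h1, h2, hx,
      measure_repPVM_repCalc Φ hψ (memLp_continuousMap ι),
      integral_map hψ.aemeasurable (by fun_prop)]
    have hint : ∀ g : C(X, ℂ), Integrable g (repMeasure Φ y) := fun g =>
      (memLp_continuousMap g).integrable (by norm_num)
    have e : (fun w => ‖ι w‖ₑ ^ 2) = fun w => ((‖ι w‖₊ ^ 2 : ℝ≥0) : ℝ≥0∞) := by
      ext w; simp [enorm_eq_nnnorm]
    rw [e, integral_withDensity_eq_integral_smul (by fun_prop), ← integral_const_mul,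
      ← integral_sub]
    · refine integral_congr_ae (Eventually.of_forall fun w => ?_)
      simp only [hψι, NNReal.smul_def, NNReal.coe_pow, coe_nnnorm, Complex.real_smul]
      rcases eq_or_ne (ι w) 0 with h0 | h0
      · simp [h0]
      · rw [mul_sub, mul_comm z]
        congr 1
        rw [← Complex.normSq_eq_norm_sq, Complex.normSq_eq_conj_mul_self, mul_assoc,
          mul_inv_cancel₀ h0, mul_one]
    · exact hint ⟨fun w => z * ((‖ι w‖ ^ 2 : ℝ) : ℂ), by fun_prop⟩
    · exact hint ⟨fun w => (starRingEnd ℂ) (ι w), by fun_prop⟩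

theorem IsResolvent.exists_isSpectralMeasure {A : Y →ₗ.[ℂ] Y} {z : ℂ} {R : Y →L[ℂ] Y}
    (hR : IsResolvent A z R) (hn : IsStarNormal R) :
    ∃ E : ProjectionValuedMeasure Y, IsSpectralMeasure A E :=
  ⟨_, isSpectralMeasure_repPVM (cfcHom hn) hR (cfcHom_id hn)
    (ψ := fun w : spectrum ℂ R => z - (w : ℂ)⁻¹) (by fun_prop) fun _ => rfl⟩

end SpectralMeasureExistence

/-! ### Consequences of having a spectral measure -/

section SpectralMeasure

variable {Y : Type*} [NormedAddCommGroup Y] [InnerProductSpace ℂ Y] [CompleteSpace Y]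

namespace ProjectionValuedMeasure

variable (E : ProjectionValuedMeasure Y) {s t : Set ℂ}

theorem proj_proj (hs : MeasurableSet s) (ht : MeasurableSet t) (x : Y) :
    E.proj s (E.proj t x) = E.proj (s ∩ t) x := by
  rw [E.inter s t hs ht]; rfl

theorem proj_idem (hs : MeasurableSet s) (x : Y) : E.proj s (E.proj s x) = E.proj s x := by
  rw [E.proj_proj hs hs, inter_self]

theorem inner_proj_left (hs : MeasurableSet s) (x y : Y) :
    inner ℂ (E.proj s x) y = inner ℂ x (E.proj s y) := by
  have h : (E.proj s).adjoint = E.proj s := (E.isStarProjection s hs).isSelfAdjoint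
  rw [← ContinuousLinearMap.adjoint_inner_left, h]

theorem norm_sq_eq (hs : MeasurableSet s) (x : Y) :
    ‖x‖ ^ 2 = ‖E.proj s x‖ ^ 2 + ‖x - E.proj s x‖ ^ 2 := by
  have h : inner ℂ (E.proj s x) (x - E.proj s x) = 0 := by
    rw [inner_sub_right, E.inner_proj_left hs x (E.proj s x), E.proj_idem hs,
      ← E.inner_proj_left hs, sub_self]
  have := norm_add_sq_eq_norm_sq_add_norm_sq_of_inner_eq_zero _ _ h
  rw [add_sub_cancel] at this
  rw [sq, sq, sq, this]

theorem norm_proj_le (hs : MeasurableSet s) (x : Y) : ‖E.proj s x‖ ≤ ‖x‖ := by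
  have := E.norm_sq_eq hs x
  nlinarith [norm_nonneg (E.proj s x), norm_nonneg x, sq_nonneg ‖x - E.proj s x‖]

theorem proj_empty : E.proj ∅ = 0 := by
  ext x
  have h := E.iUnion (fun _ => ∅) (fun _ => MeasurableSet.empty) (fun _ _ _ => disjoint_bot_left) x
  rw [iUnion_empty] at h
  exact tendsto_nhds_unique tendsto_const_nhds h.summable.tendsto_atTop_zero

omit [CompleteSpace Y] in
theorem enorm_sq_add {a b : Y} (h : inner ℂ a b = 0) : ‖a + b‖ₑ ^ 2 = ‖a‖ₑ ^ 2 + ‖b‖ₑ ^ 2 := by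
  have := norm_add_sq_eq_norm_sq_add_norm_sq_of_inner_eq_zero _ _ h
  simp only [← ofReal_norm, ← ENNReal.ofReal_pow (norm_nonneg _)]
  rw [← ENNReal.ofReal_add (by positivity) (by positivity), sq, sq, sq, this]

instance (x : Y) : IsFiniteMeasure (E.measure x) :=
  ⟨by rw [E.measure_apply x MeasurableSet.univ]; finiteness⟩

theorem measure_univ (x : Y) : E.measure x Set.univ = ‖x‖ₑ ^ 2 := by
  rw [E.measure_apply x MeasurableSet.univ, E.univ]; rfl

theorem measure_eq_zero_iff (hs : MeasurableSet s) (x : Y) :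
    E.measure x s = 0 ↔ E.proj s x = 0 := by
  rw [E.measure_apply x hs, pow_eq_zero_iff two_ne_zero, enorm_eq_zero]

theorem measure_proj (hs : MeasurableSet s) (x : Y) :
    E.measure (E.proj s x) = (E.measure x).restrict s := by
  ext t ht
  rw [Measure.restrict_apply ht, E.measure_apply _ ht, E.proj_proj ht hs,
    E.measure_apply _ (ht.inter hs)]

/-- By additivity of `μ_x`, `x - E(s) x` has the same norm as its image `E(sᶜ) x` under the
orthogonal projection `E(sᶜ)`; hence it equals that image. -/
theorem proj_add_compl (hs : MeasurableSet s) (x : Y) : E.proj s x + E.proj sᶜ x = x := by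
  have h1 : inner ℂ (E.proj s x) (E.proj sᶜ x) = 0 := by
    rw [E.inner_proj_left hs, E.proj_proj hs hs.compl, inter_compl_self, E.proj_empty]
    simp
  have h2 : ‖x - E.proj s x‖ₑ ^ 2 = ‖E.proj sᶜ x‖ₑ ^ 2 := by
    have h3 : inner ℂ (E.proj s x) (x - E.proj s x) = 0 := by
      rw [inner_sub_right, E.inner_proj_left hs x (E.proj s x), E.proj_idem hs,
        ← E.inner_proj_left hs, sub_self]
    have h4 := enorm_sq_add h3
    rw [add_sub_cancel, ← E.measure_univ, ← measure_add_measure_compl hs, E.measure_apply x hs,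
      E.measure_apply x hs.compl] at h4
    exact ((ENNReal.add_right_inj (by finiteness)).mp h4).symm
  have h5 : E.proj sᶜ (x - E.proj s x) = E.proj sᶜ x := by
    rw [map_sub, E.proj_proj hs.compl hs, compl_inter_self, E.proj_empty]
    simp
  have h6 := E.norm_sq_eq hs.compl (x - E.proj s x)
  rw [h5] at h6
  have h7 : ‖x - E.proj s x‖ ^ 2 = ‖E.proj sᶜ x‖ ^ 2 := by
    have := congrArg ENNReal.toReal h2
    simpa using this
  rw [h7, left_eq_add, sq_eq_zero_iff, norm_eq_zero, sub_eq_zero] at h6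
  rw [← h6, add_sub_cancel]

theorem inner_proj_proj_compl (hs : MeasurableSet s) (x y : Y) :
    inner ℂ (E.proj s x) (E.proj sᶜ y) = 0 := by
  rw [E.inner_proj_left hs, E.proj_proj hs hs.compl, inter_compl_self, E.proj_empty]
  simp

theorem measure_add_proj (hs : MeasurableSet s) (x y : Y) :
    E.measure (E.proj s x + E.proj sᶜ y) = E.measure (E.proj s x) + E.measure (E.proj sᶜ y) := by
  ext t ht
  rw [Measure.add_apply, E.measure_apply _ ht, E.measure_apply _ ht, E.measure_apply _ ht, map_add]
  refine enorm_sq_add ?_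
  rw [E.proj_proj ht hs, inter_comm, ← E.proj_proj hs ht, E.proj_proj ht hs.compl, inter_comm,
    ← E.proj_proj hs.compl ht, E.inner_proj_proj_compl hs]

end ProjectionValuedMeasure

namespace IsSpectralMeasure

variable {A : Y →ₗ.[ℂ] Y} {E F : ProjectionValuedMeasure Y} {s : Set ℂ}

theorem proj_mem_domain (hE : IsSpectralMeasure A E) (hs : MeasurableSet s) {x : Y}
    (hx : x ∈ A.domain) : E.proj s x ∈ A.domain := by
  rw [hE.mem_domain_iff] at hx ⊢
  rw [E.measure_proj hs]
  exact (lintegral_mono' Measure.restrict_le_self le_rfl).trans_lt hx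

theorem proj_mem_domain_of_bounded (hE : IsSpectralMeasure A E) (hs : MeasurableSet s) {r : ℝ}
    (hr : ∀ z ∈ s, ‖z‖ ≤ r) (x : Y) : E.proj s x ∈ A.domain := by
  rw [hE.mem_domain_iff, E.measure_proj hs]
  calc _ ≤ ∫⁻ _ in s, ENNReal.ofReal r ^ 2 ∂(E.measure x) := by
        refine setLIntegral_mono (by fun_prop) fun z hz => ?_
        rw [← ofReal_norm]
        exact pow_le_pow_left' (ENNReal.ofReal_le_ofReal (hr z hz)) 2
    _ < ∞ := by
        rw [lintegral_const]
        exact ENNReal.mul_lt_top (by finiteness) (measure_lt_top _ _)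

theorem integrable_id (hE : IsSpectralMeasure A E) {x : Y} (hx : x ∈ A.domain) :
    Integrable (fun z : ℂ => z) (E.measure x) := by
  have h : MemLp (fun z : ℂ => z) 2 (E.measure x) := by
    refine ⟨by fun_prop, ?_⟩
    have := (hE.mem_domain_iff x).mp hx
    rw [← eLpNorm_two_pow] at this
    exact (ENNReal.pow_lt_top_iff.mp this).resolve_right two_ne_zero
  exact h.integrable (by norm_num)

theorem inner_of_mem_graph (hE : IsSpectralMeasure A E) {x y : Y} (h : (x, y) ∈ A.graph) :
    inner ℂ x y = ∫ z, z ∂(E.measure x) := by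
  obtain ⟨hx, rfl⟩ := mem_graph_iff_exists.mp h
  exact hE.inner_apply ⟨x, hx⟩

/-- The measures of `E(s) x` and `c E(sᶜ) y` add, so the two cross terms of the quadratic form sum
to zero; taking `c = 1` and `c = i` makes each vanish. -/
theorem inner_proj_compl_eq_zero (hE : IsSpectralMeasure A E) (hs : MeasurableSet s) {x y a b : Y}
    (ha : (E.proj s x, a) ∈ A.graph) (hb : (E.proj sᶜ y, b) ∈ A.graph) :
    inner ℂ (E.proj sᶜ y) a = 0 := by
  have key : ∀ c : ℂ, inner ℂ (E.proj s x) (c • b) + inner ℂ (c • E.proj sᶜ y) a = 0 := by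
    intro c
    have hcb : (E.proj sᶜ (c • y), c • b) ∈ A.graph := by
      rw [map_smul]; exact A.graph.smul_mem c hb
    have h1 := hE.inner_of_mem_graph (A.graph.add_mem ha hcb)
    have hi := fun {u v : Y} (h : (u, v) ∈ A.graph) =>
      hE.integrable_id (mem_graph_iff_exists.mp h).1
    rw [E.measure_add_proj hs, integral_add_measure (hi ha) (hi hcb), ← hE.inner_of_mem_graph ha,
      ← hE.inner_of_mem_graph hcb, inner_add_left, inner_add_right, inner_add_right] at h1
    rw [← map_smul]
    linear_combination h1
  have h1 := key 1
  have h2 := key Complex.I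
  simp only [one_smul] at h1
  rw [inner_smul_right, inner_smul_left, Complex.conj_I] at h2
  have h3 : Complex.I * inner ℂ (E.proj sᶜ y) a = 0 := by linear_combination (Complex.I * h1 - h2) / 2
  exact (mul_eq_zero.mp h3).resolve_left Complex.I_ne_zero

theorem proj_compl_apply_eq_zero (hE : IsSpectralMeasure A E) (hd : Dense (A.domain : Set Y))
    (hs : MeasurableSet s) {x a : Y} (ha : (E.proj s x, a) ∈ A.graph) : E.proj sᶜ a = 0 := by
  refine hd.eq_zero_of_inner_left ℂ fun v hv => ?_
  rw [E.inner_proj_left hs.compl]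
  exact inner_eq_zero_symm.mp
    (hE.inner_proj_compl_eq_zero hs ha (A.mem_graph ⟨_, hE.proj_mem_domain hs.compl hv⟩))

/-- The spectral projections reduce the operator. -/
theorem proj_mem_graph (hE : IsSpectralMeasure A E) (hd : Dense (A.domain : Set Y))
    (hs : MeasurableSet s) {x y : Y} (h : (x, y) ∈ A.graph) :
    (E.proj s x, E.proj s y) ∈ A.graph := by
  have hx := (mem_graph_iff_exists.mp h).1
  have h1 := A.mem_graph ⟨_, hE.proj_mem_domain hs hx⟩
  have h2 := A.mem_graph ⟨_, hE.proj_mem_domain hs.compl hx⟩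
  set a := A ⟨_, hE.proj_mem_domain hs hx⟩
  set b := A ⟨_, hE.proj_mem_domain hs.compl hx⟩
  have h3 : y = a + b := by
    have h4 := A.graph.sub_mem h (A.graph.add_mem h1 h2)
    have h5 : x - (E.proj s x + E.proj sᶜ x) = 0 := by rw [E.proj_add_compl hs, sub_self]
    exact sub_eq_zero.mp (A.graph_fst_eq_zero_snd h4 h5)
  have h6 : E.proj sᶜ a = 0 := hE.proj_compl_apply_eq_zero hd hs h1
  have h7 : E.proj s b = 0 := by
    have := hE.proj_compl_apply_eq_zero hd hs.compl (x := x) (a := b) h2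
    rwa [compl_compl] at this
  have h8 : E.proj s a = a := by
    have := E.proj_add_compl hs a
    rwa [h6, add_zero] at this
  rw [h3, map_add, h7, h8, add_zero]
  exact h1

/-- For bounded `s` the product `A E(s)` is everywhere defined and has closed graph, hence is
bounded. -/
theorem exists_bounded_restriction (hE : IsSpectralMeasure A E) (hcl : A.IsClosed)
    (hs : MeasurableSet s) {r : ℝ} (hr : ∀ z ∈ s, ‖z‖ ≤ r) :
    ∃ G : Y →L[ℂ] Y, ∀ x, (E.proj s x, G x) ∈ A.graph := by
  let G : Y →ₗ[ℂ] Y := A.toFun.comp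
    (LinearMap.codRestrict A.domain (E.proj s).toLinearMap (hE.proj_mem_domain_of_bounded hs hr))
  have hG : ∀ x, (E.proj s x, G x) ∈ A.graph := fun x =>
    A.mem_graph ⟨_, hE.proj_mem_domain_of_bounded hs hr x⟩
  refine ⟨⟨G, LinearMap.continuous_of_isClosed_graph G ?_⟩, hG⟩
  have e : (G.graph : Set (Y × Y)) = (fun p : Y × Y => (E.proj s p.1, p.2)) ⁻¹' (A.graph : Set (Y × Y)) := by
    ext ⟨x, y⟩
    simp only [SetLike.mem_coe, LinearMap.mem_graph_iff, mem_preimage]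
    refine ⟨fun h => by rw [h]; exact hG x, fun h => ?_⟩
    have := A.graph_fst_eq_zero_snd (A.graph.sub_mem h (hG x)) (sub_self _)
    exact sub_eq_zero.mp this
  rw [e]
  exact hcl.preimage (by fun_prop)

-- The norm is at most twice the numerical radius: polarize with `w` the multiple of `T x` of norm
-- `‖x‖` and use the parallelogram law.
omit [CompleteSpace Y] in
theorem _root_.Galerkin.norm_le_two_mul_of_inner_le {T : Y →L[ℂ] Y} {δ : ℝ}
    (hT : ∀ y, ‖inner ℂ y (T y)‖ ≤ δ * ‖y‖ ^ 2) (x : Y) : ‖T x‖ ≤ 2 * δ * ‖x‖ := by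
  rcases eq_or_ne x 0 with rfl | hx
  · simp
  rcases eq_or_ne (T x) 0 with hv | hv
  · have h1 := (norm_nonneg _).trans (hT x)
    have h2 : 0 < ‖x‖ := norm_pos_iff.mpr hx
    have h3 : 0 ≤ δ := nonneg_of_mul_nonneg_left h1 (by positivity)
    rw [hv, norm_zero]; positivity
  have hx' : 0 < ‖x‖ := norm_pos_iff.mpr hx
  have hv' : 0 < ‖T x‖ := norm_pos_iff.mpr hv
  set w : Y := ((‖x‖ / ‖T x‖ : ℝ) : ℂ) • T x with hw
  have hwn : ‖w‖ = ‖x‖ := by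
    rw [hw, norm_smul, Complex.norm_real, Real.norm_of_nonneg (by positivity)]
    field_simp
  have h1 : 4 * inner ℂ w (T x) = inner ℂ (x + w) (T (x + w)) - inner ℂ (x - w) (T (x - w))
      + (Complex.I * inner ℂ (x + Complex.I • w) (T (x + Complex.I • w))
        - Complex.I * inner ℂ (x - Complex.I • w) (T (x - Complex.I • w))) := by
    simp only [map_add, map_sub, map_smul, inner_add_left, inner_add_right, inner_sub_left,
      inner_sub_right, inner_smul_left, inner_smul_right, Complex.conj_I]
    linear_combination (2 * inner ℂ w (T x) - 2 * inner ℂ x (T w)) * Complex.I_sq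
  have h2 : ‖inner ℂ w (T x)‖ = ‖x‖ * ‖T x‖ := by
    rw [hw, inner_smul_left, inner_self_eq_norm_sq_to_K, Complex.conj_ofReal]
    rw [norm_mul, Complex.norm_real, Real.norm_of_nonneg (by positivity), norm_pow]
    simp only [Complex.coe_algebraMap, Complex.norm_real, norm_norm]
    field_simp
  have p1 := parallelogram_law_with_norm ℂ x w
  have p2 := parallelogram_law_with_norm ℂ x (Complex.I • w)
  have hIw : ‖Complex.I • w‖ = ‖x‖ := by rw [norm_smul, Complex.norm_I, one_mul, hwn]
  rw [hwn] at p1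
  rw [hIw] at p2
  have h3 : 4 * (‖x‖ * ‖T x‖) ≤ 8 * δ * ‖x‖ ^ 2 := by
    have h4 : ‖4 * inner ℂ w (T x)‖ = 4 * (‖x‖ * ‖T x‖) := by
      rw [norm_mul, h2]; norm_num
    rw [← h4, h1]
    refine (norm_add_le _ _).trans ?_
    refine (add_le_add (norm_sub_le _ _) (norm_sub_le _ _)).trans ?_
    rw [norm_mul, norm_mul, Complex.norm_I, one_mul, one_mul]
    have q1 := hT (x + w)
    have q2 := hT (x - w)
    have q3 := hT (x + Complex.I • w)
    have q4 := hT (x - Complex.I • w)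
    have e : 8 * δ * ‖x‖ ^ 2 = δ * ‖x + w‖ ^ 2 + δ * ‖x - w‖ ^ 2 + (δ * ‖x + Complex.I • w‖ ^ 2
        + δ * ‖x - Complex.I • w‖ ^ 2) := by linear_combination (-δ) * p1 - δ * p2
    rw [e]
    gcongr
  have h5 : ‖x‖ * (‖T x‖) ≤ ‖x‖ * (2 * δ * ‖x‖) := by nlinarith
  exact le_of_mul_le_mul_left h5 hx'

/-- A spectral measure prescribes only the quadratic form of `A`, so the bound passes through the
numerical radius. The resulting factor `2` is harmless for small `δ`. -/
theorem norm_sub_smul_le (hE : IsSpectralMeasure A E) (hd : Dense (A.domain : Set Y))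
    (hs : MeasurableSet s) {a : ℂ} {δ : ℝ} (hδ : 0 ≤ δ) (hsδ : ∀ z ∈ s, ‖z - a‖ ≤ δ) {G : Y →L[ℂ] Y}
    (hG : ∀ x, (E.proj s x, G x) ∈ A.graph) (x : Y) :
    ‖G x - a • E.proj s x‖ ≤ 2 * δ * ‖x‖ := by
  refine norm_le_two_mul_of_inner_le (T := G - a • E.proj s) (fun y => ?_) x
  have h1 : E.proj s (G y) = G y := by
    have h2 := E.proj_add_compl hs (G y)
    rwa [hE.proj_compl_apply_eq_zero hd hs (hG y), add_zero] at h2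
  have h2 : inner ℂ y ((G - a • E.proj s) y) = ∫ z, (z - a) ∂(E.measure (E.proj s y)) := by
    have h3 : ∫ _, a ∂(E.measure (E.proj s y)) = a * inner ℂ y (E.proj s y) := by
      have h4 : (E.measure (E.proj s y)).real univ = ‖E.proj s y‖ ^ 2 := by
        rw [Measure.real, E.measure_univ]; simp
      rw [integral_const, h4, inner_starProjection (E.isStarProjection s hs), Complex.real_smul,
        mul_comm]
    rw [integral_sub (hE.integrable_id (mem_graph_iff_exists.mp (hG y)).1) (integrable_const a), h3,
      ← hE.inner_of_mem_graph (hG y), E.inner_proj_left hs, h1, _root_.sub_apply, _root_.smul_apply,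
      inner_sub_right, inner_smul_right]
  rw [h2, E.measure_proj hs]
  refine (norm_setIntegral_le_of_norm_le_const (measure_lt_top _ _) hsδ).trans ?_
  have h5 : (E.measure y).real s = ‖E.proj s y‖ ^ 2 := by
    rw [Measure.real, E.measure_apply y hs]; simp
  rw [h5]
  have := E.norm_proj_le hs y
  gcongr

end IsSpectralMeasure

end SpectralMeasure

/-! ### Uniqueness of spectral projections and convergence of the Galerkin projectors -/

section Uniqueness

variable {Y : Type*} [NormedAddCommGroup Y] [InnerProductSpace ℂ Y] [CompleteSpace Y]
  {A : Y →ₗ.[ℂ] Y}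

theorem IsResolvent.exists_of_norm_lt {z w : ℂ} {R : Y →L[ℂ] Y} (hR : IsResolvent A z R)
    (h : ‖w - z‖ * ‖R‖ < 1) : ∃ R', IsResolvent A w R' := by
  obtain ⟨u, hu⟩ := isUnit_one_sub_of_norm_lt_one (x := -((w - z) • R)) (by rwa [norm_neg, norm_smul])
  have huy : ∀ v, (u : Y →L[ℂ] Y) v = v + (w - z) • R v := fun v => by rw [hu]; simp
  have h1 : ∀ v, (u : Y →L[ℂ] Y) ((↑u⁻¹ : Y →L[ℂ] Y) v) = v := fun v =>
    congrArg (fun q : Y →L[ℂ] Y => q v) u.mul_inv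
  have h2 : ∀ v, (↑u⁻¹ : Y →L[ℂ] Y) ((u : Y →L[ℂ] Y) v) = v := fun v =>
    congrArg (fun q : Y →L[ℂ] Y => q v) u.inv_mul
  refine ⟨R.comp (↑u⁻¹ : Y →L[ℂ] Y), fun y => ?_, fun x => ?_⟩
  · obtain ⟨hd, he⟩ := hR.1 ((↑u⁻¹ : Y →L[ℂ] Y) y)
    refine ⟨hd, ?_⟩
    have h3 := h1 y
    rw [huy] at h3
    have h4 : w • R ((↑u⁻¹ : Y →L[ℂ] Y) y) - A ⟨R ((↑u⁻¹ : Y →L[ℂ] Y) y), hd⟩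
        = (z • R ((↑u⁻¹ : Y →L[ℂ] Y) y) - A ⟨R ((↑u⁻¹ : Y →L[ℂ] Y) y), hd⟩)
          + (w - z) • R ((↑u⁻¹ : Y →L[ℂ] Y) y) := by module
    rw [he] at h4
    exact h4.trans h3
  · have h3 := hR.2 x
    have h4 : w • (x : Y) - A x = (u : Y →L[ℂ] Y) (z • (x : Y) - A x) := by
      rw [huy, h3]
      module
    rw [ContinuousLinearMap.comp_apply, h4, h2, h3]

theorem isClosed_unboundedSpectrum : IsClosed (unboundedSpectrum A) := by
  rw [← isOpen_compl_iff, Metric.isOpen_iff]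
  intro z hz
  obtain ⟨R, hR⟩ := not_not.mp hz
  refine ⟨(‖R‖ + 1)⁻¹, by positivity, fun w hw => not_not.mpr ?_⟩
  refine IsResolvent.exists_of_norm_lt (R := R) hR ?_
  rw [mem_ball_iff_norm, ← one_div, lt_div_iff₀ (by positivity)] at hw
  nlinarith [norm_nonneg (w - z)]

theorem isClosed_spectrum_inter (m : ℕ) :
    IsClosed {z | z ∈ unboundedSpectrum A ∧ ‖z‖ ≤ (m : ℝ)} :=
  isClosed_unboundedSpectrum.inter (isClosed_le continuous_norm continuous_const)

/-- A locally null set is null, applied to the measure of `x`. -/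
theorem ProjectionValuedMeasure.proj_eq_zero_of_locally (E : ProjectionValuedMeasure Y)
    {s : Set ℂ} (hs : MeasurableSet s) {x : Y}
    (h : ∀ a ∈ s, ∃ δ > 0, E.proj (Metric.closedBall a δ) x = 0) : E.proj s x = 0 := by
  rw [← E.measure_eq_zero_iff hs]
  refine measure_null_of_locally_null s fun a ha => ?_
  obtain ⟨δ, hδ, h0⟩ := h a ha
  exact ⟨_, mem_nhdsWithin_of_mem_nhds (Metric.closedBall_mem_nhds a hδ),
    (E.measure_eq_zero_iff Metric.isClosed_closedBall.measurableSet x).mpr h0⟩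

namespace IsSpectralMeasure

variable {E F : ProjectionValuedMeasure Y} {s : Set ℂ} {a b : ℂ} {δ : ℝ}

theorem exists_restriction_closedBall (hE : IsSpectralMeasure A E) (hd : Dense (A.domain : Set Y))
    (hcl : A.IsClosed) (a : ℂ) (hδ : 0 ≤ δ) :
    ∃ G : Y →L[ℂ] Y, (∀ x, (E.proj (Metric.closedBall a δ) x, G x) ∈ A.graph) ∧
      (∀ x, E.proj (Metric.closedBall a δ) (G x) = G x) ∧
      (∀ x, ‖G x - a • E.proj (Metric.closedBall a δ) x‖
        ≤ 2 * δ * ‖E.proj (Metric.closedBall a δ) x‖) := by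
  have hm : MeasurableSet (Metric.closedBall a δ) := Metric.isClosed_closedBall.measurableSet
  obtain ⟨G, hG⟩ := hE.exists_bounded_restriction hcl hm (r := ‖a‖ + δ) (fun z hz => by
    rw [mem_closedBall_iff_norm] at hz
    calc ‖z‖ = ‖a + (z - a)‖ := by rw [add_sub_cancel]
      _ ≤ _ := (norm_add_le _ _).trans (by gcongr))
  refine ⟨G, hG, fun x => ?_, fun x => ?_⟩
  · have h2 := E.proj_add_compl hm (G x)
    rwa [hE.proj_compl_apply_eq_zero hd hm (hG x), add_zero] at h2
  · have h1 := hE.norm_sub_smul_le hd hm hδ (fun z hz => mem_closedBall_iff_norm.mp hz) hG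
      (E.proj (Metric.closedBall a δ) x)
    have h2 := hG (E.proj (Metric.closedBall a δ) x)
    rw [E.proj_idem hm] at h1 h2
    rwa [A.mem_graph_snd_inj h2 (hG x) rfl] at h1

/-- On the range of the projection `a - A` has norm at most `2δ`, whereas its inverse is bounded by
`‖R‖`; with `2δ‖R‖ < 1` the range must be trivial. -/
theorem proj_closedBall_eq_zero (hE : IsSpectralMeasure A E) (hd : Dense (A.domain : Set Y))
    (hcl : A.IsClosed) {R : Y →L[ℂ] Y} (hR : IsResolvent A a R) (hδ : 0 ≤ δ)
    (h : ‖R‖ * (2 * δ) < 1) : E.proj (Metric.closedBall a δ) = 0 := by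
  obtain ⟨G, hG, -, hn⟩ := hE.exists_restriction_closedBall hd hcl a hδ
  ext x
  set x' := E.proj (Metric.closedBall a δ) x with hx'
  have h1 : R (a • x' - G x) = x' := by
    obtain ⟨hx, he⟩ := mem_graph_iff_exists.mp (hG x)
    rw [← he]
    exact hR.2 ⟨_, hx⟩
  have h2 : ‖x'‖ ≤ ‖R‖ * (2 * δ) * ‖x'‖ := by
    calc ‖x'‖ = ‖R (a • x' - G x)‖ := by rw [h1]
      _ ≤ ‖R‖ * ‖a • x' - G x‖ := R.le_opNorm _
      _ ≤ ‖R‖ * (2 * δ * ‖x'‖) := by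
        gcongr
        rw [norm_sub_rev]
        exact hn x
      _ = _ := by ring
  have h3 : ‖x'‖ = 0 := by nlinarith [norm_nonneg x']
  simpa using h3

theorem proj_compl_spectrum (hE : IsSpectralMeasure A E) (hd : Dense (A.domain : Set Y))
    (hcl : A.IsClosed) (x : Y) : E.proj (unboundedSpectrum A)ᶜ x = 0 := by
  refine E.proj_eq_zero_of_locally isClosed_unboundedSpectrum.measurableSet.compl fun a ha => ?_
  obtain ⟨R, hR⟩ := not_not.mp ha
  refine ⟨(‖R‖ + 1)⁻¹ / 2, by positivity, ?_⟩
  rw [hE.proj_closedBall_eq_zero hd hcl (R := R) hR (by positivity), _root_.zero_apply]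
  rw [mul_div_cancel₀ _ two_ne_zero, ← div_eq_mul_inv, div_lt_one (by positivity)]
  exact lt_add_one _

/-- Let `q` and `p` be the two projections. As `q` reduces `A`, one has `(b - a) q p = q (A - a) p -
(A - b) q p`, and each term has norm at most `2δ ‖q p‖`. With `4δ < ‖b - a‖` this forces `q p = 0`.
-/
theorem proj_closedBall_proj_closedBall (hE : IsSpectralMeasure A E) (hF : IsSpectralMeasure A F)
    (hd : Dense (A.domain : Set Y)) (hcl : A.IsClosed) (hδ : 0 ≤ δ) (h : 4 * δ < ‖b - a‖) (x : Y) :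
    F.proj (Metric.closedBall b δ) (E.proj (Metric.closedBall a δ) x) = 0 := by
  have hma : MeasurableSet (Metric.closedBall a δ) := Metric.isClosed_closedBall.measurableSet
  have hmb : MeasurableSet (Metric.closedBall b δ) := Metric.isClosed_closedBall.measurableSet
  obtain ⟨G, hG, hGr, hGn⟩ := hE.exists_restriction_closedBall hd hcl a hδ
  obtain ⟨H, hH, -, hHn⟩ := hF.exists_restriction_closedBall hd hcl b hδ
  have hcomp : ∀ x, F.proj (Metric.closedBall b δ) (G x)
      = H (E.proj (Metric.closedBall a δ) x) := fun x =>
    A.mem_graph_snd_inj (hF.proj_mem_graph hd hmb (hG x)) (hH _) rfl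
  have hcontr : ∀ x, ‖E.proj (Metric.closedBall a δ) x‖ ≤ ‖x‖ := E.norm_proj_le hma
  have hidem := E.proj_idem hma
  set p := E.proj (Metric.closedBall a δ)
  set q := F.proj (Metric.closedBall b δ)
  have hc : 0 < ‖b - a‖ - 2 * δ := by linarith
  have key : ∀ x, ‖(q.comp p) x‖ ≤ 2 * δ / (‖b - a‖ - 2 * δ) * ‖q.comp p‖ * ‖x‖ := by
    intro x
    have h1 : (b - a) • q (p x) = q (G x - a • p x) - (H (p x) - b • q (p x)) := by
      rw [map_sub, map_smul, hcomp]
      module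
    have h2 : q (G x - a • p x) = (q.comp p) (G x - a • p x) := by
      rw [ContinuousLinearMap.comp_apply, map_sub p, map_smul, hGr, hidem]
    have h3 : ‖b - a‖ * ‖q (p x)‖ ≤ ‖q.comp p‖ * (2 * δ * ‖x‖) + 2 * δ * ‖q (p x)‖ := by
      rw [← norm_smul, h1]
      refine (norm_sub_le _ _).trans (add_le_add ?_ (hHn _))
      rw [h2]
      refine (ContinuousLinearMap.le_opNorm _ _).trans ?_
      gcongr
      exact (hGn x).trans (by gcongr; exact hcontr x)
    rw [ContinuousLinearMap.comp_apply, div_mul_eq_mul_div, div_mul_eq_mul_div, le_div_iff₀ hc]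
    linarith
  have h4 := ContinuousLinearMap.opNorm_le_bound _ (by positivity) key
  have h5 : 2 * δ / (‖b - a‖ - 2 * δ) < 1 := by rw [div_lt_one hc]; linarith
  have h6 : ‖q.comp p‖ = 0 := by nlinarith [norm_nonneg (q.comp p)]
  rw [← ContinuousLinearMap.comp_apply, norm_eq_zero.mp h6, _root_.zero_apply]

/-- Small balls off `s` are separated from small balls about points of `s`, so locality is used for
both measures; taking adjoints in between puts `E(s)` on the left. -/
theorem proj_proj_of_isClosed (hE : IsSpectralMeasure A E) (hF : IsSpectralMeasure A F)
    (hd : Dense (A.domain : Set Y)) (hcl : A.IsClosed) (hs : IsClosed s) (x : Y) :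
    F.proj s (E.proj s x) = E.proj s x := by
  have h : F.proj sᶜ (E.proj s x) = 0 := by
    refine F.proj_eq_zero_of_locally hs.measurableSet.compl fun b hb => ?_
    obtain ⟨ε, hε, hball⟩ := Metric.isOpen_iff.mp hs.isOpen_compl b hb
    -- Centres are at least `ε` apart and `4 · ε/5 < ε`.
    refine ⟨ε / 5, by positivity, ?_⟩
    have hm : MeasurableSet (Metric.closedBall b (ε / 5)) := Metric.isClosed_closedBall.measurableSet
    refine ext_inner_left ℂ fun y => ?_
    rw [← F.inner_proj_left hm, ← E.inner_proj_left hs.measurableSet, inner_zero_right]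
    have h0 : E.proj s (F.proj (Metric.closedBall b (ε / 5)) y) = 0 := by
      refine E.proj_eq_zero_of_locally hs.measurableSet fun a ha => ⟨ε / 5, by positivity, ?_⟩
      refine hF.proj_closedBall_proj_closedBall hE hd hcl (by positivity) ?_ y
      have : ε ≤ ‖a - b‖ := by
        by_contra! hlt
        exact hball (mem_ball_iff_norm.mpr hlt) ha
      linarith
    rw [h0, inner_zero_left]
  have h2 := F.proj_add_compl hs.measurableSet (E.proj s x)
  rwa [h, add_zero] at h2

/-- A spectral measure of `A` is determined by `A` on closed sets. -/
theorem proj_eq_of_isClosed (hE : IsSpectralMeasure A E) (hF : IsSpectralMeasure A F)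
    (hd : Dense (A.domain : Set Y)) (hcl : A.IsClosed) (hs : IsClosed s) :
    E.proj s = F.proj s := by
  ext x
  refine ext_inner_left ℂ fun y => ?_
  rw [← hF.proj_proj_of_isClosed hE hd hcl hs x, ← E.inner_proj_left hs.measurableSet y (F.proj s x),
    ← F.inner_proj_left hs.measurableSet, hE.proj_proj_of_isClosed hF hd hcl hs,
    E.inner_proj_left hs.measurableSet]

theorem galerkinProjector_eq (hE : IsSpectralMeasure A E) (hd : Dense (A.domain : Set Y))
    (hcl : A.IsClosed) (m : ℕ) :
    galerkinProjector A m = E.proj {z | z ∈ unboundedSpectrum A ∧ ‖z‖ ≤ m} := by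
  have h : ∃ E : ProjectionValuedMeasure Y, IsSpectralMeasure A E := ⟨E, hE⟩
  rw [galerkinProjector, spectralProjector, dif_pos h]
  exact h.choose_spec.proj_eq_of_isClosed hE hd hcl (isClosed_spectrum_inter m)

/-- The complements of the truncated spectra decrease to the complement of the spectrum, which is
null for every `x`; continuity from above of `μ_x` concludes. -/
theorem tendsto_galerkinProjector (hE : IsSpectralMeasure A E) (hd : Dense (A.domain : Set Y))
    (hcl : A.IsClosed) (x : Y) : Tendsto (fun m => galerkinProjector A m x) atTop (𝓝 x) := by
  simp_rw [hE.galerkinProjector_eq hd hcl]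
  set s : ℕ → Set ℂ := fun m => {z | z ∈ unboundedSpectrum A ∧ ‖z‖ ≤ m} with hs
  have hm : ∀ m, MeasurableSet (s m) := fun m => (isClosed_spectrum_inter m).measurableSet
  have hmono : Monotone s := fun m n hmn z hz => ⟨hz.1, hz.2.trans (by exact_mod_cast hmn)⟩
  have hU : ⋂ m, (s m)ᶜ = (unboundedSpectrum A)ᶜ := by
    rw [← compl_iUnion]
    congr 1
    ext z
    simp only [hs, mem_iUnion, mem_ofPred_eq, exists_and_left, and_iff_left_iff_imp]
    exact fun _ => exists_nat_ge ‖z‖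
  have h1 : Tendsto (fun m => E.measure x (s m)ᶜ) atTop (𝓝 0) := by
    have := tendsto_measure_iInter_atTop (μ := E.measure x) (s := fun m => (s m)ᶜ)
      (fun m => (hm m).compl.nullMeasurableSet)
      (fun m n hmn => compl_subset_compl.mpr (hmono hmn)) ⟨0, measure_ne_top _ _⟩
    rwa [hU, (E.measure_eq_zero_iff isClosed_unboundedSpectrum.measurableSet.compl x).mpr
      (hE.proj_compl_spectrum hd hcl x)] at this
  have h2 : Tendsto (fun m => E.proj (s m)ᶜ x) atTop (𝓝 0) := by
    rw [tendsto_zero_iff_norm_tendsto_zero]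
    have h3 := (ENNReal.tendsto_toReal ENNReal.zero_ne_top).comp h1
    have h4 := (Real.continuous_sqrt.tendsto 0).comp h3
    rw [Real.sqrt_zero] at h4
    refine h4.congr fun m => ?_
    simp [E.measure_apply x (hm m).compl]
  have h5 := (tendsto_const_nhds (x := x)).sub h2
  rw [sub_zero] at h5
  refine h5.congr fun m => ?_
  rw [sub_eq_iff_eq_add, E.proj_add_compl (hm m)]

end IsSpectralMeasure

end Uniqueness

/-! ### Galerkin approximation with abstract projectors -/

section Bridge

variable {𝕜 : Type*} [RCLike 𝕜] {Y : Type*} [NormedAddCommGroup Y] [InnerProductSpace 𝕜 Y]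
  [NormedSpace ℝ Y] [IsScalarTower ℝ 𝕜 Y] [CompleteSpace Y]

omit [IsScalarTower ℝ 𝕜 Y] [CompleteSpace Y] in
theorem isProjectedSolution_iff {A : Y →ₗ.[𝕜] Y} {B : Y → Y} {D : Set Y} {T : ℝ} {U₀ : Y}
    {u : ℝ → Y} {P G : Y →L[ℝ] Y} (hG : ∀ x, (P x, G x) ∈ A.graph) :
    IsProjectedSolution A B D P T U₀ u ↔ IsCutoffSolution P G B D T U₀ u := by
  have key : ∀ x, P x = x → ∃ h : x ∈ A.domain, A ⟨x, h⟩ = G x := by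
    intro x hx
    have := hG x
    rw [hx] at this
    exact mem_graph_iff_exists.mp this
  refine ⟨fun h => ⟨h.mapsTo, h.mem_range, h.initial, fun t ht => ?_⟩,
    fun h => ⟨fun t ht => (h.equation t ht).continuousWithinAt, h.mapsTo, h.mem_range, h.initial,
      fun t ht => ?_⟩⟩
  · obtain ⟨h1, h2⟩ := h.equation t ht
    obtain ⟨_, h3⟩ := key _ (h.mem_range t ht)
    rwa [h3] at h2
  · obtain ⟨h1, h3⟩ := key _ (h.mem_range t ht)
    refine ⟨h1, ?_⟩
    rw [h3]
    exact h.equation t ht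

/-- Covers both scalar fields at once; the projectors are taken real-linear, which is all that the
evolution argument needs. -/
theorem exists_forall_isProjectedSolution_and_tendsto {A : Y →ₗ.[𝕜] Y} {S : ℝ → Y →L[𝕜] Y}
    {P G : ℕ → Y →L[ℝ] Y} {D : Set Y} {B : Y → Y} {T : ℝ} {U₀ : Y} {U : ℝ → Y} {L : ℝ≥0}
    (hd : Dense (A.domain : Set Y)) (hS : IsC0Semigroup S) (hA : IsGenerator A S)
    (hP : ∀ m x, ‖P m x‖ ≤ ‖x‖) (hPP : ∀ m x, P m (P m x) = P m x)
    (hG : ∀ m x, (P m x, G m x) ∈ A.graph)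
    (hPA : ∀ m x y, (x, y) ∈ A.graph → (P m x, P m y) ∈ A.graph)
    (hlim : ∀ x, Tendsto (fun m => P m x) atTop (𝓝 x))
    (hD : IsOpen D) (hB : LipschitzOnWith L B D) (hT : 0 < T)
    (hU : IsMildSolution S B D T U₀ U) :
    ∃ mstar : ℕ, (∀ m ≥ mstar, ∃ u : ℝ → Y, IsProjectedSolution A B D (P m) T U₀ u) ∧
      ∀ u : ℕ → ℝ → Y, (∀ m ≥ mstar, IsProjectedSolution A B D (P m) T U₀ (u m)) →
        Tendsto (fun m => ⨆ t : Icc (0 : ℝ) T, ‖U t - u m t‖) atTop (𝓝 0) := by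
  have hd' : Dense {x | ∃ y, IsGeneratorPair (fun t => (S t).restrictScalars ℝ) x y} := by
    convert hd using 1
    ext x
    exact ⟨fun ⟨y, hy⟩ => (mem_graph_iff_exists.mp ((hA x y).mpr hy)).1,
      fun hx => ⟨_, (hA x _).mp (A.mem_graph ⟨x, hx⟩)⟩⟩
  have hcut : ∀ m, IsSpectralCutoff (fun t => (S t).restrictScalars ℝ) (P m) (G m) := fun m =>
    { norm_le := hP m
      idem := hPP m
      isGeneratorPair := fun x => (hA _ _).mp (hG m x)
      map_generator := fun x y h => A.mem_graph_snd_inj (hPA m x y ((hA x y).mpr h)) (hG m x) rfl }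
  simp_rw [fun m (u : ℝ → Y) => isProjectedSolution_iff (B := B) (D := D) (T := T) (U₀ := U₀)
    (u := u) (hG m)]
  exact exists_forall_isCutoffSolution_and_tendsto hS.restrictScalars hcut hlim hd' hT hD hB
    hU.continuousOn hU.mapsTo hU.eq_duhamel

end Bridge

/-! ### The theorem on complex Hilbert spaces. -/

section Complex

variable {Y : Type*} [NormedAddCommGroup Y] [InnerProductSpace ℂ Y] [CompleteSpace Y]

theorem IsNormalOperator.exists_isSpectralMeasure {A : Y →ₗ.[ℂ] Y} (hA : IsNormalOperator A)
    {z : ℂ} {R : Y →L[ℂ] Y} (hR : IsResolvent A z R) : ∃ E, IsSpectralMeasure A E :=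
  hR.exists_isSpectralMeasure (hA.isStarNormal_resolvent hR)

theorem complex_galerkin_approximation {A : Y →ₗ.[ℂ] Y} {S : ℝ → Y →L[ℂ] Y} {D : Set Y} {B : Y → Y}
    {T : ℝ} {U₀ : Y} {U : ℝ → Y} {L : ℝ≥0} (hA : IsNormalOperator A) (hS : IsC0Semigroup S)
    (hAS : IsGenerator A S) (hD : IsOpen D) (hB : LipschitzOnWith L B D) (hT : 0 < T)
    (hU : IsMildSolution S B D T U₀ U) :
    ∃ mstar : ℕ,
      (∀ m ≥ mstar, ∃ u : ℝ → Y, IsProjectedSolution A B D (galerkinProjector A m) T U₀ u) ∧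
      ∀ u : ℕ → ℝ → Y,
        (∀ m ≥ mstar, IsProjectedSolution A B D (galerkinProjector A m) T U₀ (u m)) →
        Tendsto (fun m => ⨆ t : Icc (0 : ℝ) T, ‖U t - u m t‖) atTop (𝓝 0) := by
  obtain ⟨a, R, hR⟩ := exists_isResolvent hA.isClosed hS hAS
  obtain ⟨E, hE⟩ := hA.exists_isSpectralMeasure hR
  have hd := hA.dense_domain
  have hm : ∀ m : ℕ, MeasurableSet {z | z ∈ unboundedSpectrum A ∧ ‖z‖ ≤ m} := fun m =>
    (isClosed_spectrum_inter m).measurableSet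
  have hP := hE.galerkinProjector_eq hd hA.isClosed
  choose G hG using fun m : ℕ => hE.exists_bounded_restriction hA.isClosed (hm m) fun z hz => hz.2
  refine exists_forall_isProjectedSolution_and_tendsto
    (P := fun m => (galerkinProjector A m).restrictScalars ℝ)
    (G := fun m => (G m).restrictScalars ℝ) hd hS hAS (fun m x => ?_) (fun m x => ?_)
    (fun m x => ?_) (fun m x y h => ?_) (hE.tendsto_galerkinProjector hd hA.isClosed) hD hB hT hU
  all_goals simp only [ContinuousLinearMap.coe_restrictScalars', hP]
  · exact E.norm_proj_le (hm m) x
  · exact E.proj_idem (hm m) x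
  · exact hG m x
  · exact hE.proj_mem_graph hd (hm m) h

end Complex

/-! ### Complexification -/

section RealCase

variable {Y : Type*} [NormedAddCommGroup Y]

namespace Complexification

theorem norm_re_le (z : Complexification Y) : ‖z.re‖ ≤ ‖z‖ := by
  refine le_of_sq_le_sq ?_ (norm_nonneg z)
  rw [norm_sq]
  exact le_add_of_nonneg_right (by positivity)

theorem norm_im_le (z : Complexification Y) : ‖z.im‖ ≤ ‖z‖ := by
  refine le_of_sq_le_sq ?_ (norm_nonneg z)
  rw [norm_sq]
  exact le_add_of_nonneg_left (by positivity)

theorem norm_mk_zero (x : Y) : ‖mk x 0‖ = ‖x‖ := by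
  rw [← sq_eq_sq₀ (norm_nonneg _) (norm_nonneg _), norm_sq]
  simp

@[simp] theorem re_sub (z w : Complexification Y) : (z - w).re = z.re - w.re := rfl
@[simp] theorem im_sub (z w : Complexification Y) : (z - w).im = z.im - w.im := rfl

/-- Complex conjugation. -/
def conj : Complexification Y →+ Complexification Y where
  toFun z := mk z.re (-z.im)
  map_zero' := by apply ext <;> simp
  map_add' z w := by apply ext <;> simp [add_comm]

@[simp] theorem re_conj (z : Complexification Y) : (conj z).re = z.re := rfl
@[simp] theorem im_conj (z : Complexification Y) : (conj z).im = -z.im := rfl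

@[simp] theorem conj_conj (z : Complexification Y) : conj (conj z) = z := by
  apply ext <;> simp

theorem norm_conj (z : Complexification Y) : ‖conj z‖ = ‖z‖ := by
  rw [← sq_eq_sq₀ (norm_nonneg _) (norm_nonneg _), norm_sq, norm_sq]
  simp

variable [InnerProductSpace ℝ Y]

@[simp] theorem re_real_smul (c : ℝ) (z : Complexification Y) : (c • z).re = c • z.re := by
  rw [← Complex.coe_smul, re_smul]
  simp

@[simp] theorem im_real_smul (c : ℝ) (z : Complexification Y) : (c • z).im = c • z.im := by
  rw [← Complex.coe_smul, im_smul]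
  simp

/-- The real part, as a continuous linear map. -/
def reCLM : Complexification Y →L[ℝ] Y :=
  LinearMap.mkContinuous
    { toFun := re
      map_add' := re_add
      map_smul' := re_real_smul } 1 fun z => by simpa using norm_re_le z

/-- The imaginary part, as a continuous linear map. -/
def imCLM : Complexification Y →L[ℝ] Y :=
  LinearMap.mkContinuous
    { toFun := im
      map_add' := im_add
      map_smul' := im_real_smul } 1 fun z => by simpa using norm_im_le z

/-- The inclusion `x ↦ x + i 0`, as a continuous linear map. -/
def ofRealCLM : Y →L[ℝ] Complexification Y :=
  LinearMap.mkContinuous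
    { toFun := fun x => mk x 0
      map_add' := fun x y => by apply ext <;> simp
      map_smul' := fun c x => by apply ext <;> simp } 1 fun x => by simpa using (norm_mk_zero x).le

@[simp] theorem reCLM_apply (z : Complexification Y) : reCLM z = z.re := rfl
@[simp] theorem imCLM_apply (z : Complexification Y) : imCLM z = z.im := rfl
@[simp] theorem ofRealCLM_apply (x : Y) : ofRealCLM x = mk x 0 := rfl

theorem conj_smul (c : ℂ) (z : Complexification Y) : conj (c • z) = star c • conj z := by
  apply ext
  · simp
  · simp
    abel

theorem inner_conj_conj (z w : Complexification Y) :
    inner ℂ (conj z) (conj w) = star (inner ℂ z w) := by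
  rw [inner_def, inner_def]
  apply Complex.ext <;> simp [neg_add_eq_sub]

theorem inner_conj_left (z w : Complexification Y) :
    inner ℂ (conj z) w = star (inner ℂ z (conj w)) := by
  rw [← inner_conj_conj, conj_conj]

omit [InnerProductSpace ℝ Y] in
theorem continuous_conj : Continuous (conj : Complexification Y → Complexification Y) :=
  AddMonoidHomClass.continuous_of_bound conj 1 fun z => by simp [norm_conj]

/-- The conjugate `J T J` of a bounded operator `T`, `J` being the complex conjugation. -/
def conjCLM (T : Complexification Y →L[ℂ] Complexification Y) :
    Complexification Y →L[ℂ] Complexification Y :=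
  LinearMap.mkContinuous
    { toFun := fun z => conj (T (conj z))
      map_add' := fun z w => by simp
      map_smul' := fun c z => by simp [conj_smul] } ‖T‖ fun z => by
        simpa [norm_conj] using T.le_opNorm (conj z)

@[simp] theorem conjCLM_apply (T : Complexification Y →L[ℂ] Complexification Y)
    (z : Complexification Y) : conjCLM T z = conj (T (conj z)) := rfl

/-- The complexification of a bounded operator. -/
def mapCLM (T : Y →L[ℝ] Y) : Complexification Y →L[ℂ] Complexification Y :=
  LinearMap.mkContinuous
    { toFun := fun z => mk (T z.re) (T z.im)
      map_add' := fun z w => by apply ext <;> simp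
      map_smul' := fun c z => by apply ext <;> simp } ‖T‖ fun z => by
        refine le_of_sq_le_sq ?_ (by positivity)
        rw [norm_sq, mul_pow, norm_sq z, mul_add, ← mul_pow, ← mul_pow]
        exact add_le_add (pow_le_pow_left₀ (norm_nonneg _) (T.le_opNorm _) 2)
          (pow_le_pow_left₀ (norm_nonneg _) (T.le_opNorm _) 2)

@[simp] theorem mapCLM_apply (T : Y →L[ℝ] Y) (z : Complexification Y) :
    mapCLM T z = mk (T z.re) (T z.im) := rfl

variable [CompleteSpace Y]

theorem isStarProjection_conjCLM {p : Complexification Y →L[ℂ] Complexification Y}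
    (hp : IsStarProjection p) : IsStarProjection (conjCLM p) where
  isIdempotentElem := by
    ext z
    have := congrArg (fun q : Complexification Y →L[ℂ] Complexification Y => q (conj z))
      hp.isIdempotentElem
    have h2 : p (p (conj z)) = p (conj z) := this
    simp [h2]
  isSelfAdjoint := by
    have h : p.adjoint = p := hp.isSelfAdjoint
    refine ((ContinuousLinearMap.eq_adjoint_iff _ _).mpr fun x y => ?_).symm
    rw [conjCLM_apply, conjCLM_apply, inner_conj_left, ← ContinuousLinearMap.adjoint_inner_right, h,
      ← inner_conj_conj, conj_conj]

theorem isStarNormal_mapCLM {T : Y →L[ℝ] Y} (hT : IsStarNormal T) : IsStarNormal (mapCLM T) := by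
  have h : (mapCLM T).adjoint = mapCLM T.adjoint := by
    refine ((ContinuousLinearMap.eq_adjoint_iff _ _).mpr fun x y => ?_).symm
    rw [inner_def, inner_def]
    simp [ContinuousLinearMap.adjoint_inner_left]
  have h2 : ∀ x, T.adjoint (T x) = T (T.adjoint x) := fun x =>
    congrArg (fun q : Y →L[ℝ] Y => q x) hT.star_comm_self
  constructor
  change (mapCLM T).adjoint * mapCLM T = mapCLM T * (mapCLM T).adjoint
  rw [h]
  ext z
  apply Complexification.ext <;> simp [h2]

end Complexification

open Complexification

variable [InnerProductSpace ℝ Y] {A : Y →ₗ.[ℝ] Y}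

theorem mem_graph_complexifyOperator_iff {z w : Complexification Y} :
    (z, w) ∈ (complexifyOperator A).graph ↔ (z.re, w.re) ∈ A.graph ∧ (z.im, w.im) ∈ A.graph := by
  simp only [mem_graph_iff_exists]
  constructor
  · rintro ⟨h, rfl⟩
    exact ⟨⟨h.1, rfl⟩, ⟨h.2, rfl⟩⟩
  · rintro ⟨⟨h1, h2⟩, ⟨h3, h4⟩⟩
    exact ⟨⟨h1, h3⟩, Complexification.ext h2 h4⟩

theorem conj_mem_graph_complexifyOperator {z w : Complexification Y}
    (h : (z, w) ∈ (complexifyOperator A).graph) :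
    (conj z, conj w) ∈ (complexifyOperator A).graph := by
  rw [mem_graph_complexifyOperator_iff] at h ⊢
  exact ⟨h.1, A.graph.neg_mem h.2⟩

theorem dense_domain_complexifyOperator (hA : Dense (A.domain : Set Y)) :
    Dense ((complexifyOperator A).domain : Set (Complexification Y)) := by
  intro z
  rw [mem_closure_iff_seq_limit]
  obtain ⟨u, hu, hur⟩ := mem_closure_iff_seq_limit.mp (hA z.re)
  obtain ⟨v, hv, hvr⟩ := mem_closure_iff_seq_limit.mp (hA z.im)
  refine ⟨fun n => mk (u n) (v n), fun n => ⟨hu n, hv n⟩, ?_⟩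
  have e : ∀ x y : Y, mk x y = ofRealCLM x + Complex.I • ofRealCLM y := fun x y => by
    apply Complexification.ext <;> simp
  have h := ((ofRealCLM.continuous.tendsto _).comp hur).add
    (((ofRealCLM.continuous.tendsto _).comp hvr).const_smul Complex.I)
  rw [← e] at h
  exact h.congr fun n => (e _ _).symm

theorem isClosed_complexifyOperator (hA : A.IsClosed) : (complexifyOperator A).IsClosed := by
  have e : ((complexifyOperator A).graph : Set (Complexification Y × Complexification Y)) =
      (fun p : Complexification Y × Complexification Y => (reCLM p.1, reCLM p.2)) ⁻¹' A.graph ∩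
      (fun p : Complexification Y × Complexification Y => (imCLM p.1, imCLM p.2)) ⁻¹' A.graph := by
    ext ⟨z, w⟩
    exact mem_graph_complexifyOperator_iff
  rw [LinearPMap.IsClosed, e]
  exact (hA.preimage (by fun_prop)).inter (hA.preimage (by fun_prop))

theorem isResolvent_iff_graph {𝕜 H : Type*} [RCLike 𝕜] [NormedAddCommGroup H]
    [InnerProductSpace 𝕜 H] {A : H →ₗ.[𝕜] H} {z : 𝕜} {R : H →L[𝕜] H} :
    IsResolvent A z R ↔ (∀ y, (R y, z • R y - y) ∈ A.graph) ∧
      ∀ x y, (x, y) ∈ A.graph → R (z • x - y) = x := by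
  refine ⟨fun h => ⟨h.mem_graph, fun x y => h.apply_eq⟩, fun h => ⟨fun y => ?_, fun x => ?_⟩⟩
  · obtain ⟨hd, he⟩ := mem_graph_iff_exists.mp (h.1 y)
    exact ⟨hd, by rw [he, sub_sub_cancel]⟩
  · exact h.2 _ _ (A.mem_graph x)

theorem IsResolvent.mapCLM {a : ℝ} {R : Y →L[ℝ] Y} (hR : IsResolvent A a R) :
    IsResolvent (complexifyOperator A) (a : ℂ) (mapCLM R) := by
  rw [isResolvent_iff_graph]
  refine ⟨fun y => mem_graph_complexifyOperator_iff.mpr ⟨?_, ?_⟩, fun x y h => ?_⟩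
  · simpa using hR.mem_graph y.re
  · simpa using hR.mem_graph y.im
  · obtain ⟨h1, h2⟩ := mem_graph_complexifyOperator_iff.mp h
    apply Complexification.ext
    · simpa using hR.apply_eq h1
    · simpa using hR.apply_eq h2

theorem IsResolvent.conjCLM {z : ℂ} {R : Complexification Y →L[ℂ] Complexification Y}
    (hR : IsResolvent (complexifyOperator A) z R) :
    IsResolvent (complexifyOperator A) (star z) (conjCLM R) := by
  rw [isResolvent_iff_graph]
  refine ⟨fun y => ?_, fun x y h => ?_⟩
  · have := conj_mem_graph_complexifyOperator (hR.mem_graph (conj y))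
    simpa [conj_smul] using this
  · have := hR.apply_eq (conj_mem_graph_complexifyOperator h)
    simp [conj_smul, this]

theorem star_mem_unboundedSpectrum_iff {z : ℂ} :
    star z ∈ unboundedSpectrum (complexifyOperator A) ↔
      z ∈ unboundedSpectrum (complexifyOperator A) := by
  refine not_iff_not.mp ?_
  have key : ∀ z, z ∉ unboundedSpectrum (complexifyOperator A) ↔
    ∃ R, IsResolvent (complexifyOperator A) z R := fun z => not_not
  rw [key, key]
  exact ⟨fun ⟨R, hR⟩ => ⟨_, star_star z ▸ hR.conjCLM⟩, fun ⟨R, hR⟩ => ⟨_, hR.conjCLM⟩⟩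

variable [CompleteSpace Y]

/-- The projection-valued measure `s ↦ J E(s̄) J`, `J` being the complex conjugation. -/
def ProjectionValuedMeasure.conj (E : ProjectionValuedMeasure (Complexification Y)) :
    ProjectionValuedMeasure (Complexification Y) where
  proj s := conjCLM (E.proj (star ⁻¹' s))
  isStarProjection s hs := isStarProjection_conjCLM
    (E.isStarProjection _ (continuous_star.measurable hs))
  univ := by
    ext z
    simp [E.univ]
  inter s t hs ht := by
    ext z
    rw [preimage_inter, E.inter _ _ (continuous_star.measurable hs) (continuous_star.measurable ht)]
    simp
  iUnion f hf hd x := by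
    rw [preimage_iUnion]
    exact (E.iUnion _ (fun i => continuous_star.measurable (hf i))
      (fun i j hij => (hd hij).preimage _) (Complexification.conj x)).map Complexification.conj
        continuous_conj

theorem ProjectionValuedMeasure.measure_conj (E : ProjectionValuedMeasure (Complexification Y))
    (x : Complexification Y) :
    E.conj.measure x = (E.measure (Complexification.conj x)).map star := by
  ext s hs
  rw [Measure.map_apply continuous_star.measurable hs, measure_apply _ _ hs,
    measure_apply _ _ (continuous_star.measurable hs), ← ofReal_norm, ← ofReal_norm]
  exact congrArg (fun r => ENNReal.ofReal r ^ 2) (norm_conj _)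

theorem IsSpectralMeasure.conj {E : ProjectionValuedMeasure (Complexification Y)}
    (hE : IsSpectralMeasure (complexifyOperator A) E) :
    IsSpectralMeasure (complexifyOperator A) E.conj where
  mem_domain_iff x := by
    have h : x ∈ (complexifyOperator A).domain ↔
        Complexification.conj x ∈ (complexifyOperator A).domain :=
      and_congr Iff.rfl (neg_mem_iff (H := A.domain)).symm
    rw [h, hE.mem_domain_iff, E.measure_conj, lintegral_map (by fun_prop) continuous_star.measurable]
    simp
  inner_apply x := by
    have h := hE.inner_of_mem_graph
      (conj_mem_graph_complexifyOperator ((complexifyOperator A).mem_graph x))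
    rw [inner_conj_conj] at h
    rw [← star_star (inner ℂ (x : Complexification Y) _), h, E.measure_conj,
      integral_map continuous_star.measurable.aemeasurable (by fun_prop)]
    exact integral_conj.symm

/-- `E.conj` is a second spectral measure of the same operator and the truncated spectrum is closed
and conjugation invariant, so uniqueness on closed sets applies. -/
theorem conj_galerkinProjector {E : ProjectionValuedMeasure (Complexification Y)}
    (hE : IsSpectralMeasure (complexifyOperator A) E) (hd : Dense (A.domain : Set Y))
    (hcl : A.IsClosed) (m : ℕ) (z : Complexification Y) :
    conj (galerkinProjector (complexifyOperator A) m z) =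
      galerkinProjector (complexifyOperator A) m (conj z) := by
  have hd' := dense_domain_complexifyOperator hd
  have hcl' := isClosed_complexifyOperator hcl
  have hs : star ⁻¹' {z | z ∈ unboundedSpectrum (complexifyOperator A) ∧ ‖z‖ ≤ m} =
      {z | z ∈ unboundedSpectrum (complexifyOperator A) ∧ ‖z‖ ≤ m} := by
    ext z
    exact and_congr star_mem_unboundedSpectrum_iff (by rw [norm_star])
  have h : galerkinProjector (complexifyOperator A) m =
      conjCLM (galerkinProjector (complexifyOperator A) m) := by
    conv_lhs => rw [hE.conj.galerkinProjector_eq hd' hcl']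
    conv_rhs => rw [hE.galerkinProjector_eq hd' hcl', ← hs]
    rfl
  conv_rhs => rw [h]
  rw [conjCLM_apply, conj_conj]

theorem galerkinProjector_mk_zero {E : ProjectionValuedMeasure (Complexification Y)}
    (hE : IsSpectralMeasure (complexifyOperator A) E) (hd : Dense (A.domain : Set Y))
    (hcl : A.IsClosed) (m : ℕ) (x : Y) :
    galerkinProjector (complexifyOperator A) m (mk x 0) = mk (realGalerkinProjector A m x) 0 := by
  refine Complexification.ext rfl ?_
  have h := conj_galerkinProjector hE hd hcl m (mk x 0)
  have h2 : conj (mk x 0) = mk x 0 := by apply Complexification.ext <;> simp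
  rw [h2] at h
  have h3 := congrArg im h
  rw [im_conj] at h3
  have : IsAddTorsionFree Y := .of_isTorsionFree ℝ Y
  exact self_eq_neg.mp h3.symm

/-- Normality is passed on at the level of the resolvent: the real resolvent is normal, hence so is
its complexification, and this suffices for a spectral measure of the complexified operator. -/
theorem real_galerkin_approximation {S : ℝ → Y →L[ℝ] Y} {D : Set Y} {B : Y → Y}
    {T : ℝ} {U₀ : Y} {U : ℝ → Y} {L : ℝ≥0} (hA : IsNormalOperator A) (hS : IsC0Semigroup S)
    (hAS : IsGenerator A S) (hD : IsOpen D) (hB : LipschitzOnWith L B D) (hT : 0 < T)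
    (hU : IsMildSolution S B D T U₀ U) :
    ∃ mstar : ℕ,
      (∀ m ≥ mstar, ∃ u : ℝ → Y, IsProjectedSolution A B D (realGalerkinProjector A m) T U₀ u) ∧
      ∀ u : ℕ → ℝ → Y,
        (∀ m ≥ mstar, IsProjectedSolution A B D (realGalerkinProjector A m) T U₀ (u m)) →
        Tendsto (fun m => ⨆ t : Icc (0 : ℝ) T, ‖U t - u m t‖) atTop (𝓝 0) := by
  obtain ⟨a, R, hR⟩ := exists_isResolvent hA.isClosed hS hAS
  obtain ⟨E, hE⟩ := hR.mapCLM.exists_isSpectralMeasure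
    (isStarNormal_mapCLM (hA.isStarNormal_resolvent hR))
  have hd := dense_domain_complexifyOperator hA.dense_domain
  have hcl := isClosed_complexifyOperator hA.isClosed
  have hm : ∀ m : ℕ, MeasurableSet {z | z ∈ unboundedSpectrum (complexifyOperator A) ∧ ‖z‖ ≤ m} :=
    fun m => (isClosed_spectrum_inter m).measurableSet
  have hP := hE.galerkinProjector_eq hd hcl
  have hP0 := galerkinProjector_mk_zero hE hA.dense_domain hA.isClosed
  choose G hG using fun m : ℕ => hE.exists_bounded_restriction hcl (hm m) fun z hz => hz.2
  refine exists_forall_isProjectedSolution_and_tendsto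
    (P := fun m => reCLM.comp (((galerkinProjector (complexifyOperator A) m).restrictScalars ℝ).comp
      ofRealCLM))
    (G := fun m => reCLM.comp (((G m).restrictScalars ℝ).comp ofRealCLM))
    hA.dense_domain hS hAS (fun m x => ?_) (fun m x => ?_)
    (fun m x => ?_) (fun m x y h => ?_) (fun x => ?_) hD hB hT hU
  · refine (norm_re_le _).trans ?_
    rw [← norm_mk_zero x]
    change ‖galerkinProjector (complexifyOperator A) m (mk x 0)‖ ≤ _
    rw [hP]
    exact E.norm_proj_le (hm m) _
  · change (galerkinProjector (complexifyOperator A) m (mk (realGalerkinProjector A m x) 0)).re =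
      (galerkinProjector (complexifyOperator A) m (mk x 0)).re
    rw [← hP0, hP, E.proj_idem (hm m)]
  · change ((galerkinProjector (complexifyOperator A) m (mk x 0)).re, (G m (mk x 0)).re) ∈ A.graph
    rw [hP]
    exact (mem_graph_complexifyOperator_iff.mp (hG m _)).1
  · change ((galerkinProjector (complexifyOperator A) m (mk x 0)).re,
      (galerkinProjector (complexifyOperator A) m (mk y 0)).re) ∈ A.graph
    have h' : (mk x 0, mk y 0) ∈ (complexifyOperator A).graph :=
      mem_graph_complexifyOperator_iff.mpr ⟨h, A.graph.zero_mem⟩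
    rw [hP]
    exact (mem_graph_complexifyOperator_iff.mp (hE.proj_mem_graph hd (hm m) h')).1
  · exact (reCLM.continuous.tendsto _).comp (hE.tendsto_galerkinProjector hd hcl (mk x 0))

end RealCase

end Galerkin

end

theorem mainTheorem7 :
    -- complex Hilbert spaces
    (∀ (Y : Type*) [NormedAddCommGroup Y] [InnerProductSpace ℂ Y] [CompleteSpace Y]
      (A : Y →ₗ.[ℂ] Y) (S : ℝ → Y →L[ℂ] Y) (D : Set Y) (B : Y → Y) (T : ℝ) (U₀ : Y) (U : ℝ → Y),
      Galerkin.IsNormalOperator A → Galerkin.IsC0Semigroup S → Galerkin.IsGenerator A S →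
      IsOpen D → (∃ L : ℝ≥0, LipschitzOnWith L B D) →
      0 < T → Galerkin.IsMildSolution S B D T U₀ U →
      ∃ mstar : ℕ,
        (∀ m ≥ mstar, ∃ u : ℝ → Y,
          Galerkin.IsProjectedSolution A B D (Galerkin.galerkinProjector A m) T U₀ u) ∧
        ∀ u : ℕ → ℝ → Y,
          (∀ m ≥ mstar,
            Galerkin.IsProjectedSolution A B D (Galerkin.galerkinProjector A m) T U₀ (u m)) →
          Tendsto (fun m => ⨆ t : Icc (0 : ℝ) T, ‖U t - u m t‖) atTop (𝓝 0)) ∧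
    -- real Hilbert spaces
    (∀ (Y : Type*) [NormedAddCommGroup Y] [InnerProductSpace ℝ Y] [CompleteSpace Y]
      (A : Y →ₗ.[ℝ] Y) (S : ℝ → Y →L[ℝ] Y) (D : Set Y) (B : Y → Y) (T : ℝ) (U₀ : Y) (U : ℝ → Y),
      Galerkin.IsNormalOperator A → Galerkin.IsC0Semigroup S → Galerkin.IsGenerator A S →
      IsOpen D → (∃ L : ℝ≥0, LipschitzOnWith L B D) →
      0 < T → Galerkin.IsMildSolution S B D T U₀ U →
      ∃ mstar : ℕ,
        (∀ m ≥ mstar, ∃ u : ℝ → Y,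
          Galerkin.IsProjectedSolution A B D (Galerkin.realGalerkinProjector A m) T U₀ u) ∧
        ∀ u : ℕ → ℝ → Y,
          (∀ m ≥ mstar,
            Galerkin.IsProjectedSolution A B D (Galerkin.realGalerkinProjector A m) T U₀ (u m)) →
          Tendsto (fun m => ⨆ t : Icc (0 : ℝ) T, ‖U t - u m t‖) atTop (𝓝 0)) := by
  refine ⟨fun Y _ _ _ A S D B T U₀ U hA hS hAS hD ⟨L, hB⟩ hT hU => ?_,
    fun Y _ _ _ A S D B T U₀ U hA hS hAS hD ⟨L, hB⟩ hT hU => ?_⟩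
  · exact Galerkin.complex_galerkin_approximation hA hS hAS hD hB hT hU
  · exact Galerkin.real_galerkin_approximation hA hS hAS hD hB hT hU
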